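/- Let $k$ be an algebraically closed field. Use Sweedler notation $\Delta(h)=h_{(1)}\otimes h_{(2)}$. A weak Hopf algebra (finite quantum groupoid) over $k$ is a finite dimensional unital associative algebra $H$ that is also a coassociative counital coalgebra $(H,\Delta,\varepsilon)$ with a linear map $S:H\to H$ such that $\Delta(gh)=\Delta(g)\Delta(h)$, $(\Delta\otimes\mathrm{id})\Delta(1)=(\Delta(1)\otimes1)(1\otimes\Delta(1))=(1\otimes\Delta(1))(\Delta(1)\otimes1)$, $\varepsilon(fgh)=\varepsilon(fg_{(1)})\varepsilon(g_{(2)}h)=\varepsilon(fg_{(2)})\varepsilon(g_{(1)}h)$, $h_{(1)}S(h_{(2)})=\varepsilon_t(h)$, $S(h_{(1)})h_{(2)}=\varepsilon_s(h)$ and $S(h_{(1)})h_{(2)}S(h_{(3)})=S(h)$, where $\varepsilon_t(h)=(\varepsilon\otimes\mathrm{id})(\Delta(1)(h\otimes1))$ and $\varepsilon_s(h)=(\mathrm{id}\otimes\varepsilon)((1\otimes h)\Delta(1))$. Put $H_t=\varepsilon_t(H)$, $H_s=\varepsilon_s(H)$. It is connected if $H_t\cap Z(H)=k1$, where $Z(H)$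 is the center of $H$. It is quasitriangular if it is equipped with $\mathcal R\in\Delta^{op}(1)(H\otimes_k H)\Delta(1)$ such that $\Delta^{op}(h)\mathcal R=\mathcal R\Delta(h)$ for all $h$, $(\mathrm{id}\otimes\Delta)\mathcal R=\mathcal R_{13}\mathcal R_{12}$, $(\Delta\otimes\mathrm{id})\mathcal R=\mathcal R_{13}\mathcal R_{23}$, and there is $\bar{\mathcal R}\in\Delta(1)(H\otimes_k H)\Delta^{op}(1)$ with $\mathcal R\bar{\mathcal R}=\Delta^{op}(1)$ and $\bar{\mathcal R}\mathcal R=\Delta(1)$. It is ribbon if moreover it is equipped with an invertible central $\nu\in H$ with $\Delta(\nu)=\mathcal R_{21}\mathcal R(\nu\otimes\nu)$ and $S(\nu)=\nu$. It is factorizable if the map $F:H^*\to C_H(H_s)$, $F(\phi)=(\phi\otimes\mathrm{id})(\mathcal R_{21}\mathcal R)$, into the centralizer of $H_s$ in $H$, is surjective. A normalized two-sided integral is an element $l\in H$ with $hl=\varepsilon_t(h)l$ and $lh=l\varepsilon_s(h)$ for all $h\in H$, and $\varepsilon_t(l)=\varepsilon_s(l)=1$. For a ribbon $H$, $\mathrm{Rep}(H)$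 is the $k$-linear category of finite dimensional left $H$-modules, with: tensor product $V\otimes W=\{x\in V\otimes_kW : x=\Delta(1)\cdot x\}$, on which $H$ acts through $\Delta$, and the associativity of $\otimes_k$; unit object $H_t$ with $h\cdot z=\varepsilon_t(hz)$, and unit isomorphisms inverse to $v\mapsto \Delta(1)\cdot(1\otimes v)$ (that is, $z\otimes v\mapsto z\cdot v$) and $v\mapsto 1_{(1)}\cdot v\otimes 1_{(2)}$; dual $V^*=\mathrm{Hom}_k(V,k)$ with $(h\cdot\phi)(v)=\phi(S(h)\cdot v)$, evaluation $d_V:V^*\otimes V\to H_t$, $d_V(\sum_j\phi^j\otimes v_j)=\sum_j\phi^j(1_{(1)}\cdot v_j)1_{(2)}$, and coevaluation $b_V:H_t\to V\otimes V^*$, $b_V(z)=z\cdot\sum_ig_i\otimes\gamma^i$ for dual bases $\{g_i\},\{\gamma^i\}$; braiding $c_{V,W}:V\otimes W\to W\otimes V$, $c_{V,W}(x)=\mathcal R^{(2)}\cdot x^{(2)}\otimes\mathcal R^{(1)}\cdot x^{(1)}$; and twist $\theta_V(v)=\nu\cdot v$. This is a $k$-linear ribbon category. The quantum trace of an endomorphism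 $f$ of $V$ is $\mathrm{tr}_q(f)=d_V\,c_{V,V^*}\,(\theta_Vf\otimes\mathrm{id}_{V^*})\,b_V\in\mathrm{End}(H_t)$. Proposition. Let $H\neq0$ be a connected, ribbon, factorizable weak Hopf algebra over the algebraically closed field $k$ that possesses a normalized two-sided integral. Then $\mathrm{Rep}(H)$ is a modular category. Explicitly, there is a finite family $V_1,\dots,V_n$ of representatives of the isomorphism classes of irreducible finite dimensional $H$-modules (each class being represented exactly once) such that: (0) every $V_i$ is simple in the sense that each endomorphism of $V_i$ is multiplication by a unique scalar in $k$; (i) some $V_i$ is the unit object $H_t$; (ii) for every $i$ there is $i^*$ with $V_{i^*}\cong V_i^*$; (iii) every object $V$ is dominated by the family, i.e. $\mathrm{id}_V=\sum_r f_rg_r$ for finitely many morphisms $g_r:V\to V_{i(r)}$, $f_r:V_{i(r)}\to V$; (iv) the quantum traces $\mathrm{tr}_q(c_{V_i,V_j}\circ c_{V_j,V_i})$ are scalars $S_{ij}\in k$ (multiples of $\mathrm{id}_{H_t}$), and the square matrix $S=(S_{ij})_{1\le i,j\le n}$ is invertible over $k$. -/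

import Mathlib

open TensorProduct CategoryTheory MonoidalCategory

universe u

set_option linter.unusedSectionVars false

noncomputable section

namespace WeakHopf

section Sweedler

variable (k : Type*) [Field k] {L M N P Q : Type*}
  [AddCommGroup L] [Module k L] [AddCommGroup M] [Module k M]
  [AddCommGroup N] [Module k N] [AddCommGroup P] [Module k P] [AddCommGroup Q] [Module k Q]

/-- Linearity of an unbundled function. -/
@[fun_prop]
structure Lin (f : M → N) : Prop where
  map_add : ∀ x y, f (x + y) = f x + f y
  map_smul : ∀ (c : k) x, f (c • x) = c • f x

variable {k}

@[fun_prop] theorem Lin.id' : Lin k (fun x : M => x) := ⟨fun _ _ => rfl, fun _ _ => rfl⟩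

@[fun_prop] theorem Lin.zero' : Lin k (fun _ : M => (0 : N)) := ⟨by simp, by simp⟩

@[fun_prop] theorem Lin.comp' {f : N → P} {g : M → N} (hf : Lin k f) (hg : Lin k g) :
    Lin k (fun x => f (g x)) :=
  ⟨fun x y => by rw [hg.map_add, hf.map_add], fun c x => by rw [hg.map_smul, hf.map_smul]⟩

@[fun_prop] theorem Lin.coe (f : M →ₗ[k] N) : Lin k (fun x => f x) := ⟨by simp, by simp⟩

@[fun_prop] theorem Lin.coe_left {g : L → (M →ₗ[k] N)} (hg : Lin k g) (m : M) :
    Lin k (fun x => g x m) := ⟨fun x y => by simp [hg.map_add], fun c x => by simp [hg.map_smul]⟩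

@[fun_prop] theorem Lin.tmul_left {g : L → M} (hg : Lin k g) (n : N) :
    Lin k (fun x => g x ⊗ₜ[k] n) :=
  ⟨fun x y => by simp [hg.map_add, add_tmul], fun c x => by simp [hg.map_smul, smul_tmul']⟩

@[fun_prop] theorem Lin.tmul_right {g : L → M} (hg : Lin k g) (n : N) :
    Lin k (fun x => n ⊗ₜ[k] g x) :=
  ⟨fun x y => by simp [hg.map_add, tmul_add], fun c x => by simp [hg.map_smul]⟩

@[fun_prop] theorem Lin.mul_left {A : Type*} [Ring A] [Algebra k A] {g : L → A} (hg : Lin k g)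
    (a : A) : Lin k (fun x => g x * a) :=
  ⟨fun x y => by simp [hg.map_add, add_mul], fun c x => by simp [hg.map_smul]⟩

@[fun_prop] theorem Lin.mul_right {A : Type*} [Ring A] [Algebra k A] {g : L → A} (hg : Lin k g)
    (a : A) : Lin k (fun x => a * g x) :=
  ⟨fun x y => by simp [hg.map_add, mul_add], fun c x => by simp [hg.map_smul]⟩

@[fun_prop] theorem Lin.smul_left {A : Type*} [Ring A] [Algebra k A] [Module A M]
    [IsScalarTower k A M] {g : L → A} (hg : Lin k g) (m : M) : Lin k (fun x => g x • m) :=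
  ⟨fun x y => by simp [hg.map_add, add_smul], fun c x => by simp [hg.map_smul]⟩

@[fun_prop] theorem Lin.smul_right {A : Type*} [Ring A] [Algebra k A] [Module A M]
    [IsScalarTower k A M] {g : L → M} (hg : Lin k g) (a : A) : Lin k (fun x => a • g x) :=
  ⟨fun x y => by simp [hg.map_add, smul_add], fun c x => by
    rw [hg.map_smul, ← algebraMap_smul A c (g x), ← algebraMap_smul A c (a • g x), smul_smul,
      smul_smul, Algebra.commutes]⟩

@[fun_prop] theorem Lin.scalar_smul {g : L → k} (hg : Lin k g) (m : M) :
    Lin k (fun x => g x • m) :=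
  ⟨fun x y => by simp [hg.map_add, add_smul], fun c x => by simp [hg.map_smul, mul_smul]⟩

@[fun_prop] theorem Lin.smul_scalar {g : L → M} (hg : Lin k g) (a : k) :
    Lin k (fun x => a • g x) :=
  ⟨fun x y => by simp [hg.map_add], fun c x => by simp [hg.map_smul, smul_comm c a]⟩

/-- Bundle an unbundled linear function. -/
def Lin.mk' {f : M → N} (hf : Lin k f) : M →ₗ[k] N :=
  { toFun := f, map_add' := hf.map_add, map_smul' := hf.map_smul }

/-- Sweedler sum: `ts t f = ∑ f (t₁) (t₂)` for a chosen presentation `t = ∑ t₁ ⊗ t₂`; for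
bilinear `f` the value does not depend on the presentation. -/
def ts (t : M ⊗[k] N) (f : M → N → P) : P :=
  ∑ p ∈ (TensorProduct.exists_finset t).choose, f p.1 p.2

theorem ts_tmul_self (t : M ⊗[k] N) : ts t (fun a b => a ⊗ₜ[k] b) = t :=
  (TensorProduct.exists_finset t).choose_spec.symm

theorem Lin.map_ts {g : P → Q} (hg : Lin k g) (t : M ⊗[k] N) (f : M → N → P) :
    g (ts t f) = ts t (fun a b => g (f a b)) := by
  have := map_sum hg.mk' (fun p : M × N => f p.1 p.2) (TensorProduct.exists_finset t).choose
  exact this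

/-- The linear map attached to an unbundled bilinear function. -/
def lift2 (f : M → N → P) (h1 : ∀ b, Lin k fun a => f a b) (h2 : ∀ a, Lin k fun b => f a b) :
    M ⊗[k] N →ₗ[k] P :=
  TensorProduct.lift (LinearMap.mk₂ k f (fun _ _ _ => (h1 _).map_add _ _)
    (fun _ _ _ => (h1 _).map_smul _ _) (fun _ _ _ => (h2 _).map_add _ _)
    (fun _ _ _ => (h2 _).map_smul _ _))

theorem ts_eq_lift2 (t : M ⊗[k] N) {f : M → N → P} (h1 : ∀ b, Lin k fun a => f a b)
    (h2 : ∀ a, Lin k fun b => f a b) : ts t f = lift2 f h1 h2 t := by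
  conv_rhs => rw [← ts_tmul_self t]
  rw [Lin.map_ts (Lin.coe (lift2 f h1 h2))]
  simp [lift2]

theorem ts_tmul (a : M) (b : N) {f : M → N → P} (h1 : ∀ b, Lin k fun a => f a b)
    (h2 : ∀ a, Lin k fun b => f a b) : ts (a ⊗ₜ[k] b) f = f a b := by
  rw [ts_eq_lift2 _ h1 h2]; simp [lift2]

@[fun_prop] theorem Lin.ts_left {g : L → M ⊗[k] N} (hg : Lin k g) {f : M → N → P}
    (h1 : ∀ b, Lin k fun a => f a b) (h2 : ∀ a, Lin k fun b => f a b) :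
    Lin k (fun x => ts (g x) f) := by
  simp only [ts_eq_lift2 _ h1 h2]; fun_prop

@[fun_prop] theorem Lin.ts_right (t : M ⊗[k] N) {f : L → M → N → P}
    (h : ∀ a b, Lin k fun x => f x a b) : Lin k (fun x => ts t (f x)) :=
  ⟨fun x y => by simp [ts, (h _ _).map_add, Finset.sum_add_distrib],
   fun c x => by simp [ts, (h _ _).map_smul, Finset.smul_sum]⟩

theorem ts_congr (t : M ⊗[k] N) {f g : M → N → P} (h : ∀ a b, f a b = g a b) :
    ts t f = ts t g := by
  congr; funext a b; exact h a b

theorem ts_comm {M' N' : Type*} [AddCommGroup M'] [Module k M'] [AddCommGroup N'] [Module k N']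
    (t : M ⊗[k] N) (s : M' ⊗[k] N') (f : M → N → M' → N' → P) :
    ts t (fun a b => ts s fun c d => f a b c d) = ts s fun c d => ts t fun a b => f a b c d :=
  Finset.sum_comm

/-- Sweedler sums may be computed after any linear map out of the tensor product. -/
theorem ts_map {M' N' : Type*} [AddCommGroup M'] [Module k M'] [AddCommGroup N'] [Module k N']
    (t : M ⊗[k] N) {g : M → N → M' ⊗[k] N'}
    {f : M' → N' → P} (h1 : ∀ b, Lin k fun a => f a b) (h2 : ∀ a, Lin k fun b => f a b) :
    ts (ts t g) f = ts t (fun a b => ts (g a b) f) :=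
  Lin.map_ts (g := fun t => ts t f) (by fun_prop) t g

theorem ts_mul {A B : Type*} [Ring A] [Algebra k A] [Ring B] [Algebra k B] (t s : A ⊗[k] B)
    {f : A → B → P} (h1 : ∀ b, Lin k fun a => f a b) (h2 : ∀ a, Lin k fun b => f a b) :
    ts (t * s) f = ts t fun a b => ts s fun c d => f (a * c) (b * d) := by
  have : t * s = ts t fun a b => ts s fun c d => (a * c) ⊗ₜ[k] (b * d) := by
    conv_lhs => rw [← ts_tmul_self t, ← ts_tmul_self s]
    simp only [ts, Finset.sum_mul, Finset.mul_sum, Algebra.TensorProduct.tmul_mul_tmul]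
    exact Finset.sum_comm
  rw [this, ts_map _ h1 h2]
  simp only [ts_map _ h1 h2, ts_tmul _ _ h1 h2]

end Sweedler

/-! ### Weak Hopf algebras -/

section Definitions

variable (k H : Type*) [Field k] [Ring H] [Algebra k H] [Coalgebra k H]

/-- The target counital map `ε_t(h) = (ε ⊗ id)(Δ(1)(h ⊗ 1))`. -/
def targetCounit : H →ₗ[k] H :=
  (TensorProduct.lid k H).toLinearMap ∘ₗ LinearMap.rTensor H Coalgebra.counit ∘ₗ
    LinearMap.mulLeft k (Coalgebra.comul (R := k) (1 : H)) ∘ₗ (TensorProduct.mk k H H).flip 1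

/-- The source counital map `ε_s(h) = (id ⊗ ε)((1 ⊗ h)Δ(1))`. -/
def sourceCounit : H →ₗ[k] H :=
  (TensorProduct.rid k H).toLinearMap ∘ₗ LinearMap.lTensor H Coalgebra.counit ∘ₗ
    LinearMap.mulRight k (Coalgebra.comul (R := k) (1 : H)) ∘ₗ TensorProduct.mk k H H 1

end Definitions

/-- A weak Hopf algebra (quantum groupoid) over a field `k`: an algebra and a coalgebra with
compatibility axioms weaker than those of a Hopf algebra, and an antipode. Products of tensors
are taken in the tensor product algebras. -/
class WeakHopfAlgebra (k H : Type*) [Field k] [Ring H] [Algebra k H] extends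
    Coalgebra k H where
  /-- `Δ(g h) = Δ(g) Δ(h)`. -/
  comul_mul : ∀ g h : H, comul (g * h) = comul g * comul h
  /-- `(Δ ⊗ id)Δ(1) = (Δ(1) ⊗ 1)(1 ⊗ Δ(1))`. -/
  comul_one_left : LinearMap.rTensor H comul (comul (1 : H)) =
    (comul 1 ⊗ₜ[k] (1 : H)) * (TensorProduct.assoc k H H H).symm (1 ⊗ₜ[k] comul 1)
  /-- `(Δ ⊗ id)Δ(1) = (1 ⊗ Δ(1))(Δ(1) ⊗ 1)`. -/
  comul_one_right : LinearMap.rTensor H comul (comul (1 : H)) =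
    (TensorProduct.assoc k H H H).symm (1 ⊗ₜ[k] comul 1) * (comul 1 ⊗ₜ[k] (1 : H))
  /-- `ε(f g h) = ε(f g₁) ε(g₂ h)`. -/
  counit_mul_mul : ∀ f g h : H, counit (f * g * h) =
    LinearMap.mul' k k (TensorProduct.map (counit ∘ₗ LinearMap.mulLeft k f)
      (counit ∘ₗ LinearMap.mulRight k h) (comul g))
  /-- `ε(f g h) = ε(f g₂) ε(g₁ h)`. -/
  counit_mul_mul_op : ∀ f g h : H, counit (f * g * h) =
    LinearMap.mul' k k (TensorProduct.map (counit ∘ₗ LinearMap.mulLeft k f)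
      (counit ∘ₗ LinearMap.mulRight k h) (TensorProduct.comm k H H (comul g)))
  /-- The antipode. -/
  antipode : H →ₗ[k] H
  /-- `m(id ⊗ S)Δ(h) = ε_t(h)`. -/
  mul_antipode : ∀ h : H,
    LinearMap.mul' k H (LinearMap.lTensor H antipode (comul h)) = targetCounit k H h
  /-- `m(S ⊗ id)Δ(h) = ε_s(h)`. -/
  antipode_mul : ∀ h : H,
    LinearMap.mul' k H (LinearMap.rTensor H antipode (comul h)) = sourceCounit k H h
  /-- `m(m ⊗ id)(S ⊗ id ⊗ S)(Δ ⊗ id)Δ(h) = S(h)`. -/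
  antipode_mul_antipode : ∀ h : H,
    LinearMap.mul' k H (TensorProduct.map (LinearMap.mul' k H ∘ₗ LinearMap.rTensor H antipode)
      antipode (LinearMap.rTensor H comul (comul h))) = antipode h

section Basic

variable {k H : Type*} [Field k] [Ring H] [Algebra k H] [WeakHopfAlgebra k H]
  {P : Type*} [AddCommGroup P] [Module k P]

local notation "δ" => (Coalgebra.comul : H →ₗ[k] H ⊗[k] H)
local notation "ϵ" => (Coalgebra.counit : H →ₗ[k] k)
local notation "εt" => targetCounit k H
local notation "εs" => sourceCounit k H
local notation "σ" => (WeakHopfAlgebra.antipode : H →ₗ[k] H)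

theorem sw_mul (x y : H) {f : H → H → P} (h1 : ∀ b, Lin k fun a => f a b)
    (h2 : ∀ a, Lin k fun b => f a b) :
    ts (δ (x * y)) f = ts (δ x) fun a b => ts (δ y) fun c d => f (a * c) (b * d) := by
  rw [WeakHopfAlgebra.comul_mul, ts_mul _ _ h1 h2]

theorem sw_coassoc (x : H) {f : H → H → H → P} (h1 : ∀ b c, Lin k fun a => f a b c)
    (h2 : ∀ a c, Lin k fun b => f a b c) (h3 : ∀ a b, Lin k fun c => f a b c) :
    ts (δ x) (fun a b => ts (δ a) fun c d => f c d b) =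
      ts (δ x) fun a b => ts (δ b) fun c d => f a c d := by
  have e := Coalgebra.coassoc_apply (R := k) x
  have e2 : LinearMap.lTensor H δ (δ x) = ts (δ x) fun a b => ts (δ b) fun c d => a ⊗ₜ (c ⊗ₜ d) := by
    conv_lhs => rw [← ts_tmul_self (δ x)]
    rw [Lin.map_ts (Lin.coe _)]
    congr; ext a b
    rw [LinearMap.lTensor_tmul]
    conv_lhs => rw [← ts_tmul_self (δ b)]
    rw [Lin.map_ts (g := fun t => a ⊗ₜ[k] t) (by fun_prop)]
  have e1 : TensorProduct.assoc k H H H (LinearMap.rTensor H δ (δ x)) =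
      ts (δ x) fun a b => ts (δ a) fun c d => c ⊗ₜ (d ⊗ₜ b) := by
    conv_lhs => rw [← ts_tmul_self (δ x)]
    rw [Lin.map_ts (g := fun t => TensorProduct.assoc k H H H (LinearMap.rTensor H δ t))
      ⟨by simp, by simp⟩]
    congr; ext a b
    rw [LinearMap.rTensor_tmul]
    conv_lhs => rw [← ts_tmul_self (δ a)]
    rw [Lin.map_ts (g := fun t => TensorProduct.assoc k H H H (t ⊗ₜ[k] b))
      ⟨by simp [add_tmul], fun c x => by simp [← smul_tmul']⟩]
    simp
  rw [e1, e2] at e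
  have hL : Lin k (fun t : H ⊗[k] (H ⊗[k] H) => ts t fun a s => ts s fun b c => f a b c) := by
    fun_prop
  have := congrArg (fun t => ts t fun a s => ts s fun b c => f a b c) e
  simp only [hL.map_ts] at this
  simp (disch := fun_prop) only [ts_tmul] at this
  exact this

theorem sw_counit_left (x : H) {f : H → P} (hf : Lin k f) :
    ts (δ x) (fun a b => ϵ a • f b) = f x := by
  have e := congrArg (fun t => f (TensorProduct.lid k H t)) (Coalgebra.rTensor_counit_comul (R := k) x)
  simp only [lid_tmul, one_smul] at e
  rw [← e]
  conv_rhs => rw [← ts_tmul_self (δ x)]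
  rw [Lin.map_ts (Lin.coe _), Lin.map_ts (g := fun t => f (TensorProduct.lid k H t))]
  · simp [hf.map_smul]
  · exact hf.comp' (Lin.coe (TensorProduct.lid k H).toLinearMap)

theorem sw_counit_right (x : H) {f : H → P} (hf : Lin k f) :
    ts (δ x) (fun a b => ϵ b • f a) = f x := by
  have e := congrArg (fun t => f (TensorProduct.rid k H t)) (Coalgebra.lTensor_counit_comul (R := k) x)
  simp only [rid_tmul, one_smul] at e
  rw [← e]
  conv_rhs => rw [← ts_tmul_self (δ x)]
  rw [Lin.map_ts (Lin.coe _), Lin.map_ts (g := fun t => f (TensorProduct.rid k H t))]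
  · simp [hf.map_smul]
  · exact hf.comp' (Lin.coe (TensorProduct.rid k H).toLinearMap)

theorem sw_one_left {f : H → H → H → P} (h1 : ∀ b c, Lin k fun a => f a b c)
    (h2 : ∀ a c, Lin k fun b => f a b c) (h3 : ∀ a b, Lin k fun c => f a b c) :
    ts (δ 1) (fun a b => ts (δ b) fun c d => f a c d) =
      ts (δ 1) fun a b => ts (δ 1) fun c d => f a (b * c) d := by
  rw [← sw_coassoc _ h1 h2 h3]
  have hL : Lin k (fun t : (H ⊗[k] H) ⊗[k] H => ts t fun s c => ts s fun a b => f a b c) := by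
    fun_prop
  have e := congrArg (fun t => ts t fun s c => ts s fun a b => f a b c)
    (WeakHopfAlgebra.comul_one_left (k := k) (H := H))
  have e1 : LinearMap.rTensor H δ (δ 1) = ts (δ 1) fun a b => δ a ⊗ₜ b := by
    conv_lhs => rw [← ts_tmul_self (δ 1)]
    rw [Lin.map_ts (Lin.coe _)]
    simp
  have e2 : (δ 1 ⊗ₜ[k] (1 : H)) * (TensorProduct.assoc k H H H).symm (1 ⊗ₜ[k] δ 1) =
      ts (δ 1) fun a b => ts (δ 1) fun c d => (a ⊗ₜ (b * c)) ⊗ₜ d := by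
    conv_lhs => rw [← ts_tmul_self (δ 1)]
    simp [ts, sum_tmul, tmul_sum, Finset.sum_mul, Finset.mul_sum]
    exact Finset.sum_comm
  rw [e1, e2] at e
  simp only [hL.map_ts] at e
  simp (disch := fun_prop) only [ts_tmul] at e
  exact e

theorem sw_one_right {f : H → H → H → P} (h1 : ∀ b c, Lin k fun a => f a b c)
    (h2 : ∀ a c, Lin k fun b => f a b c) (h3 : ∀ a b, Lin k fun c => f a b c) :
    ts (δ 1) (fun a b => ts (δ b) fun c d => f a c d) =
      ts (δ 1) fun a b => ts (δ 1) fun c d => f a (c * b) d := by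
  rw [← sw_coassoc _ h1 h2 h3]
  have hL : Lin k (fun t : (H ⊗[k] H) ⊗[k] H => ts t fun s c => ts s fun a b => f a b c) := by
    fun_prop
  have e := congrArg (fun t => ts t fun s c => ts s fun a b => f a b c)
    (WeakHopfAlgebra.comul_one_right (k := k) (H := H))
  have e1 : LinearMap.rTensor H δ (δ 1) = ts (δ 1) fun a b => δ a ⊗ₜ b := by
    conv_lhs => rw [← ts_tmul_self (δ 1)]
    rw [Lin.map_ts (Lin.coe _)]
    simp
  have e2 : (TensorProduct.assoc k H H H).symm (1 ⊗ₜ[k] δ 1) * (δ 1 ⊗ₜ[k] (1 : H)) =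
      ts (δ 1) fun a b => ts (δ 1) fun c d => (a ⊗ₜ (c * b)) ⊗ₜ d := by
    conv_lhs => rw [← ts_tmul_self (δ 1)]
    simp [ts, sum_tmul, tmul_sum, Finset.sum_mul, Finset.mul_sum]
  rw [e1, e2] at e
  simp only [hL.map_ts] at e
  simp (disch := fun_prop) only [ts_tmul] at e
  exact e

theorem counit_mul (f g h : H) : ϵ (f * g * h) = ts (δ g) fun a b => ϵ (f * a) * ϵ (b * h) := by
  rw [WeakHopfAlgebra.counit_mul_mul]
  conv_lhs => rw [← ts_tmul_self (δ g)]
  simp [ts]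

theorem counit_mul_op (f g h : H) :
    ϵ (f * g * h) = ts (δ g) fun a b => ϵ (f * b) * ϵ (a * h) := by
  rw [WeakHopfAlgebra.counit_mul_mul_op]
  conv_lhs => rw [← ts_tmul_self (δ g)]
  simp [ts]

theorem targetCounit_eq (h : H) : εt h = ts (δ 1) fun a b => ϵ (a * h) • b := by
  simp only [targetCounit, LinearMap.comp_apply, LinearMap.flip_apply, TensorProduct.mk_apply,
    LinearMap.mulLeft_apply]
  conv_lhs => rw [← ts_tmul_self (δ 1)]
  simp [ts, Finset.sum_mul]

theorem sourceCounit_eq (h : H) : εs h = ts (δ 1) fun a b => ϵ (h * b) • a := by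
  simp only [sourceCounit, LinearMap.comp_apply, TensorProduct.mk_apply,
    LinearMap.mulRight_apply]
  conv_lhs => rw [← ts_tmul_self (δ 1)]
  simp [ts, Finset.mul_sum]

theorem sw_mul_antipode (h : H) : ts (δ h) (fun a b => a * σ b) = εt h := by
  rw [← WeakHopfAlgebra.mul_antipode]
  conv_rhs => rw [← ts_tmul_self (δ h)]
  simp [ts]

theorem sw_antipode_mul (h : H) : ts (δ h) (fun a b => σ a * b) = εs h := by
  rw [← WeakHopfAlgebra.antipode_mul]
  conv_rhs => rw [← ts_tmul_self (δ h)]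
  simp [ts]

theorem sw_antipode_mul_antipode (h : H) : 
    ts (δ h) (fun a b => ts (δ b) fun c d => σ a * c * σ d) = σ h := by
  rw [← WeakHopfAlgebra.antipode_mul_antipode,
    ← sw_coassoc h (f := fun a c d => σ a * c * σ d) (by fun_prop) (by fun_prop) (by fun_prop)]
  conv_rhs => rw [← ts_tmul_self (δ h)]
  rw [Lin.map_ts (Lin.coe _), Lin.map_ts (Lin.coe _), Lin.map_ts (Lin.coe _)]
  refine ts_congr _ fun a b => ?_
  rw [LinearMap.rTensor_tmul]
  conv_rhs => rw [← ts_tmul_self (δ a)]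
  simp [ts, Finset.sum_mul]

/-- `1₁ ⊗ ε(h₁1₂)h₂ = 1₁ ⊗ h1₂`. -/
theorem sw_aux1 (h : H) {f : H → H → P} (h1 : ∀ b, Lin k fun a => f a b)
    (h2 : ∀ a, Lin k fun b => f a b) :
    ts (δ 1) (fun c d => ts (δ h) fun a b => ϵ (a * d) • f c b) =
      ts (δ 1) fun c d => f c (h * d) := by
  conv_lhs => rw [← mul_one h]
  simp (disch := fun_prop) only [sw_mul h 1]
  simp only [ts_comm (δ h) (δ 1), mul_assoc]
  rw [← sw_one_right (f := fun c d b' => ts (δ h) fun a b => ϵ (a * d) • f c (b * b'))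
    (by fun_prop) (by fun_prop) (by fun_prop)]
  refine ts_congr _ fun c d => ?_
  rw [ts_comm, ← sw_mul h d (f := fun x y => ϵ x • f c y) (by fun_prop) (by fun_prop)]
  exact sw_counit_left _ (by fun_prop)

/-- `1₁ ⊗ ε(1₂h₁)h₂ = 1₁ ⊗ 1₂h`. -/
theorem sw_aux2 (h : H) {f : H → H → P} (h1 : ∀ b, Lin k fun a => f a b)
    (h2 : ∀ a, Lin k fun b => f a b) :
    ts (δ 1) (fun c d => ts (δ h) fun a b => ϵ (d * a) • f c b) =
      ts (δ 1) fun c d => f c (d * h) := by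
  conv_lhs => rw [← one_mul h]
  simp (disch := fun_prop) only [sw_mul 1 h]
  simp only [← mul_assoc]
  rw [← sw_one_left (f := fun c d b' => ts (δ h) fun a b => ϵ (d * a) • f c (b' * b))
    (by fun_prop) (by fun_prop) (by fun_prop)]
  refine ts_congr _ fun c d => ?_
  rw [← sw_mul d h (f := fun x y => ϵ x • f c y) (by fun_prop) (by fun_prop)]
  exact sw_counit_left _ (by fun_prop)

/-- `h₁ ⊗ ε_t(h₂) = 1₁h ⊗ 1₂`. -/
theorem sw_targetCounit_right (h : H) {f : H → H → P} (h1 : ∀ b, Lin k fun a => f a b)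
    (h2 : ∀ a, Lin k fun b => f a b) :
    ts (δ h) (fun a b => f a (εt b)) = ts (δ 1) fun a b => f (a * h) b := by
  have e : ∀ a b, f a (εt b) = ts (δ 1) fun c d => ϵ (c * b) • f a d := fun a b => by
    rw [targetCounit_eq, (h2 a).map_ts]; simp only [(h2 a).map_smul]
  simp only [e]
  conv_lhs => rw [← one_mul h]
  rw [sw_mul _ _ (by fun_prop) (by fun_prop)]
  simp only [ts_comm (δ h) (δ 1), ← mul_assoc]
  rw [← sw_one_right (f := fun p q r => ts (δ h) fun c d => ϵ (q * d) • f (p * c) r)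
    (by fun_prop) (by fun_prop) (by fun_prop),
    ← sw_coassoc _ (by fun_prop) (by fun_prop) (by fun_prop)]
  refine ts_congr _ fun a b => ?_
  rw [← sw_mul a h (f := fun c d => ϵ d • f c b) (by fun_prop) (by fun_prop)]
  exact sw_counit_right (a * h) (f := fun c => f c b) (by fun_prop)

/-- `ε_s(h₁) ⊗ h₂ = 1₁ ⊗ h1₂`. -/
theorem sw_sourceCounit_left (h : H) {f : H → H → P} (h1 : ∀ b, Lin k fun a => f a b)
    (h2 : ∀ a, Lin k fun b => f a b) :
    ts (δ h) (fun a b => f (εs a) b) = ts (δ 1) fun a b => f a (h * b) := by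
  have e : ∀ a b, f (εs a) b = ts (δ 1) fun c d => ϵ (a * d) • f c b := fun a b => by
    rw [sourceCounit_eq, (h1 b).map_ts]; simp only [(h1 b).map_smul]
  simp only [e]
  rw [ts_comm, sw_aux1 h h1 h2]

/-- `ε(h₁g)h₂ = h ε_t(g)`. -/
theorem sw_counit_mul_left (h g : H) : ts (δ h) (fun a b => ϵ (a * g) • b) = h * εt g := by
  have e : ∀ a, ϵ (a * g) = ts (δ 1) fun c d => ϵ (a * d) * ϵ (c * g) := fun a => by
    rw [← counit_mul_op, mul_one]
  have e2 : ∀ a b, ϵ (a * g) • b = ts (δ 1) fun c d => ϵ (a * d) • (ϵ (c * g) • b) :=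
    fun a b => by
      rw [e, Lin.map_ts (g := fun x : k => (x • b : H)) (by fun_prop)]
      exact ts_congr _ fun c d => mul_smul _ _ _
  conv_lhs => enter [2, a, b]; rw [e2]
  rw [ts_comm, sw_aux1 h (f := fun c b => ϵ (c * g) • b) (by fun_prop) (by fun_prop),
    targetCounit_eq, Lin.map_ts (g := fun x => h * x) (by fun_prop)]
  simp

/-- `ε_t(h₁) ⊗ h₂ = ε_t(1₁) ⊗ 1₂h`. -/
theorem sw_targetCounit_left (h : H) {f : H → H → P} (h1 : ∀ b, Lin k fun a => f a b)
    (h2 : ∀ a, Lin k fun b => f a b) :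
    ts (δ h) (fun a b => f (εt a) b) = ts (δ 1) fun a b => f (εt a) (b * h) := by
  have e : ∀ a b, f (εt a) b = ts (δ 1) fun c d => ϵ (c * a) • f d b := fun a b => by
    rw [targetCounit_eq, (h1 b).map_ts]; simp only [(h1 b).map_smul]
  have e2 : ∀ a c, ϵ (c * a) = ts (δ 1) fun p q => ϵ (c * p) * ϵ (q * a) := fun a c => by
    rw [← counit_mul, mul_one]
  have e3 : ∀ a b, f (εt a) b = ts (δ 1) fun p q => ϵ (q * a) • f (εt p) b := fun a b => by
    simp only [e]
    conv_lhs => enter [2, c, d]; rw [e2, Lin.map_ts (g := fun x : k => (x • f d b : P)) (by fun_prop)]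
    rw [ts_comm]
    refine ts_congr _ fun p q => ?_
    rw [Lin.map_ts (g := fun x => ϵ (q * a) • x) (by fun_prop)]
    refine ts_congr _ fun c d => ?_
    rw [mul_comm, mul_smul]
  conv_lhs => enter [2, a, b]; rw [e3]
  rw [ts_comm, sw_aux2 h (f := fun p b => f (εt p) b) (by fun_prop) (by fun_prop)]

theorem targetCounit_mul_targetCounit (h x : H) : εt (h * εt x) = εt (h * x) := by
  simp only [targetCounit_eq (h * _)]
  refine ts_congr _ fun a b => ?_
  congr 1
  rw [targetCounit_eq, Lin.map_ts (g := fun y => ϵ (a * (h * y))) (by fun_prop), ← mul_assoc a h x,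
    ← mul_one (a * h), counit_mul_op]
  refine ts_congr _ fun c d => ?_
  simp [mul_assoc, mul_comm]

theorem sourceCounit_mul_sourceCounit (h x : H) : εs (εs h * x) = εs (h * x) := by
  simp only [sourceCounit_eq (_ * x)]
  refine ts_congr _ fun a b => ?_
  congr 1
  rw [sourceCounit_eq, Lin.map_ts (g := fun y => ϵ (y * x * b)) (by fun_prop), mul_assoc h x b,
    ← mul_one h, mul_assoc h 1, ← mul_assoc, counit_mul_op]
  refine ts_congr _ fun c d => ?_
  simp [mul_assoc]

theorem targetCounit_idem (x : H) : εt (εt x) = εt x := by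
  simpa using targetCounit_mul_targetCounit (k := k) 1 x

theorem sourceCounit_idem (x : H) : εs (εs x) = εs x := by
  simpa using sourceCounit_mul_sourceCounit (k := k) x 1

theorem targetCounit_one : εt 1 = 1 := by
  rw [targetCounit_eq]; simpa using sw_counit_left (1 : H) Lin.id'

theorem sourceCounit_one : εs 1 = 1 := by
  rw [sourceCounit_eq]; simpa using sw_counit_right (1 : H) Lin.id'

theorem counit_targetCounit (x : H) : ϵ (εt x) = ϵ x := by
  rw [targetCounit_eq, Lin.map_ts (Lin.coe _)]
  have e := sw_counit_right (k := k) (1 : H) (f := fun a => ϵ (a * x)) (by fun_prop)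
  simpa only [map_smul, smul_eq_mul, one_mul, mul_comm (ϵ (_ * x))] using e

/-- `Δ(z) = 1₁z ⊗ 1₂` for `z` in the target subalgebra. -/
theorem sw_target {z : H} (hz : εt z = z) {f : H → H → P} (h1 : ∀ b, Lin k fun a => f a b)
    (h2 : ∀ a, Lin k fun b => f a b) :
    ts (δ z) f = ts (δ 1) fun a b => f (a * z) b := by
  conv_lhs => rw [← hz, targetCounit_eq, Lin.map_ts (g := fun x => ts (δ x) f) (by fun_prop)]
  conv_rhs => 
    enter [2, a, b]
    rw [← hz, targetCounit_eq, Lin.map_ts (g := fun x => f (a * x) b) (by fun_prop)]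
  rw [ts_comm]
  have := sw_one_right (k := k) (f := fun p q r => ϵ (p * z) • f q r)
    (by fun_prop) (by fun_prop) (by fun_prop)
  refine Eq.trans (Eq.trans (ts_congr _ fun a b => ?_) this) (ts_congr _ fun a b =>
    ts_congr _ fun c d => ?_)
  · rw [map_smul, Lin.map_smul (f := fun x => ts x f) (by fun_prop),
      Lin.map_ts (g := fun x => ϵ (a * z) • x) (by fun_prop)]
  · rw [mul_smul_comm, (h1 _).map_smul]

/-- `Δ(z) = z1₁ ⊗ 1₂` for `z` in the target subalgebra. -/
theorem sw_target' {z : H} (hz : εt z = z) {f : H → H → P} (h1 : ∀ b, Lin k fun a => f a b)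
    (h2 : ∀ a, Lin k fun b => f a b) :
    ts (δ z) f = ts (δ 1) fun a b => f (z * a) b := by
  conv_lhs => rw [← hz, targetCounit_eq, Lin.map_ts (g := fun x => ts (δ x) f) (by fun_prop)]
  conv_rhs => 
    enter [2, a, b]
    rw [← hz, targetCounit_eq, Lin.map_ts (g := fun x => f (x * a) b) (by fun_prop)]
  rw [ts_comm]
  have := sw_one_left (k := k) (f := fun p q r => ϵ (p * z) • f q r)
    (by fun_prop) (by fun_prop) (by fun_prop)
  refine Eq.trans (Eq.trans (ts_congr _ fun a b => ?_) this) (ts_congr _ fun a b =>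
    ts_congr _ fun c d => ?_)
  · rw [map_smul, Lin.map_smul (f := fun x => ts x f) (by fun_prop),
      Lin.map_ts (g := fun x => ϵ (a * z) • x) (by fun_prop)]
  · rw [smul_mul_assoc, (h1 _).map_smul]

/-- `Δ(y) = 1₁ ⊗ y1₂` for `y` in the source subalgebra. -/
theorem sw_source {y : H} (hy : εs y = y) {f : H → H → P} (h1 : ∀ b, Lin k fun a => f a b)
    (h2 : ∀ a, Lin k fun b => f a b) :
    ts (δ y) f = ts (δ 1) fun a b => f a (y * b) := by
  conv_lhs => rw [← hy, sourceCounit_eq, Lin.map_ts (g := fun x => ts (δ x) f) (by fun_prop)]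
  conv_rhs => 
    enter [2, a, b]
    rw [← hy, sourceCounit_eq, Lin.map_ts (g := fun x => f a (x * b)) (by fun_prop)]
  have := sw_one_right (k := k) (f := fun p q r => ϵ (y * r) • f p q)
    (by fun_prop) (by fun_prop) (by fun_prop)
  rw [← sw_coassoc _ (by fun_prop) (by fun_prop) (by fun_prop)] at this
  refine Eq.trans (Eq.trans (ts_congr _ fun a b => ?_) this) (ts_congr _ fun a b =>
    ts_congr _ fun c d => ?_)
  · rw [map_smul, Lin.map_smul (f := fun x => ts x f) (by fun_prop),
      Lin.map_ts (g := fun x => ϵ (y * b) • x) (by fun_prop)]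
  · rw [smul_mul_assoc, (h2 _).map_smul]

theorem target_mul_source {z y : H} (hz : εt z = z) (hy : εs y = y) : z * y = y * z := by
  have e := (sw_one_left (k := k) (f := fun p q r => (ϵ (p * z) * ϵ (y * r)) • q) (by fun_prop)
    (by fun_prop) (by fun_prop)).symm.trans (sw_one_right (k := k) (f := fun p q r =>
      (ϵ (p * z) * ϵ (y * r)) • q) (by fun_prop) (by fun_prop) (by fun_prop))
  have e1 : z * y = ts (δ 1) fun a b => ts (δ 1) fun c d => (ϵ (a * z) * ϵ (y * d)) • (b * c) := by
    conv_lhs => rw [← hz, ← hy, targetCounit_eq, Lin.map_ts (g := fun x => x * εs y) (by fun_prop)]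
    refine ts_congr _ fun a b => ?_
    rw [sourceCounit_eq, Lin.map_ts (g := fun x => (ϵ (a * z) • b) * x) (by fun_prop)]
    simp [mul_smul, smul_comm (ϵ (y * _))]
  have e2 : y * z = ts (δ 1) fun a b => ts (δ 1) fun c d => (ϵ (a * z) * ϵ (y * d)) • (c * b) := by
    conv_lhs => rw [← hz, ← hy, targetCounit_eq, Lin.map_ts (g := fun x => εs y * x) (by fun_prop)]
    refine ts_congr _ fun a b => ?_
    rw [sourceCounit_eq, Lin.map_ts (g := fun x => x * (ϵ (a * z) • b)) (by fun_prop)]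
    simp [mul_smul]
  rw [e1, e2, e]

/-- `ε_t(h₁)ε(h₂z) = ε_t(hz)`. -/
theorem sw_targetCounit_counit (h z : H) :
    ts (δ h) (fun a b => ϵ (b * z) • εt a) = εt (h * z) := by
  simp only [targetCounit_eq]
  conv_lhs => 
    enter [2, a, b]; rw [Lin.map_ts (g := fun x => ϵ (b * z) • x) (by fun_prop)]
  rw [ts_comm]
  refine ts_congr _ fun a b => ?_
  rw [← mul_assoc a h z, counit_mul, Lin.map_ts (g := fun x : k => (x • b : H)) (by fun_prop)]
  refine ts_congr _ fun c d => ?_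
  rw [smul_smul, mul_comm]

/-- `h₁ z S(h₂) = ε_t(hz)` for `z` in the target subalgebra. -/
theorem sw_mul_antipode_target (h : H) {z : H} (hz : εt z = z) :
    ts (δ h) (fun a b => a * z * σ b) = εt (h * z) := by
  rw [← sw_mul_antipode, sw_mul _ _ (by fun_prop) (by fun_prop)]
  conv_rhs => enter [2, a, b]; rw [sw_target hz (by fun_prop) (by fun_prop)]
  conv_lhs => rw [← mul_one h]
  rw [sw_mul _ _ (by fun_prop) (by fun_prop)]
  simp only [mul_assoc]

/-- `S(h₁) y h₂ = ε_s(yh)` for `y` in the source subalgebra. -/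
theorem sw_antipode_mul_source (h : H) {y : H} (hy : εs y = y) :
    ts (δ h) (fun a b => σ a * y * b) = εs (y * h) := by
  rw [← sw_antipode_mul, sw_mul _ _ (by fun_prop) (by fun_prop),
    sw_source hy (by fun_prop) (by fun_prop)]
  conv_lhs => rw [← one_mul h]
  rw [sw_mul _ _ (by fun_prop) (by fun_prop)]
  simp only [mul_assoc]

theorem sw_antipode_targetCounit (h : H) : ts (δ h) (fun a b => σ a * εt b) = σ h := by
  rw [← sw_antipode_mul_antipode]
  refine ts_congr _ fun a b => ?_
  rw [← sw_mul_antipode, Lin.map_ts (g := fun x => σ a * x) (by fun_prop)]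
  simp only [mul_assoc]

theorem sw_sourceCounit_antipode (h : H) : ts (δ h) (fun a b => εs a * σ b) = σ h := by
  rw [← sw_antipode_mul_antipode, ← sw_coassoc h (f := fun a c d => σ a * c * σ d) (by fun_prop)
    (by fun_prop) (by fun_prop)]
  refine ts_congr _ fun a b => ?_
  rw [← sw_antipode_mul, Lin.map_ts (g := fun x => x * σ b) (by fun_prop)]

theorem antipode_one : σ 1 = 1 := by
  rw [← sw_antipode_targetCounit, sw_targetCounit_right 1 (f := fun a b => σ a * b)
    (by fun_prop) (by fun_prop)]
  simp only [mul_one]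
  rw [sw_antipode_mul, sourceCounit_one]

theorem antipode_mul_rev (h g : H) : σ (h * g) = σ g * σ h := by
  calc σ (h * g) = ts (δ h) fun a b => ts (δ g) fun c d => σ (a * c) * εt (b * d) := by
        rw [← sw_antipode_targetCounit, sw_mul _ _ (by fun_prop) (by fun_prop)]
    _ = ts (δ g) fun c d => ts (δ h) fun a b => ts (δ b) fun p q =>
          σ (a * c) * p * εt d * σ q := by
        rw [ts_comm]
        refine ts_congr _ fun c d => ts_congr _ fun a b => ?_
        rw [← targetCounit_mul_targetCounit, ← sw_mul_antipode_target _ (targetCounit_idem d),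
          Lin.map_ts (g := fun x => σ (a * c) * x) (by fun_prop)]
        simp only [mul_assoc]
    _ = ts (δ h) fun a b => ts (δ a) fun p q => ts (δ g) fun c d =>
          ts (δ d) fun r s => σ (p * c) * q * r * σ s * σ b := by
        conv_lhs =>
          enter [2, c, d]
          rw [← sw_coassoc h (f := fun a p q => σ (a * c) * p * εt d * σ q)
            (by fun_prop) (by fun_prop) (by fun_prop)]
        rw [ts_comm]
        refine ts_congr _ fun a b => ?_
        rw [ts_comm]
        refine ts_congr _ fun p q => ts_congr _ fun c d => ?_
        rw [← sw_mul_antipode, Lin.map_ts (g := fun x => σ (p * c) * q * x * σ b) (by fun_prop)]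
        simp only [mul_assoc]
    _ = ts (δ h) fun a b => ts (δ g) fun c d => εs (a * c) * σ d * σ b := by
        refine ts_congr _ fun a b => ?_
        conv_lhs =>
          enter [2, p, q]
          rw [← sw_coassoc g (f := fun c r s => σ (p * c) * q * r * σ s * σ b)
            (by fun_prop) (by fun_prop) (by fun_prop)]
        rw [ts_comm]
        refine ts_congr _ fun c d => ?_
        rw [← sw_antipode_mul, sw_mul _ _ (by fun_prop) (by fun_prop),
          Lin.map_ts (g := fun x => x * σ d * σ b) (by fun_prop)]
        refine ts_congr _ fun p q => ?_
        rw [Lin.map_ts (g := fun x => x * σ d * σ b) (by fun_prop)]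
        simp only [mul_assoc]
    _ = ts (δ h) fun a b => ts (δ g) fun c d => σ c * εt d * (εs a * σ b) := by
        refine ts_congr _ fun a b => ?_
        have e : ∀ c d, εs (a * c) * σ d * σ b =
            ts (δ c) fun r s => σ r * εs a * s * σ d * σ b := fun c d => by
          rw [← sourceCounit_mul_sourceCounit, ← sw_antipode_mul_source _ (sourceCounit_idem a),
            Lin.map_ts (g := fun x => x * σ d * σ b) (by fun_prop)]
        simp only [e]
        rw [sw_coassoc g (f := fun r s d => σ r * εs a * s * σ d * σ b) (by fun_prop)
          (by fun_prop) (by fun_prop)]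
        refine ts_congr _ fun c d => ?_
        rw [mul_assoc, ← mul_assoc (εt d), target_mul_source (targetCounit_idem d)
          (sourceCounit_idem a), ← sw_mul_antipode,
          Lin.map_ts (g := fun x => σ c * (εs a * x * σ b)) (by fun_prop)]
        simp only [mul_assoc]
    _ = σ g * σ h := by
        conv_rhs => rw [← sw_antipode_targetCounit g, ← sw_sourceCounit_antipode h,
          Lin.map_ts (g := fun x => x * _) (by fun_prop)]
        rw [ts_comm]
        refine ts_congr _ fun c d => ?_
        rw [Lin.map_ts (g := fun x => σ c * εt d * x) (by fun_prop)]

theorem antipode_target {z : H} (hz : εt z = z) : σ z = εs z := by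
  rw [← sw_antipode_mul, sw_target hz (by fun_prop) (by fun_prop)]
  simp only [antipode_mul_rev, mul_assoc]
  rw [← Lin.map_ts (g := fun x => σ z * x) (by fun_prop), sw_antipode_mul, sourceCounit_one,
    mul_one]

theorem antipode_source {y : H} (hy : εs y = y) : σ y = εt y := by
  rw [← sw_mul_antipode, sw_source hy (by fun_prop) (by fun_prop)]
  simp only [antipode_mul_rev, ← mul_assoc]
  rw [← Lin.map_ts (g := fun x => x * σ y) (by fun_prop), sw_mul_antipode, targetCounit_one,
    one_mul]

theorem targetCounit_mul {w z : H} (hw : εt w = w) (hz : εt z = z) : εt (w * z) = w * z := by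
  rw [← sw_mul_antipode_target _ hz, sw_target' hw (by fun_prop) (by fun_prop)]
  simp only [mul_assoc]
  rw [← Lin.map_ts (g := fun x => w * x) (by fun_prop)]
  simp only [← mul_assoc]
  rw [sw_mul_antipode_target _ hz, one_mul, hz]

theorem sw_one_target {f : H → H → P} (h1 : ∀ b, Lin k fun a => f a b)
    (h2 : ∀ a, Lin k fun b => f a b) :
    ts (δ 1) (fun a b => f a (εt b)) = ts (δ 1) f := by
  rw [sw_targetCounit_right 1 h1 h2]; simp only [mul_one]

theorem sw_one_source {f : H → H → P} (h1 : ∀ b, Lin k fun a => f a b)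
    (h2 : ∀ a, Lin k fun b => f a b) :
    ts (δ 1) (fun a b => f (εs a) b) = ts (δ 1) f := by
  rw [sw_sourceCounit_left 1 h1 h2]; simp only [one_mul]

/-- `S(h₁)1₁h₂ ⊗ 1₂ = 1₁ ⊗ ε_t(h1₂)`. -/
theorem sw_adjoint (h : H) {f : H → H → P} (h1 : ∀ b, Lin k fun a => f a b)
    (h2 : ∀ a, Lin k fun b => f a b) :
    ts (δ h) (fun p q => ts (δ 1) fun a b => f (σ p * a * q) b) =
      ts (δ 1) fun a b => f a (εt (h * b)) := by
  have e : ∀ p q, ts (δ 1) (fun a b => f (σ p * a * q) b) =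
      ts (δ q) fun a b => f (σ p * a) (εt b) := fun p q => by
    rw [sw_targetCounit_right q (f := fun a b => f (σ p * a) b) (by fun_prop) (by fun_prop)]
    simp only [mul_assoc]
  simp only [e]
  rw [← sw_coassoc h (f := fun p a b => f (σ p * a) (εt b)) (by fun_prop) (by fun_prop)
    (by fun_prop), ← sw_sourceCounit_left h (f := fun a b => f a (εt b)) (by fun_prop)
    (by fun_prop)]
  refine ts_congr _ fun a b => ?_
  rw [← sw_antipode_mul, (h1 _).map_ts]

/-- `ε_t(1₁) ⊗ S(1₂) = 1₂ ⊗ 1₁`. -/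
theorem sw_one_swap {f : H → H → P} (h1 : ∀ b, Lin k fun a => f a b)
    (h2 : ∀ a, Lin k fun b => f a b) :
    ts (δ 1) (fun a b => f (εt a) (σ b)) = ts (δ 1) fun a b => f b a := by
  rw [← sw_one_target (f := fun a b => f (εt a) (σ b)) (by fun_prop) (by fun_prop)]
  simp only [antipode_target (targetCounit_idem _)]
  rw [sw_one_target (f := fun a b => f (εt a) (εs b)) (by fun_prop) (by fun_prop),
    ← sw_one_source (f := fun a b => f b a) (by fun_prop) (by fun_prop)]
  have e1 : ∀ a b, f (εt a) (εs b) = ts (δ 1) fun c d => ts (δ 1) fun p q =>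
      (ϵ (c * a) * ϵ (b * q)) • f d p := fun a b => by
    rw [targetCounit_eq, (h1 _).map_ts]
    refine ts_congr _ fun c d => ?_
    rw [(h1 _).map_smul, sourceCounit_eq, (h2 _).map_ts,
      Lin.map_ts (g := fun x => ϵ (c * a) • x) (by fun_prop)]
    refine ts_congr _ fun p q => ?_
    rw [(h2 _).map_smul, smul_smul]
  simp only [e1]
  rw [ts_comm]
  refine ts_congr _ fun c d => ?_
  rw [ts_comm, sourceCounit_eq, (h2 _).map_ts]
  refine ts_congr _ fun p q => ?_
  rw [(h2 _).map_smul, ← mul_one c, counit_mul, Lin.map_ts (g := fun x : k => (x • f d p : P))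
    (by fun_prop)]
  simp only [mul_one]

end Basic

/-! ### Tensor products, unit and duals of modules -/

section Modules

variable (k H : Type u) [Field k] [Ring H] [Algebra k H] [WeakHopfAlgebra k H]

local notation "δ" => (Coalgebra.comul : H →ₗ[k] H ⊗[k] H)
local notation "ϵ" => (Coalgebra.counit : H →ₗ[k] k)
local notation "εt" => targetCounit k H
local notation "εs" => sourceCounit k H
local notation "σ" => (WeakHopfAlgebra.antipode : H →ₗ[k] H)

section Tensor

variable (V W : Type u) [AddCommGroup V] [Module k V] [Module H V] [IsScalarTower k H V]
  [AddCommGroup W] [Module k W] [Module H W] [IsScalarTower k H W]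
  {V' W' P : Type u} [AddCommGroup V'] [Module k V'] [Module H V'] [IsScalarTower k H V']
  [AddCommGroup W'] [Module k W'] [Module H W'] [IsScalarTower k H W'] [AddCommGroup P] [Module k P]

/-- The action of `H ⊗ H` on `V ⊗ W`: `(a ⊗ b) · (v ⊗ w) = (a · v) ⊗ (b · w)`. -/
def tensorAct : H ⊗[k] H →ₐ[k] Module.End k (V ⊗[k] W) :=
  (Module.endTensorEndAlgHom (R := k) (S := k) (A := k) (M := V) (N := W)).comp
    (Algebra.TensorProduct.map (Algebra.lsmul k k V) (Algebra.lsmul k k W))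

@[simp] theorem tensorAct_tmul (a b : H) (v : V) (w : W) :
    tensorAct k H V W (a ⊗ₜ b) (v ⊗ₜ w) = (a • v) ⊗ₜ (b • w) := by
  simp [tensorAct, Module.endTensorEndAlgHom_apply]

/-- The tensor product of modules over a weak Hopf algebra: `{x ∈ V ⊗_k W | x = Δ(1) · x}`. -/
def WTensor : Type u :=
  LinearMap.eqLocus (tensorAct k H V W (δ 1)) LinearMap.id

instance : AddCommGroup (WTensor k H V W) :=
  inferInstanceAs (AddCommGroup (LinearMap.eqLocus (tensorAct k H V W (δ 1)) LinearMap.id))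

instance : Module k (WTensor k H V W) :=
  inferInstanceAs (Module k (LinearMap.eqLocus (tensorAct k H V W (δ 1)) LinearMap.id))

instance [FiniteDimensional k V] [FiniteDimensional k W] :
    FiniteDimensional k (WTensor k H V W) :=
  inferInstanceAs
    (FiniteDimensional k (LinearMap.eqLocus (tensorAct k H V W (δ 1)) LinearMap.id))

/-- The inclusion of the tensor product of modules into the tensor product over `k`. -/
def WTensor.incl : WTensor k H V W →ₗ[k] V ⊗[k] W :=
  (LinearMap.eqLocus (tensorAct k H V W (δ 1)) LinearMap.id).subtype

variable {V W}

theorem WTensor.incl_injective : Function.Injective (WTensor.incl k H V W) :=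
  Subtype.val_injective

theorem WTensor.act_incl (x : WTensor k H V W) :
    tensorAct k H V W (δ 1) (WTensor.incl k H V W x) = WTensor.incl k H V W x := x.2

variable (V W)

theorem tensorAct_one_mul (h : H) (x : V ⊗[k] W) :
    tensorAct k H V W (δ 1) (tensorAct k H V W (δ h) x) = tensorAct k H V W (δ h) x := by
  rw [← Module.End.mul_apply, ← map_mul, ← WeakHopfAlgebra.comul_mul, one_mul]

/-- The projection `x ↦ Δ(1) · x` of `V ⊗_k W` onto the tensor product of modules. -/
def WTensor.proj : V ⊗[k] W →ₗ[k] WTensor k H V W :=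
  LinearMap.codRestrict (LinearMap.eqLocus (tensorAct k H V W (δ 1)) LinearMap.id)
    (tensorAct k H V W (δ 1)) fun x => tensorAct_one_mul k H V W 1 x

/-- `H` acts on the tensor product of modules through the comultiplication. -/
instance : Module H (WTensor k H V W) where
  smul h x := ⟨tensorAct k H V W (δ h) (WTensor.incl k H V W x), tensorAct_one_mul k H V W h _⟩
  one_smul x := Subtype.ext x.2
  mul_smul a b x := Subtype.ext (by
    change tensorAct k H V W (δ (a * b)) _ = tensorAct k H V W (δ a) (tensorAct k H V W (δ b) _)
    rw [WeakHopfAlgebra.comul_mul, map_mul]; rfl)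
  smul_zero a := Subtype.ext (map_zero (tensorAct k H V W (δ a)))
  smul_add a x y := Subtype.ext (map_add (tensorAct k H V W (δ a)) _ _)
  add_smul a b x := Subtype.ext (by
    change tensorAct k H V W (δ (a + b)) _ =
      tensorAct k H V W (δ a) _ + tensorAct k H V W (δ b) _
    rw [map_add, map_add]; rfl)
  zero_smul x := Subtype.ext (by
    change tensorAct k H V W (δ 0) _ = 0
    rw [map_zero, map_zero]; rfl)

variable {V W}

theorem WTensor.incl_smul (h : H) (x : WTensor k H V W) :
    WTensor.incl k H V W (h • x) = tensorAct k H V W (δ h) (WTensor.incl k H V W x) := rfl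

theorem WTensor.incl_proj (x : V ⊗[k] W) :
    WTensor.incl k H V W (WTensor.proj k H V W x) = tensorAct k H V W (δ 1) x := rfl

theorem WTensor.proj_incl (x : WTensor k H V W) :
    WTensor.proj k H V W (WTensor.incl k H V W x) = x :=
  Subtype.ext x.2

instance : IsScalarTower k H (WTensor k H V W) where
  smul_assoc c h x := WTensor.incl_injective k H (by
    simp only [WTensor.incl_smul, map_smul, LinearMap.smul_apply])

variable (V W) in
/-- `v ⊗ w ↦ Δ(1) · (v ⊗ w)` as a bilinear map. -/
def WTensor.mk : V →ₗ[k] W →ₗ[k] WTensor k H V W :=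
  (TensorProduct.mk k V W).compr₂ (WTensor.proj k H V W)

/-- The element `Δ(1) · (v ⊗ w)` of the tensor product of modules. -/
abbrev wtm (v : V) (w : W) : WTensor k H V W := WTensor.mk k H V W v w

local infixr:72 " ⊡ " => wtm k H

variable {k H}

@[fun_prop] theorem Lin.wtm_left {L : Type*} [AddCommGroup L] [Module k L] {g : L → V}
    (hg : Lin k g) (w : W) : Lin k (fun x => g x ⊡ w) :=
  Lin.coe_left (Lin.comp' (Lin.coe (WTensor.mk k H V W)) hg) w

@[fun_prop] theorem Lin.wtm_right {L : Type*} [AddCommGroup L] [Module k L] {g : L → W}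
    (hg : Lin k g) (v : V) : Lin k (fun x => v ⊡ g x) :=
  Lin.comp' (Lin.coe (WTensor.mk k H V W v)) hg

theorem WTensor.ind {f g : WTensor k H V W → P} (hf : Lin k f) (hg : Lin k g)
    (h : ∀ v w, f (v ⊡ w) = g (v ⊡ w)) (x : WTensor k H V W) : f x = g x := by
  have e : hf.mk' ∘ₗ WTensor.proj k H V W = hg.mk' ∘ₗ WTensor.proj k H V W :=
    TensorProduct.ext' h
  have := LinearMap.congr_fun e (WTensor.incl k H V W x)
  simp only [LinearMap.comp_apply, WTensor.proj_incl] at this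
  exact this

theorem tensorAct_eq (t : H ⊗[k] H) (v : V) (w : W) :
    tensorAct k H V W t (v ⊗ₜ w) = ts t fun a b => (a • v) ⊗ₜ (b • w) := by
  conv_lhs => rw [← ts_tmul_self t]
  rw [Lin.map_ts (g := fun t => tensorAct k H V W t (v ⊗ₜ w))
    (Lin.coe ((tensorAct k H V W).toLinearMap.flip (v ⊗ₜ w)))]
  simp

theorem incl_wtm (v : V) (w : W) :
    WTensor.incl k H V W (v ⊡ w) = ts (δ 1) fun a b => (a • v) ⊗ₜ (b • w) :=
  tensorAct_eq _ v w

theorem proj_tmul (v : V) (w : W) : WTensor.proj k H V W (v ⊗ₜ w) = v ⊡ w := rfl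

theorem proj_act (t : H ⊗[k] H) (v : V) (w : W) :
    WTensor.proj k H V W (tensorAct k H V W t (v ⊗ₜ w)) = ts t fun a b => (a • v) ⊡ (b • w) := by
  rw [tensorAct_eq, Lin.map_ts (Lin.coe _)]
  simp only [proj_tmul]

theorem smul_wtm (h : H) (v : V) (w : W) :
    h • (v ⊡ w) = ts (δ h) fun a b => (a • v) ⊡ (b • w) := by
  have e : h • (v ⊡ w) = WTensor.proj k H V W (tensorAct k H V W (δ h) (v ⊗ₜ w)) := by
    refine WTensor.incl_injective k H ?_
    change tensorAct k H V W (δ h) (tensorAct k H V W (δ 1) (v ⊗ₜ w)) =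
      tensorAct k H V W (δ 1) (tensorAct k H V W (δ h) (v ⊗ₜ w))
    rw [tensorAct_one_mul, ← Module.End.mul_apply, ← map_mul, ← WeakHopfAlgebra.comul_mul, mul_one]
  rw [e, tensorAct_eq, Lin.map_ts (Lin.coe _)]
  rfl

theorem wtm_one (v : V) (w : W) : (ts (δ 1) fun a b => (a • v) ⊡ (b • w)) = v ⊡ w := by
  rw [← smul_wtm, one_smul]

theorem comp_incl_wtm (F : V ⊗[k] W →ₗ[k] P) (v : V) (w : W) :
    F (WTensor.incl k H V W (v ⊡ w)) = ts (δ 1) fun a b => F ((a • v) ⊗ₜ (b • w)) := by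
  rw [incl_wtm, Lin.map_ts (Lin.coe _)]

/-- Bundle an `H`-equivariant `k`-linear map. -/
def mkHom (f : V →ₗ[k] W) (hf : ∀ (h : H) v, f (h • v) = h • f v) : V →ₗ[H] W :=
  { f with map_smul' := hf }

theorem hom_smul (f : V →ₗ[H] W) (c : k) (v : V) : f (c • v) = c • f v := by
  rw [← algebraMap_smul H c v, map_smul, algebraMap_smul]

variable (k) in
/-- An `H`-linear map as a `k`-linear map. -/
def toLin (f : V →ₗ[H] W) : V →ₗ[k] W :=
  { toFun := f, map_add' := map_add f, map_smul' := hom_smul f }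

theorem Lin.hom (f : V →ₗ[H] W) : Lin k (fun x => f x) := Lin.coe (toLin k f)

@[fun_prop] theorem Lin.hom_comp {L : Type*} [AddCommGroup L] [Module k L] (f : V →ₗ[H] W)
    {g : L → V} (hg : Lin k g) : Lin k (fun x => f (g x)) := Lin.comp' (Lin.hom f) hg

variable (k H) in
/-- The tensor product of two `H`-linear maps: the restriction of the usual one. -/
def wmap (f : V →ₗ[H] V') (g : W →ₗ[H] W') : WTensor k H V W →ₗ[H] WTensor k H V' W' :=
  have key : ∀ (t : H ⊗[k] H) (x : V ⊗[k] W),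
      TensorProduct.map (toLin k f) (toLin k g) (tensorAct k H V W t x) =
        tensorAct k H V' W' t (TensorProduct.map (toLin k f) (toLin k g) x) := fun t x => by
    induction t with
    | zero => simp
    | add s t hs ht => simp [hs, ht]
    | tmul a b =>
      induction x with
      | zero => simp
      | add x y hx hy => simp only [map_add, hx, hy]
      | tmul v w => simp [toLin]
  mkHom (LinearMap.codRestrict (LinearMap.eqLocus (tensorAct k H V' W' (δ 1)) LinearMap.id)
      (TensorProduct.map (toLin k f) (toLin k g) ∘ₗ WTensor.incl k H V W)
      fun x => (key _ _).symm.trans (congrArg _ (WTensor.act_incl k H x)))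
    fun _ _ => Subtype.ext (key _ _)

@[simp] theorem wmap_wtm (f : V →ₗ[H] V') (g : W →ₗ[H] W') (v : V) (w : W) :
    wmap k H f g (v ⊡ w) = f v ⊡ g w := by
  refine WTensor.incl_injective k H ?_
  change TensorProduct.map (toLin k f) (toLin k g) (WTensor.incl k H V W (v ⊡ w)) = _
  rw [comp_incl_wtm, incl_wtm]
  simp [toLin]

end Tensor

section Assoc

variable (U V W : Type u) [AddCommGroup U] [Module k U] [Module H U] [IsScalarTower k H U]
  [AddCommGroup V] [Module k V] [Module H V] [IsScalarTower k H V]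
  [AddCommGroup W] [Module k W] [Module H W] [IsScalarTower k H W]

local infixr:72 " ⊡ " => wtm k H

/-- The associativity map, induced by that of the tensor product over `k`. -/
def assocHom : WTensor k H (WTensor k H U V) W →ₗ[k] WTensor k H U (WTensor k H V W) :=
  WTensor.proj k H U (WTensor k H V W) ∘ₗ LinearMap.lTensor U (WTensor.proj k H V W) ∘ₗ
    (TensorProduct.assoc k U V W).toLinearMap ∘ₗ LinearMap.rTensor W (WTensor.incl k H U V) ∘ₗ
    WTensor.incl k H (WTensor k H U V) W

/-- The inverse associativity map, induced by that of the tensor product over `k`. -/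
def assocInv : WTensor k H U (WTensor k H V W) →ₗ[k] WTensor k H (WTensor k H U V) W :=
  WTensor.proj k H (WTensor k H U V) W ∘ₗ LinearMap.rTensor W (WTensor.proj k H U V) ∘ₗ
    (TensorProduct.assoc k U V W).symm.toLinearMap ∘ₗ
    LinearMap.lTensor U (WTensor.incl k H V W) ∘ₗ WTensor.incl k H U (WTensor k H V W)

variable {U V W}

theorem smul_wtm_wtm (h : H) (u : U) (v : V) (w : W) : h • (u ⊡ v ⊡ w) =
    ts (δ h) fun a b => ts (δ b) fun c d => (a • u) ⊡ (c • v) ⊡ (d • w) := by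
  rw [smul_wtm]
  refine ts_congr _ fun a b => ?_
  rw [smul_wtm, Lin.map_ts (g := fun x => (a • u) ⊡ x) (by fun_prop)]

theorem smul_wtm_wtm' (h : H) (u : U) (v : V) (w : W) : h • ((u ⊡ v) ⊡ w) =
    ts (δ h) fun a b => ts (δ b) fun c d => ((a • u) ⊡ (c • v)) ⊡ (d • w) := by
  rw [← sw_coassoc h (f := fun a c d => ((a • u) ⊡ (c • v)) ⊡ (d • w)) (by fun_prop)
    (by fun_prop) (by fun_prop), smul_wtm]
  refine ts_congr _ fun a b => ?_
  rw [smul_wtm, Lin.map_ts (g := fun x => x ⊡ (b • w)) (by fun_prop)]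

theorem assocHom_wtm (u : U) (v : V) (w : W) :
    assocHom k H U V W ((u ⊡ v) ⊡ w) = u ⊡ v ⊡ w := by
  have e : ∀ (u : U) (v : V) (w : W), WTensor.proj k H U (WTensor k H V W)
      (LinearMap.lTensor U (WTensor.proj k H V W) (TensorProduct.assoc k U V W
        (LinearMap.rTensor W (WTensor.incl k H U V) ((u ⊡ v) ⊗ₜ w)))) =
      ts (δ 1) fun a b => (a • u) ⊡ (b • v) ⊡ w := fun u v w => by
    rw [LinearMap.rTensor_tmul, incl_wtm]
    simp only [ts, sum_tmul, map_sum, TensorProduct.assoc_tmul, LinearMap.lTensor_tmul, proj_tmul]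
  have e2 : ∀ (a b : H), WTensor.proj k H U (WTensor k H V W)
      (LinearMap.lTensor U (WTensor.proj k H V W) (TensorProduct.assoc k U V W
        (LinearMap.rTensor W (WTensor.incl k H U V) ((a • (u ⊡ v)) ⊗ₜ (b • w))))) =
      ts (δ a) fun c d => (c • u) ⊡ (d • v) ⊡ (b • w) := fun a b => by
    have hF : Lin k fun x : WTensor k H U V => WTensor.proj k H U (WTensor k H V W)
      (LinearMap.lTensor U (WTensor.proj k H V W) (TensorProduct.assoc k U V W
        (LinearMap.rTensor W (WTensor.incl k H U V) (x ⊗ₜ (b • w))))) :=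
      ⟨by simp [add_tmul], by simp [← smul_tmul']⟩
    rw [smul_wtm, hF.map_ts]
    simp only [e, smul_smul]
    rw [ts_comm, ← sw_mul 1 a (f := fun c d => (c • u) ⊡ (d • v) ⊡ (b • w)) (by fun_prop)
      (by fun_prop), one_mul]
  rw [← one_smul H (u ⊡ v ⊡ w), smul_wtm_wtm k H,
    ← sw_coassoc 1 (f := fun a c d => (a • u) ⊡ (c • v) ⊡ (d • w)) (by fun_prop)
      (by fun_prop) (by fun_prop)]
  refine (comp_incl_wtm (WTensor.proj k H U (WTensor k H V W) ∘ₗ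
    LinearMap.lTensor U (WTensor.proj k H V W) ∘ₗ (TensorProduct.assoc k U V W).toLinearMap ∘ₗ
    LinearMap.rTensor W (WTensor.incl k H U V)) (u ⊡ v) w).trans (ts_congr _ fun a b => e2 a b)

theorem assocInv_wtm (u : U) (v : V) (w : W) :
    assocInv k H U V W (u ⊡ v ⊡ w) = (u ⊡ v) ⊡ w := by
  have e : ∀ (u : U) (v : V) (w : W), WTensor.proj k H (WTensor k H U V) W
      (LinearMap.rTensor W (WTensor.proj k H U V) ((TensorProduct.assoc k U V W).symm
        (LinearMap.lTensor U (WTensor.incl k H V W) (u ⊗ₜ (v ⊡ w))))) =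
      ts (δ 1) fun a b => (u ⊡ (a • v)) ⊡ (b • w) := fun u v w => by
    rw [LinearMap.lTensor_tmul, incl_wtm]
    simp only [ts, tmul_sum, map_sum, TensorProduct.assoc_symm_tmul, LinearMap.rTensor_tmul,
      proj_tmul]
  have e2 : ∀ (a b : H), WTensor.proj k H (WTensor k H U V) W
      (LinearMap.rTensor W (WTensor.proj k H U V) ((TensorProduct.assoc k U V W).symm
        (LinearMap.lTensor U (WTensor.incl k H V W) ((a • u) ⊗ₜ (b • (v ⊡ w)))))) =
      ts (δ b) fun c d => ((a • u) ⊡ (c • v)) ⊡ (d • w) := fun a b => by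
    have hF : Lin k fun x : WTensor k H V W => WTensor.proj k H (WTensor k H U V) W
      (LinearMap.rTensor W (WTensor.proj k H U V) ((TensorProduct.assoc k U V W).symm
        (LinearMap.lTensor U (WTensor.incl k H V W) ((a • u) ⊗ₜ x)))) :=
      ⟨by simp [tmul_add], by simp⟩
    rw [smul_wtm, hF.map_ts]
    simp only [e, smul_smul]
    rw [ts_comm, ← sw_mul 1 b (f := fun c d => ((a • u) ⊡ (c • v)) ⊡ (d • w)) (by fun_prop)
      (by fun_prop), one_mul]
  rw [← one_smul H ((u ⊡ v) ⊡ w), smul_wtm_wtm' k H]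
  refine (comp_incl_wtm (WTensor.proj k H (WTensor k H U V) W ∘ₗ
    LinearMap.rTensor W (WTensor.proj k H U V) ∘ₗ
    (TensorProduct.assoc k U V W).symm.toLinearMap ∘ₗ
    LinearMap.lTensor U (WTensor.incl k H V W)) u (v ⊡ w)).trans (ts_congr _ fun a b => e2 a b)

variable {k H}

theorem WTensor.ind3 {P : Type u} [AddCommGroup P] [Module k P]
    {f g : WTensor k H (WTensor k H U V) W → P} (hf : Lin k f) (hg : Lin k g)
    (h : ∀ u v w, f ((u ⊡ v) ⊡ w) = g ((u ⊡ v) ⊡ w))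
    (x : WTensor k H (WTensor k H U V) W) : f x = g x :=
  WTensor.ind hf hg (fun p w => WTensor.ind (f := fun p => f (p ⊡ w)) (g := fun p => g (p ⊡ w))
    (hf.comp' (by fun_prop)) (hg.comp' (by fun_prop)) (fun u v => h u v w) p) x

theorem WTensor.ind3' {P : Type u} [AddCommGroup P] [Module k P]
    {f g : WTensor k H U (WTensor k H V W) → P} (hf : Lin k f) (hg : Lin k g)
    (h : ∀ u v w, f (u ⊡ v ⊡ w) = g (u ⊡ v ⊡ w))
    (x : WTensor k H U (WTensor k H V W)) : f x = g x :=
  WTensor.ind hf hg (fun u p => WTensor.ind (f := fun p => f (u ⊡ p)) (g := fun p => g (u ⊡ p))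
    (hf.comp' (by fun_prop)) (hg.comp' (by fun_prop)) (fun v w => h u v w) p) x

theorem assocHom_smul (h : H) (x : WTensor k H (WTensor k H U V) W) :
    assocHom k H U V W (h • x) = h • assocHom k H U V W x :=
  WTensor.ind3 (f := fun x => assocHom k H U V W (h • x))
    (g := fun x => h • assocHom k H U V W x) (by fun_prop) (by fun_prop) (fun u v w => by
      simp only [smul_wtm_wtm', assocHom_wtm, smul_wtm_wtm, Lin.map_ts (Lin.coe _)]) x

theorem assocInv_assocHom (x : WTensor k H (WTensor k H U V) W) :
    assocInv k H U V W (assocHom k H U V W x) = x :=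
  WTensor.ind3 (f := fun x => assocInv k H U V W (assocHom k H U V W x))
    (g := fun x => x) (by fun_prop) (by fun_prop)
    (fun u v w => by simp only [assocHom_wtm, assocInv_wtm]) x

theorem assocHom_assocInv (x : WTensor k H U (WTensor k H V W)) :
    assocHom k H U V W (assocInv k H U V W x) = x :=
  WTensor.ind3' (f := fun x => assocHom k H U V W (assocInv k H U V W x))
    (g := fun x => x) (by fun_prop) (by fun_prop)
    (fun u v w => by simp only [assocHom_wtm, assocInv_wtm]) x

theorem assocInv_smul (h : H) (x : WTensor k H U (WTensor k H V W)) :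
    assocInv k H U V W (h • x) = h • assocInv k H U V W x := by
  conv_lhs => rw [← assocHom_assocInv x, ← assocHom_smul, assocInv_assocHom]

end Assoc

section Unit

/-- The unit object: the target counital subalgebra `H_t = ε_t(H)`. -/
def TargetSub : Type u := LinearMap.range εt

instance : AddCommGroup (TargetSub k H) := inferInstanceAs (AddCommGroup (LinearMap.range εt))

instance : Module k (TargetSub k H) := inferInstanceAs (Module k (LinearMap.range εt))

instance [FiniteDimensional k H] : FiniteDimensional k (TargetSub k H) :=
  inferInstanceAs (FiniteDimensional k (LinearMap.range εt))

/-- The inclusion `H_t → H`. -/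
def TargetSub.val : TargetSub k H →ₗ[k] H := (LinearMap.range εt).subtype

/-- The map `ε_t : H → H_t`. -/
def TargetSub.mk : H →ₗ[k] TargetSub k H := LinearMap.rangeRestrict εt

variable {k H}

theorem TargetSub.val_injective : Function.Injective (TargetSub.val k H) :=
  Subtype.val_injective

@[simp] theorem TargetSub.val_mk (h : H) : TargetSub.val k H (TargetSub.mk k H h) = εt h := rfl

theorem TargetSub.targetCounit_val (z : TargetSub k H) :
    εt (TargetSub.val k H z) = TargetSub.val k H z := by
  obtain ⟨_, h, rfl⟩ := z
  exact targetCounit_idem h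

@[simp] theorem TargetSub.mk_val (z : TargetSub k H) :
    TargetSub.mk k H (TargetSub.val k H z) = z :=
  TargetSub.val_injective (TargetSub.targetCounit_val z)

theorem TargetSub.mk_targetCounit (h : H) :
    TargetSub.mk k H (εt h) = TargetSub.mk k H h :=
  TargetSub.val_injective (targetCounit_idem h)

/-- The action of `H` on the unit object: `h · z = ε_t(hz)`. -/
instance : Module H (TargetSub k H) where
  smul h z := TargetSub.mk k H (h * TargetSub.val k H z)
  one_smul z := by
    change TargetSub.mk k H (1 * TargetSub.val k H z) = z
    rw [one_mul, TargetSub.mk_val]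
  mul_smul a b z := TargetSub.val_injective (by
    change εt (a * b * TargetSub.val k H z) = εt (a * εt (b * TargetSub.val k H z))
    rw [targetCounit_mul_targetCounit, mul_assoc])
  smul_zero a := by
    change TargetSub.mk k H (a * TargetSub.val k H 0) = 0
    simp
  smul_add a x y := by
    change TargetSub.mk k H (a * TargetSub.val k H (x + y)) =
      TargetSub.mk k H (a * TargetSub.val k H x) + TargetSub.mk k H (a * TargetSub.val k H y)
    simp [mul_add]
  add_smul a b x := by
    change TargetSub.mk k H ((a + b) * TargetSub.val k H x) =
      TargetSub.mk k H (a * TargetSub.val k H x) + TargetSub.mk k H (b * TargetSub.val k H x)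
    simp [add_mul]
  zero_smul x := by
    change TargetSub.mk k H (0 * TargetSub.val k H x) = 0
    simp

theorem TargetSub.smul_def (h : H) (z : TargetSub k H) :
    h • z = TargetSub.mk k H (h * TargetSub.val k H z) := rfl

theorem TargetSub.smul_mk (h x : H) :
    h • TargetSub.mk k H x = TargetSub.mk k H (h * x) :=
  TargetSub.val_injective (targetCounit_mul_targetCounit h x)

instance : IsScalarTower k H (TargetSub k H) where
  smul_assoc c h z := by simp [TargetSub.smul_def]

section

variable {V : Type u} [AddCommGroup V] [Module k V] [Module H V] [IsScalarTower k H V]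

local infixr:72 " ⊡ " => wtm k H
local notation "ₜ" => TargetSub.mk k H

/-- `ε_t(h₁)h₂ = h`. -/
theorem sw_targetCounit_mul (h : H) : ts (δ h) (fun a b => εt a * b) = h := by
  conv_lhs =>
    enter [2, a, b]
    rw [targetCounit_eq, Lin.map_ts (g := fun x => x * b) (by fun_prop)]
  rw [ts_comm]
  conv_lhs =>
    enter [2, a, b, 2, c, d]
    rw [smul_mul_assoc]
  rw [← sw_mul 1 h (f := fun a b => ϵ a • b) (by fun_prop) (by fun_prop),
    sw_counit_left _ Lin.id', one_mul]

/-- `ε_t(h₁z)h₂ = hz` for `z` in the target subalgebra. -/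
theorem sw_targetCounit_mul_target (h : H) {z : H} (hz : εt z = z) :
    ts (δ h) (fun a b => εt (a * z) * b) = h * z := by
  conv_rhs => rw [← sw_targetCounit_mul (k := k) (h * z), sw_mul _ _ (by fun_prop) (by fun_prop)]
  conv_rhs => enter [2, a, b]; rw [sw_target hz (by fun_prop) (by fun_prop)]
  conv_lhs => rw [← mul_one h]
  rw [sw_mul _ _ (by fun_prop) (by fun_prop)]
  simp only [mul_assoc]

variable (k H V) in
/-- The left unit constraint `H_t ⊗ V → V`, `z ⊗ v ↦ z · v`. -/
def leftUnitLin : WTensor k H (TargetSub k H) V →ₗ[k] V :=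
  TensorProduct.lift ((Algebra.lsmul k k V).toLinearMap ∘ₗ TargetSub.val k H) ∘ₗ
    WTensor.incl k H (TargetSub k H) V

variable (k H V) in
/-- The right unit constraint `V ⊗ H_t → V`, `v ⊗ z ↦ ε(z) v`. It is inverse to the map
`v ↦ 1₁ · v ⊗ 1₂`. -/
def rightUnitLin : WTensor k H V (TargetSub k H) →ₗ[k] V :=
  (TensorProduct.rid k V).toLinearMap ∘ₗ LinearMap.lTensor V (ϵ ∘ₗ TargetSub.val k H) ∘ₗ
    WTensor.incl k H V (TargetSub k H)

theorem leftUnitLin_wtm (z : TargetSub k H) (v : V) :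
    leftUnitLin k H V (z ⊡ v) = TargetSub.val k H z • v := by
  refine (comp_incl_wtm (V := TargetSub k H) (W := V) (TensorProduct.lift
    ((Algebra.lsmul k k V).toLinearMap ∘ₗ TargetSub.val k H)) z v).trans ?_
  conv_rhs => rw [← one_mul (TargetSub.val k H z),
    ← sw_targetCounit_mul_target 1 (TargetSub.targetCounit_val z),
    Lin.map_ts (g := fun h : H => h • v) (by fun_prop)]
  refine ts_congr _ fun a b => ?_
  simp [TargetSub.smul_def, smul_smul]

theorem rightUnitLin_wtm (v : V) (z : TargetSub k H) :
    rightUnitLin k H V (v ⊡ z) = ts (δ 1) fun a b => ϵ (b * TargetSub.val k H z) • a • v := by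
  refine (comp_incl_wtm (V := V) (W := TargetSub k H) ((TensorProduct.rid k V).toLinearMap ∘ₗ
    LinearMap.lTensor V (ϵ ∘ₗ TargetSub.val k H)) v z).trans ?_
  refine ts_congr _ fun a b => ?_
  simp [TargetSub.smul_def, counit_targetCounit]

theorem leftUnitLin_smul (h : H) (x : WTensor k H (TargetSub k H) V) :
    leftUnitLin k H V (h • x) = h • leftUnitLin k H V x :=
  WTensor.ind (f := fun x => leftUnitLin k H V (h • x)) (g := fun x => h • leftUnitLin k H V x)
    (by fun_prop) (by fun_prop) (fun z v => by
      rw [smul_wtm, Lin.map_ts (Lin.coe _), leftUnitLin_wtm, smul_smul,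
        ← sw_targetCounit_mul_target h (TargetSub.targetCounit_val z),
        Lin.map_ts (g := fun h : H => h • v) (by fun_prop)]
      refine ts_congr _ fun a b => ?_
      rw [leftUnitLin_wtm, smul_smul]; rfl) x

theorem leftUnitLin_one (v : V) : leftUnitLin k H V (ₜ 1 ⊡ v) = v := by
  rw [leftUnitLin_wtm, TargetSub.val_mk, targetCounit_one, one_smul]

theorem one_wtm_leftUnitLin (x : WTensor k H (TargetSub k H) V) :
    ₜ 1 ⊡ leftUnitLin k H V x = x :=
  WTensor.ind (f := fun x => ₜ 1 ⊡ leftUnitLin k H V x) (g := fun x => x)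
    (by fun_prop) (by fun_prop) (fun z v => by
      rw [leftUnitLin_wtm, ← wtm_one, ← wtm_one z]
      have e := sw_targetCounit_left (TargetSub.val k H z) (f := fun a b => ₜ a ⊡ (b • v))
        (by fun_prop) (by fun_prop)
      rw [sw_target (TargetSub.targetCounit_val z) (by fun_prop) (by fun_prop)] at e
      simp only [TargetSub.mk_targetCounit] at e
      simp only [TargetSub.smul_mk, mul_one, smul_smul]
      exact e.symm) x

theorem wtm_one_smul (h : H) (v : V) : (h • v) ⊡ ₜ 1 = h • (v ⊡ ₜ 1) := by
  rw [smul_wtm, ← wtm_one]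
  have e := sw_targetCounit_right h (f := fun a b => (a • v) ⊡ ₜ b) (by fun_prop) (by fun_prop)
  simp only [TargetSub.mk_targetCounit] at e
  simp only [TargetSub.smul_mk, mul_one, smul_smul]
  exact e.symm

theorem rightUnitLin_one (v : V) : rightUnitLin k H V (v ⊡ ₜ 1) = v := by
  rw [rightUnitLin_wtm, TargetSub.val_mk, targetCounit_one]
  simp only [mul_one]
  rw [sw_counit_right 1 (f := fun a => a • v) (by fun_prop), one_smul]

theorem rightUnitLin_wtm_one (x : WTensor k H V (TargetSub k H)) :
    rightUnitLin k H V x ⊡ ₜ 1 = x :=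
  WTensor.ind (f := fun x => rightUnitLin k H V x ⊡ ₜ 1) (g := fun x => x)
    (by fun_prop) (by fun_prop) (fun v z => by
      have e1 : ∀ y : H, (y • v) ⊡ ₜ 1 = ts (δ y) fun a b => (a • v) ⊡ ₜ b := fun y => by
        rw [wtm_one_smul, smul_wtm]
        simp only [TargetSub.smul_mk, mul_one]
      rw [rightUnitLin_wtm, Lin.map_ts (g := fun x => x ⊡ ₜ 1) (by fun_prop)]
      have e2 : ∀ a b : H, (ϵ (b * TargetSub.val k H z) • a • v) ⊡ ₜ 1 =
          ts (δ a) fun c d => ϵ (b * TargetSub.val k H z) • ((c • v) ⊡ ₜ d) := fun a b => by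
        rw [Lin.map_smul (f := fun x => x ⊡ ₜ 1) (by fun_prop), e1,
          Lin.map_ts (g := fun x => ϵ (b * TargetSub.val k H z) • x) (by fun_prop)]
      simp only [e2]
      rw [sw_coassoc 1 (f := fun c d b => ϵ (b * TargetSub.val k H z) • ((c • v) ⊡ ₜ d))
        (by fun_prop) (by fun_prop) (by fun_prop), ← wtm_one v z]
      refine ts_congr _ fun a b => ?_
      rw [TargetSub.smul_def, ← TargetSub.mk_targetCounit, ← sw_targetCounit_counit,
        Lin.map_ts (g := fun x => (a • v) ⊡ ₜ x) (by fun_prop)]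
      refine ts_congr _ fun c d => ?_
      simp only [map_smul, TargetSub.mk_targetCounit]) x

theorem rightUnitLin_smul (h : H) (x : WTensor k H V (TargetSub k H)) :
    rightUnitLin k H V (h • x) = h • rightUnitLin k H V x := by
  conv_lhs => rw [← rightUnitLin_wtm_one x, ← wtm_one_smul, rightUnitLin_one]

end

end Unit

end Modules

/-! ### Quasitriangular and ribbon structures, duals -/

/-- A quasitriangular structure on a weak Hopf algebra. Here `Δᵒᵖ` is the composition of `Δ` with
the flip, and the identities are taken in `H ⊗ H` and in `H ⊗ (H ⊗ H)`. -/
class QuasitriangularStructure (k H : Type*) [Field k] [Ring H] [Algebra k H]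
    [WeakHopfAlgebra k H] where
  /-- The universal `R`-matrix. -/
  R : H ⊗[k] H
  /-- The quasi-inverse of `R`. -/
  Rbar : H ⊗[k] H
  /-- `R ∈ Δᵒᵖ(1)(H ⊗ H)Δ(1)`. -/
  R_mem : ∃ X : H ⊗[k] H, R = Algebra.TensorProduct.comm k H H (Coalgebra.comul (R := k) (1 : H)) *
    X * Coalgebra.comul (R := k) (1 : H)
  /-- `Δᵒᵖ(h) R = R Δ(h)`. -/
  comul_op_mul_R : ∀ h : H, Algebra.TensorProduct.comm k H H (Coalgebra.comul (R := k) h) * R =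
    R * Coalgebra.comul (R := k) h
  /-- `(id ⊗ Δ)R = R₁₃R₁₂`. -/
  lTensor_comul_R : LinearMap.lTensor H (Coalgebra.comul (R := k) (A := H)) R =
    LinearMap.lTensor H (TensorProduct.mk k H H 1) R *
      TensorProduct.assoc k H H H (R ⊗ₜ[k] (1 : H))
  /-- `(Δ ⊗ id)R = R₁₃R₂₃`. -/
  rTensor_comul_R : TensorProduct.assoc k H H H
      (LinearMap.rTensor H (Coalgebra.comul (R := k) (A := H)) R) =
    LinearMap.lTensor H (TensorProduct.mk k H H 1) R * ((1 : H) ⊗ₜ[k] R)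
  /-- `R̄ ∈ Δ(1)(H ⊗ H)Δᵒᵖ(1)`. -/
  Rbar_mem : ∃ X : H ⊗[k] H, Rbar = Coalgebra.comul (R := k) (1 : H) * X *
    Algebra.TensorProduct.comm k H H (Coalgebra.comul (R := k) (1 : H))
  /-- `R R̄ = Δᵒᵖ(1)`. -/
  R_mul_Rbar : R * Rbar = Algebra.TensorProduct.comm k H H (Coalgebra.comul (R := k) (1 : H))
  /-- `R̄ R = Δ(1)`. -/
  Rbar_mul_R : Rbar * R = Coalgebra.comul (R := k) (1 : H)

/-- A ribbon structure on a quasitriangular weak Hopf algebra: an invertible central element `ν`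
with `Δ(ν) = R₂₁R(ν ⊗ ν)` and `S(ν) = ν`. -/
class RibbonStructure (k H : Type*) [Field k] [Ring H] [Algebra k H] [WeakHopfAlgebra k H]
    [QuasitriangularStructure k H] where
  /-- The ribbon element. -/
  ν : Hˣ
  ν_central : ∀ h : H, (ν : H) * h = h * ν
  comul_ν : Coalgebra.comul (R := k) (ν : H) =
    Algebra.TensorProduct.comm k H H (QuasitriangularStructure.R (k := k) (H := H)) *
      QuasitriangularStructure.R * ((ν : H) ⊗ₜ[k] (ν : H))
  antipode_ν : WeakHopfAlgebra.antipode (k := k) (ν : H) = ν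

section Braiding

variable (k H : Type u) [Field k] [Ring H] [Algebra k H] [WeakHopfAlgebra k H]
  [QuasitriangularStructure k H]

local notation "δ" => (Coalgebra.comul : H →ₗ[k] H ⊗[k] H)
local notation "ϵ" => (Coalgebra.counit : H →ₗ[k] k)
local notation "εt" => targetCounit k H
local notation "εs" => sourceCounit k H
local notation "σ" => (WeakHopfAlgebra.antipode : H →ₗ[k] H)
local notation "ℛ" => (QuasitriangularStructure.R : H ⊗[k] H)
local notation "ℛ'" => (QuasitriangularStructure.Rbar : H ⊗[k] H)
local notation "τ" => Algebra.TensorProduct.comm k H H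
local infixr:72 " ⊡ " => wtm k H

variable {k H} {P : Type*} [AddCommGroup P] [Module k P]

theorem ts_flip (t : H ⊗[k] H) {f : H → H → P} (h1 : ∀ b, Lin k fun a => f a b)
    (h2 : ∀ a, Lin k fun b => f a b) : ts (τ t) f = ts t fun a b => f b a := by
  conv_lhs => rw [← ts_tmul_self t]
  rw [Lin.map_ts (g := fun t => τ t) (Lin.coe (τ).toLinearMap),
    Lin.map_ts (g := fun t => ts t f) (by fun_prop)]
  refine ts_congr _ fun a b => ?_
  rw [Algebra.TensorProduct.comm_tmul, ts_tmul _ _ h1 h2]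

theorem flip_flip (t : H ⊗[k] H) : τ (τ t) = t := by
  induction t with
  | zero => simp
  | add x y hx hy => simp [hx, hy]
  | tmul a b => simp

theorem R_mul_comul_one : ℛ * δ 1 = ℛ := by
  obtain ⟨X, hX⟩ := QuasitriangularStructure.R_mem (k := k) (H := H)
  rw [hX, mul_assoc, ← WeakHopfAlgebra.comul_mul, one_mul]

theorem comul_op_one_mul_R : τ (δ 1) * ℛ = ℛ := by
  rw [QuasitriangularStructure.comul_op_mul_R, R_mul_comul_one]

theorem comul_one_mul_flip_R : δ 1 * τ ℛ = τ ℛ := by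
  conv_rhs => rw [← comul_op_one_mul_R, map_mul, flip_flip]

theorem comul_one_mul_Rbar : δ 1 * ℛ' = ℛ' := by
  obtain ⟨X, hX⟩ := QuasitriangularStructure.Rbar_mem (k := k) (H := H)
  rw [hX, ← mul_assoc, ← mul_assoc, ← WeakHopfAlgebra.comul_mul, one_mul]

theorem Rbar_mul_comul_op_one : ℛ' * τ (δ 1) = ℛ' := by
  rw [← QuasitriangularStructure.R_mul_Rbar, ← mul_assoc, QuasitriangularStructure.Rbar_mul_R,
    comul_one_mul_Rbar]

theorem sw_R_comul_right {f : H → H → H → P} (h1 : ∀ b c, Lin k fun a => f a b c)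
    (h2 : ∀ a c, Lin k fun b => f a b c) (h3 : ∀ a b, Lin k fun c => f a b c) :
    ts ℛ (fun a b => ts (δ b) fun c d => f a c d) =
      ts ℛ fun a b => ts ℛ fun c d => f (a * c) d b := by
  have hL : Lin k (fun t : H ⊗[k] (H ⊗[k] H) => ts t fun a s => ts s fun b c => f a b c) := by
    fun_prop
  have e := congrArg (fun t => ts t fun a s => ts s fun b c => f a b c)
    (QuasitriangularStructure.lTensor_comul_R (k := k) (H := H))
  have e1 : LinearMap.lTensor H δ ℛ = ts ℛ fun a b => a ⊗ₜ δ b := by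
    conv_lhs => rw [← ts_tmul_self ℛ]
    rw [Lin.map_ts (Lin.coe _)]
    simp
  have e2 : LinearMap.lTensor H (TensorProduct.mk k H H 1) ℛ *
      TensorProduct.assoc k H H H (ℛ ⊗ₜ[k] (1 : H)) =
      ts ℛ fun a b => ts ℛ fun c d => (a * c) ⊗ₜ (d ⊗ₜ b) := by
    conv_lhs => rw [← ts_tmul_self ℛ]
    simp [ts, sum_tmul, Finset.sum_mul, Finset.mul_sum]
    exact Finset.sum_comm
  rw [e1, e2] at e
  simp only [hL.map_ts] at e
  simp (disch := fun_prop) only [ts_tmul] at e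
  exact e

theorem sw_R_comul_left {f : H → H → H → P} (h1 : ∀ b c, Lin k fun a => f a b c)
    (h2 : ∀ a c, Lin k fun b => f a b c) (h3 : ∀ a b, Lin k fun c => f a b c) :
    ts ℛ (fun a b => ts (δ a) fun c d => f c d b) =
      ts ℛ fun a b => ts ℛ fun c d => f a c (b * d) := by
  have hL : Lin k (fun t : H ⊗[k] (H ⊗[k] H) => ts t fun a s => ts s fun b c => f a b c) := by
    fun_prop
  have e := congrArg (fun t => ts t fun a s => ts s fun b c => f a b c)
    (QuasitriangularStructure.rTensor_comul_R (k := k) (H := H))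
  have e1 : TensorProduct.assoc k H H H (LinearMap.rTensor H δ ℛ) =
      ts ℛ fun a b => ts (δ a) fun c d => c ⊗ₜ (d ⊗ₜ b) := by
    conv_lhs => rw [← ts_tmul_self ℛ]
    rw [Lin.map_ts (g := fun t => TensorProduct.assoc k H H H (LinearMap.rTensor H δ t))
      ⟨by simp, by simp⟩]
    refine ts_congr _ fun a b => ?_
    rw [LinearMap.rTensor_tmul]
    conv_lhs => rw [← ts_tmul_self (δ a)]
    rw [Lin.map_ts (g := fun t => TensorProduct.assoc k H H H (t ⊗ₜ[k] b))
      ⟨by simp [add_tmul], fun c x => by simp [← smul_tmul']⟩]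
    simp
  have e2 : LinearMap.lTensor H (TensorProduct.mk k H H 1) ℛ * ((1 : H) ⊗ₜ[k] ℛ) =
      ts ℛ fun a b => ts ℛ fun c d => a ⊗ₜ (c ⊗ₜ (b * d)) := by
    conv_lhs => rw [← ts_tmul_self ℛ]
    simp [ts, tmul_sum, Finset.sum_mul, Finset.mul_sum]
    exact Finset.sum_comm
  rw [e1, e2] at e
  simp only [hL.map_ts] at e
  simp (disch := fun_prop) only [ts_tmul] at e
  exact e

section

variable (k H) (V W : Type u) [AddCommGroup V] [Module k V] [Module H V] [IsScalarTower k H V]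
  [AddCommGroup W] [Module k W] [Module H W] [IsScalarTower k H W]

/-- The action of `R₂₁` after the flip, `x ↦ R⁽²⁾ · x⁽²⁾ ⊗ R⁽¹⁾ · x⁽¹⁾`. -/
def braidLin : WTensor k H V W →ₗ[k] WTensor k H W V :=
  LinearMap.codRestrict (LinearMap.eqLocus (tensorAct k H W V (δ 1)) LinearMap.id)
    (tensorAct k H W V (τ ℛ) ∘ₗ (TensorProduct.comm k V W).toLinearMap ∘ₗ WTensor.incl k H V W)
    fun x => by
      change (tensorAct k H W V (δ 1) * tensorAct k H W V (τ ℛ)) _ = _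
      rw [← map_mul, comul_one_mul_flip_R]; rfl

/-- The inverse braiding, `y ↦ R̄⁽¹⁾ · y⁽²⁾ ⊗ R̄⁽²⁾ · y⁽¹⁾`. -/
def braidInvLin : WTensor k H W V →ₗ[k] WTensor k H V W :=
  LinearMap.codRestrict (LinearMap.eqLocus (tensorAct k H V W (δ 1)) LinearMap.id)
    (tensorAct k H V W ℛ' ∘ₗ (TensorProduct.comm k W V).toLinearMap ∘ₗ WTensor.incl k H W V)
    fun x => by
      change (tensorAct k H V W (δ 1) * tensorAct k H V W ℛ') _ = _
      rw [← map_mul, comul_one_mul_Rbar]; rfl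

variable {k H V W}

theorem comm_act (t : H ⊗[k] H) (x : V ⊗[k] W) : TensorProduct.comm k V W (tensorAct k H V W t x) =
    tensorAct k H W V (τ t) (TensorProduct.comm k V W x) := by
  induction t with
  | zero => simp
  | add s t hs ht => simp [hs, ht]
  | tmul a b =>
    induction x with
    | zero => simp
    | add x y hx hy => simp only [map_add, hx, hy]
    | tmul v w => simp

theorem braidLin_wtm (v : V) (w : W) :
    braidLin k H V W (v ⊡ w) = ts ℛ fun a b => (b • w) ⊡ (a • v) := by
  have e : WTensor.incl k H W V (braidLin k H V W (v ⊡ w)) =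
      tensorAct k H W V (τ ℛ) (w ⊗ₜ v) := by
    change tensorAct k H W V (τ ℛ) (TensorProduct.comm k V W
      (tensorAct k H V W (δ 1) (v ⊗ₜ w))) = _
    rw [comm_act, ← Module.End.mul_apply, ← map_mul, ← map_mul, R_mul_comul_one,
      TensorProduct.comm_tmul]
  rw [← WTensor.proj_incl k H (braidLin k H V W (v ⊡ w)), e, proj_act,
    ts_flip _ (by fun_prop) (by fun_prop)]

theorem braidInvLin_wtm (v : V) (w : W) :
    braidInvLin k H V W (w ⊡ v) = ts ℛ' fun a b => (a • v) ⊡ (b • w) := by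
  have e : WTensor.incl k H V W (braidInvLin k H V W (w ⊡ v)) =
      tensorAct k H V W ℛ' (v ⊗ₜ w) := by
    change tensorAct k H V W ℛ' (TensorProduct.comm k W V
      (tensorAct k H W V (δ 1) (w ⊗ₜ v))) = _
    rw [comm_act, ← Module.End.mul_apply, ← map_mul, Rbar_mul_comul_op_one,
      TensorProduct.comm_tmul]
  rw [← WTensor.proj_incl k H (braidInvLin k H V W (w ⊡ v)), e, proj_act]

theorem braidLin_smul (h : H) (x : WTensor k H V W) :
    braidLin k H V W (h • x) = h • braidLin k H V W x :=
  WTensor.ind (f := fun x => braidLin k H V W (h • x)) (g := fun x => h • braidLin k H V W x)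
    (by fun_prop) (by fun_prop) (fun v w => by
      have e := congrArg (fun t => ts t fun a b => (b • w) ⊡ (a • v))
        (QuasitriangularStructure.comul_op_mul_R (k := k) h)
      simp (disch := fun_prop) only [ts_mul, ts_flip] at e
      rw [smul_wtm, Lin.map_ts (Lin.coe _), braidLin_wtm,
        Lin.map_ts (g := fun x => h • x) (by fun_prop)]
      simp only [braidLin_wtm, smul_wtm, smul_smul]
      rw [ts_comm, ← e, ts_comm]) x

theorem braidInvLin_braidLin (x : WTensor k H V W) :
    braidInvLin k H V W (braidLin k H V W x) = x :=
  WTensor.ind (f := fun x => braidInvLin k H V W (braidLin k H V W x)) (g := fun x => x)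
    (by fun_prop) (by fun_prop) (fun v w => by
      have e := congrArg (fun t => ts t fun a b => (a • v) ⊡ (b • w))
        (QuasitriangularStructure.Rbar_mul_R (k := k) (H := H))
      simp (disch := fun_prop) only [ts_mul] at e
      rw [braidLin_wtm, Lin.map_ts (Lin.coe _)]
      simp only [braidInvLin_wtm, smul_smul]
      rw [ts_comm, e, wtm_one]) x

theorem braidLin_braidInvLin (x : WTensor k H W V) :
    braidLin k H V W (braidInvLin k H V W x) = x :=
  WTensor.ind (f := fun x => braidLin k H V W (braidInvLin k H V W x)) (g := fun x => x)
    (by fun_prop) (by fun_prop) (fun w v => by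
      have e := congrArg (fun t => ts t fun a b => (b • w) ⊡ (a • v))
        (QuasitriangularStructure.R_mul_Rbar (k := k) (H := H))
      simp (disch := fun_prop) only [ts_mul, ts_flip] at e
      rw [braidInvLin_wtm, Lin.map_ts (Lin.coe _)]
      simp only [braidLin_wtm, smul_smul]
      rw [ts_comm, e, wtm_one]) x

end

end Braiding

section Dual

variable (k H : Type u) [Field k] [Ring H] [Algebra k H] [WeakHopfAlgebra k H]

local notation "δ" => (Coalgebra.comul : H →ₗ[k] H ⊗[k] H)
local notation "ϵ" => (Coalgebra.counit : H →ₗ[k] k)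
local notation "εt" => targetCounit k H
local notation "εs" => sourceCounit k H
local notation "σ" => (WeakHopfAlgebra.antipode : H →ₗ[k] H)
local infixr:72 " ⊡ " => wtm k H
local notation "ₜ" => TargetSub.mk k H

variable (V : Type u) [AddCommGroup V] [Module k V] [Module H V] [IsScalarTower k H V]

/-- The dual module `V* = Hom_k(V, k)`, with `(h · φ)(v) = φ(S(h) · v)`. -/
def DualMod (_ : Type u) (V : Type u) [AddCommGroup V] [Module k V] : Type u := V →ₗ[k] k

instance : AddCommGroup (DualMod k H V) := inferInstanceAs (AddCommGroup (V →ₗ[k] k))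

instance : Module k (DualMod k H V) := inferInstanceAs (Module k (V →ₗ[k] k))

instance [FiniteDimensional k V] : FiniteDimensional k (DualMod k H V) :=
  inferInstanceAs (FiniteDimensional k (V →ₗ[k] k))

/-- The evaluation of functionals. -/
def DualMod.ev : DualMod k H V →ₗ[k] V →ₗ[k] k := (LinearMap.id : (V →ₗ[k] k) →ₗ[k] (V →ₗ[k] k))

instance : Module H (DualMod k H V) where
  smul h φ := DualMod.ev k H V φ ∘ₗ Algebra.lsmul k k V (σ h)
  one_smul φ := LinearMap.ext fun v => by
    change DualMod.ev k H V φ (σ 1 • v) = DualMod.ev k H V φ v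
    rw [antipode_one, one_smul]
  mul_smul a b φ := LinearMap.ext fun v => by
    change DualMod.ev k H V φ (σ (a * b) • v) = DualMod.ev k H V φ (σ b • σ a • v)
    rw [antipode_mul_rev, mul_smul]
  smul_zero a := rfl
  smul_add a φ ψ := rfl
  add_smul a b φ := LinearMap.ext fun v => by
    change DualMod.ev k H V φ (σ (a + b) • v) =
      DualMod.ev k H V φ (σ a • v) + DualMod.ev k H V φ (σ b • v)
    rw [map_add, add_smul, map_add]
  zero_smul φ := LinearMap.ext fun v => by
    change DualMod.ev k H V φ (σ 0 • v) = 0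
    rw [map_zero, zero_smul, map_zero]

variable {k H V}

theorem DualMod.ext {φ ψ : DualMod k H V} (h : ∀ v, DualMod.ev k H V φ v = DualMod.ev k H V ψ v) :
    φ = ψ := LinearMap.ext h

theorem DualMod.smul_ev (h : H) (φ : DualMod k H V) (v : V) :
    DualMod.ev k H V (h • φ) v = DualMod.ev k H V φ (σ h • v) := rfl

instance : IsScalarTower k H (DualMod k H V) where
  smul_assoc c h φ := DualMod.ext fun v => by
    simp only [DualMod.smul_ev, map_smul, smul_assoc, LinearMap.smul_apply]

variable (k H V)

/-- The evaluation `V* ⊗ V → H_t`, `φ ⊗ v ↦ φ(1₁ · v) 1₂`. (As `ε_t(1₂) = 1₂`, the element `1₂`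
of `H_t` is `ε_t(1₂)`.) -/
def evalLin : WTensor k H (DualMod k H V) V →ₗ[k] TargetSub k H :=
  TensorProduct.lift (LinearMap.mk₂ k
    (fun (φ : DualMod k H V) (v : V) => TensorProduct.lid k (TargetSub k H) (TensorProduct.map
      (DualMod.ev k H V φ ∘ₗ (Algebra.lsmul k k V).toLinearMap.flip v) (TargetSub.mk k H) (δ 1)))
    (fun φ ψ v => by simp [LinearMap.add_comp, TensorProduct.map_add_left])
    (fun c φ v => by simp [LinearMap.smul_comp, TensorProduct.map_smul_left])
    (fun φ v w => by simp [LinearMap.comp_add, TensorProduct.map_add_left])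
    (fun c φ v => by simp [LinearMap.comp_smul, TensorProduct.map_smul_left])) ∘ₗ
  WTensor.incl k H (DualMod k H V) V

/-- The canonical element `∑ gᵢ ⊗ γⁱ` of `V ⊗_k V*`, for dual bases `gᵢ` and `γⁱ`. -/
def canon [FiniteDimensional k V] : V ⊗[k] DualMod k H V := coevaluation k V 1

/-- The coevaluation `H_t → V ⊗ V*`, `z ↦ z · ∑ gᵢ ⊗ γⁱ`, where `z` acts through `Δ(z)`. -/
def coevLin [FiniteDimensional k V] : TargetSub k H →ₗ[k] WTensor k H V (DualMod k H V) :=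
  LinearMap.codRestrict (LinearMap.eqLocus (tensorAct k H V (DualMod k H V) (δ 1)) LinearMap.id)
    ((tensorAct k H V (DualMod k H V)).toLinearMap.flip (canon k H V) ∘ₗ δ ∘ₗ TargetSub.val k H)
    fun _ => tensorAct_one_mul k H V (DualMod k H V) _ _

variable {k H V}

theorem evalLin_wtm (φ : DualMod k H V) (v : V) : evalLin k H V (φ ⊡ v) =
    ts (δ 1) fun a b => DualMod.ev k H V φ (a • v) • ₜ b := by
  have e : ∀ (φ : DualMod k H V) (v : V), TensorProduct.lid k (TargetSub k H) (TensorProduct.map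
      (DualMod.ev k H V φ ∘ₗ (Algebra.lsmul k k V).toLinearMap.flip v) (TargetSub.mk k H) (δ 1)) =
      ts (δ 1) fun a b => DualMod.ev k H V φ (a • v) • ₜ b := fun φ v => by
    conv_lhs => rw [← ts_tmul_self (δ 1)]
    simp [ts]
  have := sw_adjoint (k := k) 1 (f := fun a b => DualMod.ev k H V φ (a • v) • ₜ b)
    (by fun_prop) (by fun_prop)
  simp only [one_mul, TargetSub.mk_targetCounit] at this
  rw [← this, evalLin]
  refine (comp_incl_wtm (V := DualMod k H V) (W := V) (TensorProduct.lift _) φ v).trans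
    (ts_congr _ fun p q => (TensorProduct.lift.tmul _ _).trans ((e _ _).trans (ts_congr _ fun a b => ?_)))
  rw [DualMod.smul_ev, smul_smul, smul_smul, mul_assoc]

theorem evalLin_smul (h : H) (x : WTensor k H (DualMod k H V) V) :
    evalLin k H V (h • x) = h • evalLin k H V x :=
  WTensor.ind (f := fun x => evalLin k H V (h • x)) (g := fun x => h • evalLin k H V x)
    (by fun_prop) (by fun_prop) (fun φ v => by
      have := sw_adjoint h (f := fun a b => DualMod.ev k H V φ (a • v) • ₜ b)
        (by fun_prop) (by fun_prop)
      simp only [TargetSub.mk_targetCounit] at this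
      rw [smul_wtm, Lin.map_ts (Lin.coe _), evalLin_wtm,
        Lin.map_ts (g := fun x => h • x) (by fun_prop)]
      simp only [evalLin_wtm, DualMod.smul_ev, smul_smul, smul_comm h, TargetSub.smul_mk]
      rw [← this]
      simp only [mul_assoc]) x

section

variable [FiniteDimensional k V] {P : Type*} [AddCommGroup P] [Module k P]

local notation "𝒞" => canon k H V

theorem ts_canon {f : V → DualMod k H V → P} (h1 : ∀ φ, Lin k fun v => f v φ)
    (h2 : ∀ v, Lin k fun φ => f v φ) : ts 𝒞 f =
      ∑ i, f (Module.Basis.ofVectorSpace k V i) ((Module.Basis.ofVectorSpace k V).coord i) := by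
  rw [ts_eq_lift2 _ h1 h2, canon, coevaluation_apply_one]
  change lift2 (N := DualMod k H V) f h1 h2 (∑ i, (Module.Basis.ofVectorSpace k V i) ⊗ₜ[k]
    (show DualMod k H V from (Module.Basis.ofVectorSpace k V).coord i)) = _
  rw [map_sum]
  refine Finset.sum_congr rfl fun i _ => ?_
  rw [← ts_eq_lift2, ts_tmul _ _ h1 h2]

theorem canon_left {f : V → P} (hf : Lin k f) (w : V) :
    ts 𝒞 (fun g γ => DualMod.ev k H V γ w • f g) = f w := by
  rw [ts_canon (by fun_prop) (by fun_prop)]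
  conv_rhs => rw [← (Module.Basis.ofVectorSpace k V).sum_repr w]
  have := map_sum hf.mk' (fun i => (Module.Basis.ofVectorSpace k V).repr w i •
    Module.Basis.ofVectorSpace k V i) Finset.univ
  refine Eq.trans ?_ this.symm
  exact Finset.sum_congr rfl fun i _ => (hf.map_smul _ _).symm

theorem canon_right {f : DualMod k H V → P} (hf : Lin k f) (φ : DualMod k H V) :
    ts 𝒞 (fun g γ => DualMod.ev k H V φ g • f γ) = f φ := by
  have e : φ = ts 𝒞 fun g γ => DualMod.ev k H V φ g • γ := by
    refine DualMod.ext fun v => ?_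
    rw [Lin.map_ts (g := fun ψ => DualMod.ev k H V ψ v) (by fun_prop)]
    simp only [map_smul, LinearMap.smul_apply, smul_eq_mul, mul_comm (DualMod.ev k H V φ _)]
    exact (canon_left (f := fun g => DualMod.ev k H V φ g) (by fun_prop) v).symm
  conv_rhs => rw [e, hf.map_ts]
  simp only [hf.map_smul]

variable (k) in
/-- The functional `φ(h · -)`. -/
def DualMod.pre (φ : DualMod k H V) : H →ₗ[k] DualMod k H V :=
  LinearMap.llcomp k V V k (DualMod.ev k H V φ) ∘ₗ (Algebra.lsmul k k V).toLinearMap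

theorem DualMod.pre_ev (φ : DualMod k H V) (h : H) (v : V) :
    DualMod.ev k H V (DualMod.pre k φ h) v = DualMod.ev k H V φ (h • v) := rfl

theorem DualMod.smul_eq_pre (h : H) (φ : DualMod k H V) : h • φ = DualMod.pre k φ (σ h) := rfl

@[fun_prop] theorem Lin.pre_left {L : Type*} [AddCommGroup L] [Module k L] {g : L → DualMod k H V}
    (hg : Lin k g) (h : H) : Lin k fun x => DualMod.pre k (g x) h :=
  ⟨fun x y => by rw [hg.map_add]; exact DualMod.ext fun v => by simp [DualMod.pre_ev],
   fun c x => by rw [hg.map_smul]; exact DualMod.ext fun v => by simp [DualMod.pre_ev]⟩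

/-- `∑ xgᵢ ⊗ γⁱ = ∑ gᵢ ⊗ γⁱ(x · -)`. -/
theorem canon_move {f : V → DualMod k H V → P} (h1 : ∀ φ, Lin k fun v => f v φ)
    (h2 : ∀ v, Lin k fun φ => f v φ) (x : H) :
    ts 𝒞 (fun g γ => f (x • g) γ) = ts 𝒞 fun g γ => f g (DualMod.pre k γ x) := by
  have e : ∀ g γ, f (x • g) γ = ts 𝒞 fun g' γ' => DualMod.ev k H V γ' (x • g) • f g' γ :=
    fun g γ => (canon_left (h1 γ) (x • g)).symm
  simp only [e]
  rw [ts_comm]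
  refine ts_congr _ fun g' γ' => ?_
  exact canon_right (h2 g') (DualMod.pre k γ' x)

theorem coevLin_eq (z : TargetSub k H) : coevLin k H V z =
    ts 𝒞 fun g γ => (TargetSub.val k H z • g) ⊡ γ := by
  have e : coevLin k H V z = WTensor.proj k H V (DualMod k H V)
      (tensorAct k H V (DualMod k H V) (δ (TargetSub.val k H z)) 𝒞) :=
    (WTensor.proj_incl k H (coevLin k H V z)).symm
  rw [e]
  conv_lhs => rw [← ts_tmul_self 𝒞]
  rw [Lin.map_ts (Lin.coe _), Lin.map_ts (Lin.coe _)]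
  simp only [proj_act]
  rw [ts_comm]
  simp only [DualMod.smul_eq_pre]
  conv_lhs =>
    enter [2, a, b]
    rw [← canon_move (f := fun g γ => (a • g) ⊡ γ) (by fun_prop) (by fun_prop) (σ b)]
  rw [ts_comm]
  refine ts_congr _ fun g γ => ?_
  conv_rhs => rw [← TargetSub.targetCounit_val, ← sw_mul_antipode,
    Lin.map_ts (g := fun x : H => (x • g) ⊡ γ) (by fun_prop)]
  simp only [smul_smul]

theorem coevLin_smul (h : H) (z : TargetSub k H) :
    coevLin k H V (h • z) = h • coevLin k H V z := by
  rw [coevLin_eq, coevLin_eq, Lin.map_ts (g := fun x => h • x) (by fun_prop)]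
  simp only [smul_wtm]
  rw [ts_comm]
  simp only [DualMod.smul_eq_pre]
  conv_rhs =>
    enter [2, a, b]
    rw [← canon_move (f := fun g γ => (a • TargetSub.val k H z • g) ⊡ γ) (by fun_prop)
      (by fun_prop) (σ b)]
  rw [ts_comm]
  refine ts_congr _ fun g γ => ?_
  rw [TargetSub.smul_def, TargetSub.val_mk, ← sw_mul_antipode_target _
    (TargetSub.targetCounit_val z), Lin.map_ts (g := fun x : H => (x • g) ⊡ γ) (by fun_prop)]
  simp only [smul_smul, mul_assoc]

theorem zigzag_left (z : TargetSub k H) (x : V) :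
    (ts 𝒞 fun g γ => (TargetSub.val k H z • g) ⊡ evalLin k H V (γ ⊡ x)) =
      (TargetSub.val k H z • x) ⊡ ₜ 1 := by
  simp only [evalLin_wtm]
  have e : ∀ (g : V) (γ : DualMod k H V), (TargetSub.val k H z • g) ⊡ (ts (δ 1) fun a b =>
      DualMod.ev k H V γ (a • x) • ₜ b) = ts (δ 1) fun a b =>
      DualMod.ev k H V γ (a • x) • ((TargetSub.val k H z • g) ⊡ ₜ b) := fun g γ => by
    rw [Lin.map_ts (g := fun y => (TargetSub.val k H z • g) ⊡ y) (by fun_prop)]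
    simp only [map_smul]
  simp only [e]
  rw [ts_comm]
  conv_lhs =>
    enter [2, a, b]
    rw [canon_left (f := fun g => (TargetSub.val k H z • g) ⊡ ₜ b) (by fun_prop)]
  rw [← wtm_one (TargetSub.val k H z • x)]
  have hz := TargetSub.targetCounit_val z
  have := (sw_target' hz (f := fun a b => (a • x) ⊡ ₜ b) (by fun_prop) (by fun_prop)).symm.trans
    (sw_target hz (by fun_prop) (by fun_prop))
  simpa only [TargetSub.smul_mk, mul_one, smul_smul] using this

theorem zigzag_right (φ : DualMod k H V) (z : TargetSub k H) :
    (ts 𝒞 fun g γ => evalLin k H V (φ ⊡ (TargetSub.val k H z • g)) ⊡ γ) =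
      ₜ 1 ⊡ rightUnitLin k H (DualMod k H V) (φ ⊡ z) := by
  have hz := TargetSub.targetCounit_val z
  have e : ∀ (g : V) (γ : DualMod k H V), evalLin k H V (φ ⊡ (TargetSub.val k H z • g)) ⊡ γ =
      ts (δ 1) fun a b => DualMod.ev k H V (DualMod.pre k φ (a * TargetSub.val k H z)) g •
        (ₜ b ⊡ γ) := fun g γ => by
    rw [evalLin_wtm, Lin.map_ts (g := fun y => y ⊡ γ) (by fun_prop)]
    simp only [Lin.map_smul (f := fun y : TargetSub k H => y ⊡ γ) (by fun_prop), DualMod.pre_ev, mul_smul]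
  simp only [e]
  rw [ts_comm]
  conv_lhs =>
    enter [2, a, b]
    rw [canon_right (f := fun γ => ₜ b ⊡ γ) (by fun_prop)]
  rw [← wtm_one]
  simp only [TargetSub.smul_mk, mul_one]
  have hy : rightUnitLin k H (DualMod k H V) (φ ⊡ z) =
      DualMod.pre k φ (TargetSub.val k H z) := by
    rw [rightUnitLin_wtm]
    simp only [DualMod.smul_eq_pre]
    have : TargetSub.val k H z = ts (δ 1) fun a b => ϵ (b * TargetSub.val k H z) • σ a := by
      rw [← sw_one_source (f := fun a b => ϵ (b * TargetSub.val k H z) • σ a) (by fun_prop)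
        (by fun_prop)]
      simp only [antipode_source (sourceCounit_idem _)]
      rw [sw_one_source (f := fun a b => ϵ (b * TargetSub.val k H z) • εt a) (by fun_prop)
        (by fun_prop), sw_targetCounit_counit, one_mul, hz]
    conv_rhs => rw [this, Lin.map_ts (Lin.coe _)]
    simp only [map_smul]
  rw [hy]
  have e2 : ∀ b : H, b • DualMod.pre k φ (TargetSub.val k H z) =
      DualMod.pre k φ (TargetSub.val k H z * σ b) := fun b => DualMod.ext fun v => by
    simp only [DualMod.smul_ev, DualMod.pre_ev, mul_smul]
  simp only [e2]
  have e3 := sw_one_swap (f := fun p q => ₜ p ⊡ DualMod.pre k φ (TargetSub.val k H z * q))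
    (by fun_prop) (by fun_prop)
  simp only [TargetSub.mk_targetCounit] at e3
  rw [e3, ← sw_target hz (f := fun a b => ₜ b ⊡ DualMod.pre k φ a) (by fun_prop) (by fun_prop),
    sw_target' hz (by fun_prop) (by fun_prop)]

end

end Dual

/-! ### The representation category -/

section Rep

/-- The representations of a weak Hopf algebra: finite dimensional `H`-modules. -/
structure WHRep (k H : Type u) [Field k] [Ring H] [Algebra k H] where
  carrier : Type u
  [addCommGroup : AddCommGroup carrier]
  [moduleField : Module k carrier]
  [module : Module H carrier]
  [isScalarTower : IsScalarTower k H carrier]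
  [finiteDimensional : FiniteDimensional k carrier]

attribute [instance] WHRep.addCommGroup WHRep.moduleField WHRep.module WHRep.isScalarTower
  WHRep.finiteDimensional

variable {k H : Type u} [Field k] [Ring H] [Algebra k H]

instance : CoeSort (WHRep k H) (Type u) := ⟨WHRep.carrier⟩

/-- The morphisms of representations are the `H`-linear maps. -/
instance : Category (WHRep k H) where
  Hom V W := V →ₗ[H] W
  id V := LinearMap.id
  comp f g := g ∘ₗ f

/-- The linear map underlying a morphism. -/
def WHRep.lin {V W : WHRep k H} (f : V ⟶ W) : V →ₗ[H] W := f

/-- The morphism given by a linear map. -/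
def WHRep.ofHom {V W : WHRep k H} (f : V →ₗ[H] W) : V ⟶ W := f

open WHRep

@[simp] theorem lin_ofHom {V W : WHRep k H} (f : V →ₗ[H] W) : lin (ofHom f) = f := rfl

@[simp] theorem lin_id (V : WHRep k H) (v : V) : lin (𝟙 V) v = v := rfl

@[simp] theorem lin_comp {U V W : WHRep k H} (f : U ⟶ V) (g : V ⟶ W) (u : U) :
    lin (f ≫ g) u = lin g (lin f u) := rfl

theorem rep_ext {V W : WHRep k H} {f g : V ⟶ W} (h : ∀ v, lin f v = lin g v) : f = g :=
  LinearMap.ext h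

instance : Preadditive (WHRep k H) where
  homGroup V W := inferInstanceAs (AddCommGroup (V →ₗ[H] W))
  add_comp _ _ _ f f' g := LinearMap.comp_add f f' g
  comp_add _ _ _ _ _ _ := rfl

instance : Linear k (WHRep k H) where
  homModule V W := inferInstanceAs (Module k (V →ₗ[H] W))
  smul_comp _ _ _ c f g := rep_ext fun v => by
    change lin g (c • lin f v) = c • lin g (lin f v)
    rw [← algebraMap_smul H c (lin f v), map_smul, algebraMap_smul]
  comp_smul _ _ _ _ _ _ := rfl

@[simp] theorem lin_add {V W : WHRep k H} (f g : V ⟶ W) (v : V) :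
    lin (f + g) v = lin f v + lin g v := rfl

@[simp] theorem lin_smul {V W : WHRep k H} (c : k) (f : V ⟶ W) (v : V) :
    lin (c • f) v = c • lin f v := rfl

@[simp] theorem lin_zero {V W : WHRep k H} (v : V) : lin (0 : V ⟶ W) v = 0 := rfl

variable [WeakHopfAlgebra k H]

/-- An isomorphism of representations from mutually inverse equivariant maps. -/
def mkIso {V W : WHRep k H} (f : V →ₗ[k] W) (g : W →ₗ[k] V) (hf : ∀ (h : H) v, f (h • v) = h • f v)
    (hgf : ∀ v, g (f v) = v) (hfg : ∀ w, f (g w) = w) : V ≅ W where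
  hom := ofHom (mkHom f hf)
  inv := ofHom (mkHom g fun h w => by rw [← hgf (h • g w), hf, hfg])
  hom_inv_id := rep_ext hgf
  inv_hom_id := rep_ext hfg

section

local infixr:72 " ⊡ " => wtm k H
local notation "ₜ" => TargetSub.mk k H

variable [FiniteDimensional k H]

instance : MonoidalCategoryStruct (WHRep k H) where
  tensorObj V W := ⟨WTensor k H V W⟩
  whiskerLeft V _ _ g := ofHom (wmap k H (lin (𝟙 V)) (lin g))
  whiskerRight f W := ofHom (wmap k H (lin f) (lin (𝟙 W)))
  tensorHom f g := ofHom (wmap k H (lin f) (lin g))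
  tensorUnit := ⟨TargetSub k H⟩
  associator U V W := mkIso (V := ⟨WTensor k H (WTensor k H U V) W⟩)
    (W := ⟨WTensor k H U (WTensor k H V W)⟩) (assocHom k H U V W) (assocInv k H U V W)
    assocHom_smul assocInv_assocHom assocHom_assocInv
  leftUnitor V := mkIso (V := ⟨WTensor k H (TargetSub k H) V⟩) (leftUnitLin k H V)
    (WTensor.mk k H (TargetSub k H) V (ₜ 1)) leftUnitLin_smul one_wtm_leftUnitLin leftUnitLin_one
  rightUnitor V := mkIso (V := ⟨WTensor k H V (TargetSub k H)⟩) (rightUnitLin k H V)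
    ((WTensor.mk k H V (TargetSub k H)).flip (ₜ 1)) rightUnitLin_smul rightUnitLin_wtm_one
    rightUnitLin_one

/-- The element `Δ(1) · (v ⊗ w)` of a tensor product of representations. -/
def tp {V W : WHRep k H} (v : V) (w : W) : (V ⊗ W : WHRep k H) := v ⊡ w

local infixr:72 " ⊠ " => tp

@[fun_prop] theorem Lin.tp_left {V W : WHRep k H} {L : Type*} [AddCommGroup L] [Module k L]
    {g : L → V} (hg : Lin k g) (w : W) : Lin k (fun x => g x ⊠ w) := Lin.wtm_left hg w

@[fun_prop] theorem Lin.tp_right {V W : WHRep k H} {L : Type*} [AddCommGroup L] [Module k L]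
    {g : L → W} (hg : Lin k g) (v : V) : Lin k (fun x => v ⊠ g x) := Lin.wtm_right hg v

theorem smul_tp {V W : WHRep k H} (h : H) (v : V) (w : W) : h • (v ⊠ w) =
    ts (Coalgebra.comul (R := k) h) fun a b => (a • v) ⊠ (b • w) := smul_wtm h v w

theorem rep_ext₂ {V W X : WHRep k H} {f g : V ⊗ W ⟶ X}
    (h : ∀ (v : V) (w : W), lin f (v ⊠ w) = lin g (v ⊠ w)) : f = g :=
  rep_ext (WTensor.ind (Lin.hom (lin f)) (Lin.hom (lin g)) h)

theorem rep_ext₃ {U V W X : WHRep k H} {f g : (U ⊗ V) ⊗ W ⟶ X}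
    (h : ∀ (u : U) (v : V) (w : W), lin f ((u ⊠ v) ⊠ w) = lin g ((u ⊠ v) ⊠ w)) : f = g :=
  rep_ext (WTensor.ind3 (U := U) (V := V) (W := W) (Lin.hom (lin f)) (Lin.hom (lin g)) h)

theorem rep_ext₃' {U V W X : WHRep k H} {f g : U ⊗ V ⊗ W ⟶ X}
    (h : ∀ (u : U) (v : V) (w : W), lin f (u ⊠ v ⊠ w) = lin g (u ⊠ v ⊠ w)) : f = g :=
  rep_ext (WTensor.ind3' (U := U) (V := V) (W := W) (Lin.hom (lin f)) (Lin.hom (lin g)) h)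

theorem rep_ext₄ {U V W X Y : WHRep k H} {f g : ((U ⊗ V) ⊗ W) ⊗ X ⟶ Y}
    (h : ∀ (u : U) (v : V) (w : W) (x : X),
      lin f (((u ⊠ v) ⊠ w) ⊠ x) = lin g (((u ⊠ v) ⊠ w) ⊠ x)) : f = g :=
  rep_ext₂ fun p x => WTensor.ind3 (U := U) (V := V) (W := W)
    (f := fun p => lin f (p ⊡ x)) (g := fun p => lin g (p ⊡ x))
    ((Lin.hom (lin f)).comp' (Lin.wtm_left Lin.id' x))
    ((Lin.hom (lin g)).comp' (Lin.wtm_left Lin.id' x)) (fun u v w => h u v w x) p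

@[simp] theorem lin_tensorHom {V V' W W' : WHRep k H} (f : V ⟶ V') (g : W ⟶ W') (v : V) (w : W) :
    lin (f ⊗ₘ g) (v ⊠ w) = lin f v ⊠ lin g w := wmap_wtm _ _ _ _

@[simp] theorem lin_whiskerLeft (V : WHRep k H) {W W' : WHRep k H} (g : W ⟶ W') (v : V) (w : W) :
    lin (V ◁ g) (v ⊠ w) = v ⊠ lin g w := wmap_wtm _ _ _ _

@[simp] theorem lin_whiskerRight {V V' : WHRep k H} (f : V ⟶ V') (W : WHRep k H) (v : V) (w : W) :
    lin (f ▷ W) (v ⊠ w) = lin f v ⊠ w := wmap_wtm _ _ _ _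

@[simp] theorem lin_associator_hom (U V W : WHRep k H) (u : U) (v : V) (w : W) :
    lin (α_ U V W).hom ((u ⊠ v) ⊠ w) = u ⊠ v ⊠ w := assocHom_wtm k H u v w

@[simp] theorem lin_associator_inv (U V W : WHRep k H) (u : U) (v : V) (w : W) :
    lin (α_ U V W).inv (u ⊠ v ⊠ w) = (u ⊠ v) ⊠ w := assocInv_wtm k H u v w

/-- Elements of `H_t` as elements of the unit object. -/
def unitMk (h : H) : (𝟙_ (WHRep k H) : WHRep k H) := ₜ h

/-- Elements of the unit object as elements of `H`. -/
def unitVal (z : (𝟙_ (WHRep k H) : WHRep k H)) : H := TargetSub.val k H z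

theorem lin_leftUnitor_hom (V : WHRep k H) (z : (𝟙_ (WHRep k H) : WHRep k H)) (v : V) :
    lin (λ_ V).hom (z ⊠ v) = unitVal z • v := leftUnitLin_wtm z v

@[simp] theorem lin_leftUnitor_inv (V : WHRep k H) (v : V) :
    lin (λ_ V).inv v = unitMk 1 ⊠ v := rfl

theorem lin_rightUnitor_hom (V : WHRep k H) (v : V) (z : (𝟙_ (WHRep k H) : WHRep k H)) :
    lin (ρ_ V).hom (v ⊠ z) = ts (Coalgebra.comul (R := k) 1) fun a b =>
      (Coalgebra.counit (b * unitVal z) : k) • a • v := rightUnitLin_wtm v z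

@[simp] theorem lin_rightUnitor_inv (V : WHRep k H) (v : V) :
    lin (ρ_ V).inv v = v ⊠ unitMk 1 := rfl

instance : MonoidalCategory (WHRep k H) where
  tensorHom_def f g := rep_ext₂ fun v w => by simp
  id_tensorHom_id V W := rep_ext₂ fun v w => by simp
  tensorHom_comp_tensorHom f f' g g' := rep_ext₂ fun v w => by simp
  whiskerLeft_id V W := rep_ext₂ fun v w => by simp
  id_whiskerRight V W := rep_ext₂ fun v w => by simp
  associator_naturality f g h := rep_ext₃ fun u v w => by simp
  leftUnitor_naturality {V W} f := rep_ext₂ fun z v => by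
    simp [lin_leftUnitor_hom]
  rightUnitor_naturality {V W} f := by
    rw [← Iso.inv_comp_eq, ← Category.assoc, ← Iso.eq_comp_inv]
    exact rep_ext fun v => by simp
  pentagon U V W X := rep_ext₄ fun u v w x => by simp
  triangle V W := rep_ext₂ fun p w => by
    obtain ⟨u, rfl⟩ : ∃ u, p = u ⊠ unitMk 1 := ⟨_, (rightUnitLin_wtm_one p).symm⟩
    have h1 : (1 : H) • w = w := one_smul H w
    have h2 : lin (ρ_ V).hom (u ⊠ unitMk 1) = u := rightUnitLin_one u
    have h3 : unitVal (unitMk (k := k) (1 : H)) = 1 := targetCounit_one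
    simp [lin_leftUnitor_hom, h1, h2, h3]

theorem tp_zero {V W : WHRep k H} (v : V) : v ⊠ (0 : W) = 0 :=
  map_zero (WTensor.mk k H V W v)

theorem zero_tp {V W : WHRep k H} (w : W) : (0 : V) ⊠ w = 0 :=
  map_zero ((WTensor.mk k H V W).flip w)

instance : MonoidalPreadditive (WHRep k H) where
  whiskerLeft_zero := rep_ext₂ fun v w => by simp [tp_zero]
  zero_whiskerRight := rep_ext₂ fun v w => by simp [zero_tp]
  whiskerLeft_add f g := rep_ext₂ fun v w => by
    simp [(Lin.tp_right Lin.id' v).map_add]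
  add_whiskerRight f g := rep_ext₂ fun v w => by
    simp [(Lin.tp_left Lin.id' w).map_add]

instance : MonoidalLinear k (WHRep k H) where
  whiskerLeft_smul X _ _ r f := rep_ext₂ fun v w => by
    simp [(Lin.tp_right Lin.id' v).map_smul]
  smul_whiskerRight r _ _ f X := rep_ext₂ fun v w => by
    simp [(Lin.tp_left Lin.id' w).map_smul]

theorem lin_ts {V W : WHRep k H} (f : V ⟶ W) {M N : Type*} [AddCommGroup M] [Module k M]
    [AddCommGroup N] [Module k N] (t : M ⊗[k] N) (g : M → N → V) :
    lin f (ts t g) = ts t fun a b => lin f (g a b) := Lin.map_ts (Lin.hom (lin f)) t g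

theorem tp_ts {V W : WHRep k H} {M N : Type*} [AddCommGroup M] [Module k M]
    [AddCommGroup N] [Module k N] (t : M ⊗[k] N) (v : V) (g : M → N → W) :
    v ⊠ ts t g = ts t fun a b => v ⊠ g a b := Lin.map_ts (Lin.tp_right Lin.id' v) t g

theorem ts_tp {V W : WHRep k H} {M N : Type*} [AddCommGroup M] [Module k M]
    [AddCommGroup N] [Module k N] (t : M ⊗[k] N) (g : M → N → V) (w : W) :
    ts t g ⊠ w = ts t fun a b => g a b ⊠ w := Lin.map_ts (Lin.tp_left Lin.id' w) t g

theorem lin_map_smul {V W : WHRep k H} (f : V ⟶ W) (h : H) (v : V) :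
    lin f (h • v) = h • lin f v := map_smul (lin f) h v

section Braided

variable [QuasitriangularStructure k H]

local notation "ℛ" => (QuasitriangularStructure.R : H ⊗[k] H)

/-- The braiding `V ⊗ W ≅ W ⊗ V`. -/
def braidIso (V W : WHRep k H) : V ⊗ W ≅ W ⊗ V :=
  mkIso (V := ⟨WTensor k H V W⟩) (W := ⟨WTensor k H W V⟩) (braidLin k H V W)
    (braidInvLin k H V W) braidLin_smul braidInvLin_braidLin braidLin_braidInvLin

theorem lin_braidIso (V W : WHRep k H) (v : V) (w : W) : lin (braidIso V W).hom (v ⊠ w) =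
    ts ℛ fun a b => (b • w) ⊠ (a • v) := braidLin_wtm v w

instance : BraidedCategory (WHRep k H) where
  braiding := braidIso
  braiding_naturality_right V {W W'} f := rep_ext₂ fun v w => by
    simp only [lin_comp, lin_whiskerLeft, lin_whiskerRight, lin_braidIso, lin_ts, lin_map_smul]
  braiding_naturality_left f W := rep_ext₂ fun v w => by
    simp only [lin_comp, lin_whiskerLeft, lin_whiskerRight, lin_braidIso, lin_ts, lin_map_smul]
  hexagon_forward X Y Z := rep_ext₃ fun x y z => by
    simp only [lin_comp, lin_whiskerLeft, lin_whiskerRight, lin_braidIso, lin_ts, ts_tp, tp_ts,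
      lin_associator_hom, smul_tp, smul_smul]
    rw [sw_R_comul_right (f := fun a c d => (c • y) ⊠ (d • z) ⊠ (a • x)) (by fun_prop)
      (by fun_prop) (by fun_prop), ts_comm]
  hexagon_reverse X Y Z := rep_ext₃' fun x y z => by
    simp only [lin_comp, lin_whiskerLeft, lin_whiskerRight, lin_braidIso, lin_ts, ts_tp, tp_ts,
      lin_associator_inv, smul_tp, smul_smul]
    rw [sw_R_comul_left (f := fun a c d => ((d • z) ⊠ (a • x)) ⊠ (c • y)) (by fun_prop)
      (by fun_prop) (by fun_prop), ts_comm]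

theorem lin_braiding (V W : WHRep k H) (v : V) (w : W) : lin (β_ V W).hom (v ⊠ w) =
    ts ℛ fun a b => (b • w) ⊠ (a • v) := braidLin_wtm v w

end Braided

/-- The dual representation. -/
def dualRep (V : WHRep k H) : WHRep k H := ⟨DualMod k H V⟩

/-- The coevaluation `H_t → V ⊗ V*`. -/
def coevHom (V : WHRep k H) : 𝟙_ (WHRep k H) ⟶ V ⊗ dualRep V :=
  (mkHom (coevLin k H V) coevLin_smul : TargetSub k H →ₗ[H] WTensor k H V (DualMod k H V))

/-- The evaluation `V* ⊗ V → H_t`. -/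
def evalHom (V : WHRep k H) : dualRep V ⊗ V ⟶ 𝟙_ (WHRep k H) :=
  (mkHom (evalLin k H V) evalLin_smul : WTensor k H (DualMod k H V) V →ₗ[H] TargetSub k H)

theorem lin_coevHom (V : WHRep k H) (z : (𝟙_ (WHRep k H) : WHRep k H)) : lin (coevHom V) z =
    ts (canon k H V) fun g γ => tp (W := dualRep V) (unitVal z • g) γ := coevLin_eq z

instance (V : WHRep k H) : ExactPairing V (dualRep V) where
  coevaluation' := coevHom V
  evaluation' := evalHom V
  coevaluation_evaluation' := rep_ext₂ fun φ z => by
    simp only [lin_comp, lin_whiskerLeft, lin_coevHom, lin_ts, tp_ts]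
    refine (ts_congr _ fun g γ => ?_).trans (zigzag_right φ z)
    exact (congrArg (lin (evalHom V ▷ dualRep V)) (lin_associator_inv _ _ _ _ _ _)).trans
      (lin_whiskerRight _ _ _ _)
  evaluation_coevaluation' := rep_ext₂ fun z v => by
    simp only [lin_comp, lin_whiskerRight, lin_coevHom, lin_ts, ts_tp, lin_leftUnitor_hom]
    refine (ts_congr _ fun g γ => ?_).trans (zigzag_left z v)
    exact (congrArg (lin (V ◁ evalHom V)) (lin_associator_hom _ _ _ _ _ _)).trans
      (lin_whiskerLeft _ _ _ _)

instance : RightRigidCategory (WHRep k H) where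
  rightDual V := { rightDual := dualRep V }

end

end Rep

/-! ### Ribbon and modular categories -/

section Categories

universe v w

/-- A ribbon category: a braided monoidal category with duality, together with a twist `θ` that is
compatible with the braiding and the duality. -/
class RibbonCategory (C : Type v) [Category.{w} C] [MonoidalCategory C] [BraidedCategory C]
    [RightRigidCategory C] where
  /-- The twist. -/
  twist : ∀ X : C, X ≅ X
  twist_naturality : ∀ {X Y : C} (f : X ⟶ Y), f ≫ (twist Y).hom = (twist X).hom ≫ f
  /-- `θ_{X ⊗ Y} = c_{Y,X} c_{X,Y} (θ_X ⊗ θ_Y)`. -/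
  twist_tensor : ∀ X Y : C, (twist (X ⊗ Y)).hom =
    ((twist X).hom ⊗ₘ (twist Y).hom) ≫ (β_ X Y).hom ≫ (β_ Y X).hom
  /-- `(θ_X ⊗ id) b_X = (id ⊗ θ_{X*}) b_X`. -/
  twist_dual : ∀ X : C, η_ X Xᘁ ≫ ((twist X).hom ▷ Xᘁ) = η_ X Xᘁ ≫ (X ◁ (twist Xᘁ).hom)

variable {C : Type v} [Category.{w} C] [MonoidalCategory C] [BraidedCategory C]
  [RightRigidCategory C] [RibbonCategory C]

/-- The quantum trace `tr_q(f) = d_X c_{X,X*} (θ_X f ⊗ id) b_X` of an endomorphism. -/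
def qtrace {X : C} (f : X ⟶ X) : 𝟙_ C ⟶ 𝟙_ C :=
  η_ X Xᘁ ≫ ((f ≫ (RibbonCategory.twist X).hom) ▷ Xᘁ) ≫ (β_ X Xᘁ).hom ≫ ε_ X Xᘁ

/-- A `k`-linear ribbon category together with a finite family `V` of objects is a modular
category. -/
structure IsModularCategory (k : Type*) [Field k] (C : Type v) [Category.{w} C] [Preadditive C]
    [Linear k C] [MonoidalCategory C] [MonoidalPreadditive C] [MonoidalLinear k C]
    [BraidedCategory C] [RightRigidCategory C] [RibbonCategory C]
    {I : Type*} [Fintype I] [DecidableEq I] (V : I → C) : Prop where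
  /-- The objects of the family are simple: every endomorphism is multiplication by a unique
  scalar. -/
  simple : ∀ i, Function.Bijective fun c : k => c • 𝟙 (V i)
  /-- The unit object belongs to the family. -/
  unit : ∃ i, V i = 𝟙_ C
  /-- The family is closed under duality up to isomorphism. -/
  dual : ∀ i, ∃ j, Nonempty (V j ≅ (V i)ᘁ)
  /-- Every object is dominated by the family. -/
  dominates : ∀ X : C, ∃ (n : ℕ) (r : Fin n → I) (f : ∀ a, V (r a) ⟶ X) (g : ∀ a, X ⟶ V (r a)),
    𝟙 X = ∑ a, g a ≫ f a
  /-- The quantum traces `tr_q(c_{V_i,V_j} c_{V_j,V_i})` are scalars `S i j`, and the matrix `S`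
  is invertible. -/
  smatrix : ∃ S : Matrix I I k,
    (∀ i j, qtrace ((β_ (V j) (V i)).hom ≫ (β_ (V i) (V j)).hom) = S i j • 𝟙 (𝟙_ C)) ∧ IsUnit S

end Categories

section Ribbon

variable {k H : Type u} [Field k] [Ring H] [Algebra k H] [WeakHopfAlgebra k H]
  [QuasitriangularStructure k H] [RibbonStructure k H]

local notation "ℛ" => (QuasitriangularStructure.R : H ⊗[k] H)
local notation "ν" => ((RibbonStructure.ν k : Hˣ) : H)

theorem ν_smul_comm {V : Type*} [AddCommGroup V] [Module H V] (h : H) (v : V) :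
    ν • h • v = h • ν • v := by
  rw [smul_smul, smul_smul, RibbonStructure.ν_central]

theorem ν_inv_smul {V : Type*} [AddCommGroup V] [Module H V] (v : V) :
    ((RibbonStructure.ν k : Hˣ)⁻¹ : Hˣ).val • ν • v = v := by
  rw [smul_smul, Units.inv_mul, one_smul]

theorem ν_smul_inv {V : Type*} [AddCommGroup V] [Module H V] (v : V) :
    ν • ((RibbonStructure.ν k : Hˣ)⁻¹ : Hˣ).val • v = v := by
  rw [smul_smul, Units.mul_inv, one_smul]

/-- The twist of a representation is the action of the ribbon element. -/
def twistIso (V : WHRep k H) : V ≅ V :=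
  mkIso (Algebra.lsmul k k V ν) (Algebra.lsmul k k V ((RibbonStructure.ν k : Hˣ)⁻¹ : Hˣ).val)
    (fun h v => ν_smul_comm h v) (fun v => ν_inv_smul v) (fun v => ν_smul_inv v)

open WHRep

theorem lin_twistIso (V : WHRep k H) (v : V) : lin (twistIso V).hom v = ν • v := rfl

variable [FiniteDimensional k H]

instance : RibbonCategory (WHRep k H) where
  twist := twistIso
  twist_naturality f := rep_ext fun v => by
    simp only [lin_comp, lin_twistIso, lin_map_smul]
  twist_tensor V W := rep_ext₂ fun v w => by
    have e := congrArg (fun t => ts t fun a b => tp (a • v) (b • w))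
      (RibbonStructure.comul_ν (k := k) (H := H))
    rw [mul_assoc] at e
    simp (disch := fun_prop) only [ts_mul, ts_flip, ts_tmul] at e
    simp only [lin_comp, lin_tensorHom, lin_twistIso, lin_braiding, lin_ts, smul_tp, smul_smul]
    rw [e, ts_comm]
  twist_dual V := rep_ext fun z => by
    have e : ∀ z, lin (η_ V Vᘁ) z =
      ts (canon k H V) fun g γ => tp (W := dualRep V) (unitVal z • g) γ := lin_coevHom V
    simp only [lin_comp, e, lin_ts]
    have e1 : ∀ (g : V) (γ : DualMod k H V), lin ((twistIso V).hom ▷ Vᘁ)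
      (tp (W := dualRep V) (unitVal z • g) γ) = tp (W := dualRep V) (unitVal z • ν • g) γ :=
      fun g γ => (lin_whiskerRight _ _ _ _).trans (by rw [lin_twistIso, ν_smul_comm])
    have e2 : ∀ (g : V) (γ : DualMod k H V), lin (V ◁ (twistIso Vᘁ).hom)
      (tp (W := dualRep V) (unitVal z • g) γ) =
      tp (W := dualRep V) (unitVal z • g) (DualMod.pre k γ ν) :=
      fun g γ => (lin_whiskerLeft _ _ _ _).trans (congrArg (tp (W := dualRep V) (unitVal z • g))
        ((DualMod.smul_eq_pre _ _).trans (by rw [RibbonStructure.antipode_ν])))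
    refine (ts_congr _ e1).trans (Eq.trans ?_ (ts_congr _ e2).symm)
    exact canon_move (f := fun (g : V) (γ : DualMod k H V) =>
      tp (W := dualRep V) (unitVal z • g) γ) (fun γ => by fun_prop) (fun g => by fun_prop) ν

end Ribbon

section Hypotheses

variable (k H : Type*) [Field k] [Ring H] [Algebra k H] [WeakHopfAlgebra k H]

/-- A weak Hopf algebra is connected if `H_t ∩ Z(H) = k`. -/
def IsConnected : Prop :=
  ∀ z : H, z ∈ LinearMap.range (targetCounit k H) → z ∈ Subalgebra.center k H →
    ∃ c : k, algebraMap k H c = z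

/-- The map `F(φ) = (φ ⊗ id)(R₂₁R)` from the linear dual of `H` to `H`. -/
def drinfeldMap [QuasitriangularStructure k H] (φ : H →ₗ[k] k) : H :=
  TensorProduct.lid k H (LinearMap.rTensor H φ
    (Algebra.TensorProduct.comm k H H (QuasitriangularStructure.R (k := k) (H := H)) *
      QuasitriangularStructure.R))

/-- `H` is factorizable if `F` maps the dual of `H` onto the centralizer of `H_s` in `H`. -/
def IsFactorizable [QuasitriangularStructure k H] : Prop :=
  ∀ x ∈ Subalgebra.centralizer k (LinearMap.range (sourceCounit k H) : Set H),
    ∃ φ : H →ₗ[k] k, drinfeldMap k H φ = x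

variable {H} in
/-- A normalized two-sided integral: `h l = ε_t(h) l`, `l h = l ε_s(h)`, `ε_t(l) = 1 = ε_s(l)`. -/
structure IsNormalizedIntegral (l : H) : Prop where
  left : ∀ h : H, h * l = targetCounit k H h * l
  right : ∀ h : H, l * h = l * sourceCounit k H h
  targetCounit_eq_one : targetCounit k H l = 1
  sourceCounit_eq_one : sourceCounit k H l = 1

end Hypotheses

end WeakHopf

end

/-! Everything rests on the balancing element `γ = uν`, where `u = S(R⁽²⁾)R⁽¹⁾` is the Drinfeld
element and `ν` the ribbon element, and on the double braiding `M = R₂₁R`, through which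
`c_{W,V}c_{V,W}` acts.

Semisimplicity is Maschke's theorem: averaging a linear projection with the integral `l` makes it
`H`-linear (`isSemisimpleModule_of_integral`). An endomorphism of `H_t` is determined by the image
of `1`, which is forced to be central, so connectedness gives `End(H_t) = k` and `H_t` is simple.
Hence `H` has finitely many simple modules, they dominate every module, and the unit can be taken as
one of them. Duals of simple modules are simple because `S` is onto, its square being conjugation by
`u`.

For the S-matrix, three properties of `γ` are needed: `S²(h)γ = γh`, `u` is invertible, and `Δ(γ)M =
(γ ⊗ γ)M`. The quantum trace of `f` is `Tr(S(1₁)γf)1₂`. The twisted group-like property of `γ` turns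
the trace of the double braiding on `V ⊗ W` into a trace on `V` alone, with `(id ⊗ Tr_W(γ·))(M)`
inserted (`unitVal_qtrace_braiding_braiding`). That element is central because `S²` is implemented
by `γ` (`partialTrace_central`), so for `W = V_i` it acts on `V_j` by a scalar `t_ij`, and `S_ij =
t_ij d_j` with `d_j` the quantum dimension. Rigidity, semisimplicity and `End(H_t) = k` give `d_j ≠
0` (`qtrace_id_ne_zero`).

Suppose now that `xS = 0`. Then `∑ x_i t_ij = 0` for all `j`, so the partial trace of `ψ = ∑ x_i
Tr_{V_i}(γ·)` acts as zero on every simple module and vanishes. Partial trace and the map `F` of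
factorizability contract opposite legs of `M`, so `ψ(F(φ)) = 0` for all `φ`, and surjectivity of `F`
makes `ψ` vanish on the centralizer of `H_s`. This centralizer contains `e_j H_t`, with `e_j` the
central idempotent of `V_j`. Evaluating `ψ` there isolates `x_j Tr_{V_j}(γz)` for `z ∈ H_t`, values
that determine `x_j d_j`; thus `x_j d_j = 0` and `x_j = 0`. -/

namespace WeakHopf

/-! ### Counital subalgebras, and the antipode as an anti-coalgebra map. -/

section Counital

variable {k H : Type*} [Field k] [Ring H] [Algebra k H] [WeakHopfAlgebra k H]
  {P : Type*} [AddCommGroup P] [Module k P]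

local notation "δ" => (Coalgebra.comul : H →ₗ[k] H ⊗[k] H)
local notation "ϵ" => (Coalgebra.counit : H →ₗ[k] k)
local notation "εt" => targetCounit k H
local notation "εs" => sourceCounit k H
local notation "σ" => (WeakHopfAlgebra.antipode : H →ₗ[k] H)

/-- On `H_s` the antipode agrees with `ε_t`, so applying it to `ε(1₂z)ε_s(1₁)` gives `ε(1₂z)ε_t(1₁)
= ε_t(z)`. This lets a target element be traded for a source one, as needed for integrals. -/
theorem exists_source_antipode_eq {z : H} (hz : εt z = z) : ∃ y, εs y = y ∧ σ y = z := by
  refine ⟨ts (δ 1) fun a b => ϵ (b * z) • εs a, ?_, ?_⟩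
  · rw [Lin.map_ts (Lin.coe _)]
    simp only [map_smul, sourceCounit_idem]
  · rw [Lin.map_ts (Lin.coe _)]
    simp only [map_smul, antipode_source (sourceCounit_idem _)]
    rw [sw_one_source (f := fun a b => ϵ (b * z) • εt a) (by fun_prop) (by fun_prop),
      sw_targetCounit_counit, one_mul, hz]

theorem targetCounit_antipode_source {y : H} (hy : εs y = y) : εt (σ y) = σ y := by
  rw [antipode_source hy, targetCounit_idem]

theorem sourceCounit_antipode_target {z : H} (hz : εt z = z) : εs (σ z) = σ z := by
  rw [antipode_target hz, sourceCounit_idem]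

/-- Write `ε_s(yx)` as `S(x₁)yx₂` with `Δ(x) = 1₁ ⊗ x1₂`. Since `1₂` lies in `H_t`, it commutes with
`x`, and `x` can be pulled out on the right, leaving `ε_s(y)x`. -/
theorem sourceCounit_mul {y x : H} (hy : εs y = y) (hx : εs x = x) : εs (y * x) = y * x := by
  rw [← sw_antipode_mul_source x hy, sw_source hx (by fun_prop) (by fun_prop),
    ← sw_one_target (f := fun a b => σ a * y * (x * b)) (by fun_prop) (by fun_prop)]
  simp only [← target_mul_source (targetCounit_idem _) hx, ← mul_assoc]
  rw [sw_one_target (f := fun a b => σ a * y * b * x) (by fun_prop) (by fun_prop),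
    ← Lin.map_ts (g := fun w => w * x) (by fun_prop), sw_antipode_mul_source _ hy, mul_one, hy]

/-- `S(1₂) ⊗ S(1₁) = 1₁ ⊗ 1₂`. -/
theorem sw_one_antipode {f : H → H → P} (h1 : ∀ b, Lin k fun a => f a b)
    (h2 : ∀ a, Lin k fun b => f a b) :
    ts (δ 1) (fun a b => f (σ b) (σ a)) = ts (δ 1) f := by
  rw [← sw_one_source (f := fun a b => f (σ b) (σ a)) (by fun_prop) (by fun_prop)]
  simp only [antipode_source (sourceCounit_idem _)]
  rw [sw_one_source (f := fun a b => f (σ b) (εt a)) (by fun_prop) (by fun_prop)]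
  exact sw_one_swap (f := fun a b => f b a) (by fun_prop) (by fun_prop)

/-- `1₁ ⊗ z1₂ = S(z)1₁ ⊗ 1₂` for `z` in the target subalgebra. -/
theorem sw_one_target_mul {z : H} (hz : εt z = z) {f : H → H → P} (h1 : ∀ b, Lin k fun a => f a b)
    (h2 : ∀ a, Lin k fun b => f a b) :
    ts (δ 1) (fun a b => f a (z * b)) = ts (δ 1) fun a b => f (σ z * a) b := by
  rw [← sw_sourceCounit_left z h1 h2, sw_target' hz (f := fun a b => f (εs a) b) (by fun_prop)
    (by fun_prop), ← sw_one_source (f := fun a b => f (εs (z * a)) b) (by fun_prop) (by fun_prop),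
    ← sw_one_source (f := fun a b => f (σ z * a) b) (by fun_prop) (by fun_prop)]
  refine ts_congr _ fun a b => ?_
  rw [← sourceCounit_mul_sourceCounit, sourceCounit_mul (sourceCounit_idem _) (sourceCounit_idem _),
    antipode_target hz]

/-- `Δ(y) = 1₁ ⊗ 1₂y` for `y` in the source subalgebra. -/
theorem sw_source' {y : H} (hy : εs y = y) {f : H → H → P} (h1 : ∀ b, Lin k fun a => f a b)
    (h2 : ∀ a, Lin k fun b => f a b) :
    ts (δ y) f = ts (δ 1) fun a b => f a (b * y) := by
  rw [sw_source hy h1 h2, ← sw_one_target (f := fun a b => f a (y * b)) (by fun_prop) (by fun_prop),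
    ← sw_one_target (f := fun a b => f a (b * y)) (by fun_prop) (by fun_prop)]
  simp only [target_mul_source (targetCounit_idem _) hy]

theorem sw_mul_source (h : H) {y : H} (hy : εs y = y) {f : H → H → P}
    (h1 : ∀ b, Lin k fun a => f a b) (h2 : ∀ a, Lin k fun b => f a b) :
    ts (δ (h * y)) f = ts (δ h) fun a b => f a (b * y) := by
  conv_rhs => rw [← mul_one h]
  rw [sw_mul _ _ h1 h2, sw_mul _ _ (by fun_prop) (by fun_prop)]
  refine ts_congr _ fun a b => ?_
  rw [sw_source' hy (by fun_prop) (by fun_prop)]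
  simp only [mul_assoc]

/-- `h₁ ⊗ ε_s(h₂) = h1₁ ⊗ S(1₂)`. -/
theorem sw_sourceCounit_right (h : H) {f : H → H → P} (h1 : ∀ b, Lin k fun a => f a b)
    (h2 : ∀ a, Lin k fun b => f a b) :
    ts (δ h) (fun a b => f a (εs b)) = ts (δ 1) fun a b => f (h * a) (σ b) := by
  have key : ∀ h : H, ts (δ h) (fun a b => f a (εs b)) =
      ts (δ 1) fun a b => ts (δ 1) fun c d => ϵ (b * d) • f (h * a) c := fun h => by
    -- Weak multiplicativity splits `ε(b1₂)` through a second copy of `Δ(1)`, whose first leg may be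
    -- taken in `H_s`. For such `y` one has `h₁ε(h₂y) = hy`, which removes the coproduct of `h`.
    have e : ∀ a b, f a (εs b) = ts (δ 1) fun p q => ts (δ 1) fun c d =>
        ϵ (q * d) • ϵ (b * εs p) • f a c := fun a b => by
      rw [sw_one_source (f := fun p q => ts (δ 1) fun c d => ϵ (q * d) • ϵ (b * p) • f a c)
        (by fun_prop) (by fun_prop), sourceCounit_eq, (h2 a).map_ts]
      conv_rhs => rw [ts_comm]
      refine ts_congr _ fun c d => ?_
      rw [(h2 a).map_smul, ← mul_one b, counit_mul,
        Lin.map_ts (g := fun x : k => x • f a c) (by fun_prop)]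
      refine ts_congr _ fun p q => ?_
      rw [smul_smul, mul_comm, mul_one]
    simp only [e]
    rw [ts_comm, ← sw_one_source (f := fun a b => ts (δ 1) fun c d => ϵ (b * d) • f (h * a) c)
      (by fun_prop) (by fun_prop)]
    refine ts_congr _ fun p q => ?_
    rw [ts_comm]
    refine ts_congr _ fun c d => ?_
    rw [← Lin.map_ts (g := fun x => ϵ (q * d) • x) (by fun_prop),
      ← sw_mul_source h (sourceCounit_idem p) (f := fun a b => ϵ b • f a c)
        (by fun_prop) (by fun_prop)]
    rw [sw_counit_right _ (f := fun a => f a c) (by fun_prop)]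
  have e1 : ∀ a b, f (h * a) (σ (εt b)) = f (h * a) (εs (εt b)) := fun a b => by
    rw [antipode_target (targetCounit_idem _)]
  rw [key, ← sw_one_target (f := fun a b => f (h * a) (σ b)) (by fun_prop) (by fun_prop)]
  simp only [e1]
  rw [sw_one_target (f := fun a b => f (h * a) (εs b)) (by fun_prop) (by fun_prop)]
  refine ts_congr _ fun a b => ?_
  rw [sourceCounit_eq, (h2 _).map_ts]
  simp only [(h2 _).map_smul]

/-- The antipode reverses the comultiplication: `Δ(S(h)) = S(h₂) ⊗ S(h₁)`. -/
theorem sw_antipode (h : H) {f : H → H → P} (h1 : ∀ b, Lin k fun a => f a b)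
    (h2 : ∀ a, Lin k fun b => f a b) :
    ts (δ (σ h)) f = ts (δ h) fun a b => f (σ b) (σ a) := by
  -- `Δ(S(h₁))Δ(h₂) = S(h₂)h₃ ⊗ S(h₁)h₄`
  have hL : ∀ (h x : H), ts (δ (εs h * x)) f = ts (δ h) fun a b => ts (δ b) fun c d =>
      ts (δ x) fun p q => ts (δ a) fun r s => f (σ s * (c * p)) (σ r * (d * q)) := fun h x => by
    have e : ∀ (a b : H), (ts (δ b) fun c d => ts (δ x) fun p q => ts (δ a) fun r s =>
        f (σ s * (c * p)) (σ r * (d * q))) = ts (δ x) fun p q => ts (δ a) fun r s =>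
        ts (δ b) fun c d => f (σ s * c * p) (σ r * (d * q)) := fun a b => by
      rw [ts_comm]
      refine ts_congr _ fun p q => ?_
      rw [ts_comm]
      simp only [mul_assoc]
    simp only [e]
    conv_rhs => rw [ts_comm]
    rw [sw_mul _ _ h1 h2, ts_comm]
    refine ts_congr _ fun p q => ?_
    conv_rhs => rw [sw_coassoc h (f := fun r s b => ts (δ b) fun c d =>
      f (σ s * c * p) (σ r * (d * q))) (by fun_prop) (by fun_prop) (by fun_prop)]
    have e2 : ∀ (r b : H), (ts (δ b) fun s b => ts (δ b) fun c d =>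
        f (σ s * c * p) (σ r * (d * q))) = ts (δ b) fun a d =>
          f (εs a * p) (σ r * (d * q)) := fun r b => by
      rw [← sw_coassoc b (f := fun s c d => f (σ s * c * p) (σ r * (d * q))) (by fun_prop)
        (by fun_prop) (by fun_prop)]
      refine ts_congr _ fun a d => ?_
      rw [← sw_antipode_mul, Lin.map_ts (g := fun x => f (x * p) (σ r * (d * q))) (by fun_prop)]
    simp only [e2]
    conv_rhs =>
      enter [2, r, b]
      rw [sw_sourceCounit_left b (f := fun a d => f (a * p) (σ r * (d * q))) (by fun_prop)
        (by fun_prop)]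
    rw [ts_comm, sw_source (sourceCounit_idem h) (by fun_prop) (by fun_prop)]
    refine ts_congr _ fun a b => ?_
    rw [← sw_antipode_mul, Lin.map_ts (g := fun x => f (a * p) (x * b * q)) (by fun_prop)]
    simp only [mul_assoc]
  -- The last two factors combine: `Δ(h₃)Δ(S(h₄)) = Δ(ε_t(h₃))`, and the coproduct of a target
  -- element is known.
  have e1 : ∀ (a b : H), (ts (δ b) fun c d => ts (δ c) fun c₁ c₂ => ts (δ (σ d)) fun p q =>
      ts (δ a) fun r s => f (σ s * (c₁ * p)) (σ r * (c₂ * q))) = ts (δ 1) fun x y =>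
        ts (δ a) fun r s => f (σ s * (x * εt b)) (σ r * y) := fun a b => by
    have e : ∀ c d : H, (ts (δ c) fun c₁ c₂ => ts (δ (σ d)) fun p q =>
        ts (δ a) fun r s => f (σ s * (c₁ * p)) (σ r * (c₂ * q))) = ts (δ (c * σ d)) fun x y =>
          ts (δ a) fun r s => f (σ s * x) (σ r * y) := fun c d => by
      rw [sw_mul c (σ d) (f := fun x y => ts (δ a) fun r s => f (σ s * x) (σ r * y))
        (by fun_prop) (by fun_prop)]
    simp only [e]
    rw [← Lin.map_ts (g := fun w => ts (δ w) fun x y =>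
      ts (δ a) fun r s => f (σ s * x) (σ r * y)) (by fun_prop), sw_mul_antipode,
      sw_target (targetCounit_idem b) (by fun_prop) (by fun_prop)]
  -- `S(h₂)1₁ε_t(h₃) ⊗ S(h₁)1₂ = S(h₂)1₁ ⊗ S(h₁)1₂`
  have e2 : ∀ (r b x y : H), (ts (δ b) fun s b => f (σ s * (εs x * εt b)) (σ r * y)) =
      f (σ b * εs x) (σ r * y) := fun r b x y => by
    rw [sw_targetCounit_right b (f := fun s b => f (σ s * (εs x * b)) (σ r * y)) (by fun_prop)
      (by fun_prop), ← sw_one_target (f := fun p q => f (σ (p * b) * (εs x * q)) (σ r * y))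
      (by fun_prop) (by fun_prop)]
    simp only [← target_mul_source (targetCounit_idem _) (sourceCounit_idem x), antipode_mul_rev]
    rw [sw_one_target (f := fun p q => f (σ b * σ p * (q * εs x)) (σ r * y)) (by fun_prop)
      (by fun_prop)]
    have : ∀ p q : H, σ b * σ p * (q * εs x) = σ b * (σ p * q) * εs x := fun p q => by
      simp only [mul_assoc]
    simp only [this]
    rw [← Lin.map_ts (g := fun w => f (σ b * w * εs x) (σ r * y)) (by fun_prop), sw_antipode_mul,
      sourceCounit_one, mul_one]
  -- The weak form of uniqueness of convolution inverses: insert `S(h) = ε_s(h₁)S(h₂)` and expand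
  -- `Δ(ε_s(h₁))` so that it begins with the expected answer `S(h₂) ⊗ S(h₁)`. The rest is absorbed.
  conv_lhs => rw [← sw_sourceCounit_antipode h, Lin.map_ts (g := fun x => ts (δ x) f) (by fun_prop)]
  simp only [hL]
  rw [sw_coassoc h (f := fun a c d => ts (δ c) fun c₁ c₂ => ts (δ (σ d)) fun p q =>
      ts (δ a) fun r s => f (σ s * (c₁ * p)) (σ r * (c₂ * q))) (by fun_prop) (by fun_prop)
      (by fun_prop)]
  simp only [e1]
  rw [ts_comm]
  conv_lhs =>
    enter [2, x, y]
    rw [sw_coassoc h (f := fun r s b => f (σ s * (x * εt b)) (σ r * y)) (by fun_prop)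
      (by fun_prop) (by fun_prop)]
  rw [← sw_one_source (f := fun x y => ts (δ h) fun r b => ts (δ b) fun s b =>
    f (σ s * (x * εt b)) (σ r * y)) (by fun_prop) (by fun_prop)]
  simp only [e2]
  -- The remaining right factor `Δ(1)` is `S(1₂) ⊗ S(1₁)`, so it disappears into `Δ(1)Δ(h) = Δ(h)`
  -- under the antipodes.
  rw [sw_one_source (f := fun x y => ts (δ h) fun r b => f (σ b * x) (σ r * y)) (by fun_prop)
    (by fun_prop), ← sw_one_antipode (f := fun x y => ts (δ h) fun r b => f (σ b * x) (σ r * y))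
    (by fun_prop) (by fun_prop)]
  conv_rhs => rw [← one_mul h, sw_mul _ _ (by fun_prop) (by fun_prop)]
  simp only [antipode_mul_rev]

end Counital

end WeakHopf

namespace WeakHopf

/-! ### The R-matrix, the Drinfeld element and the double braiding element. -/

section Sweedler

variable {k : Type*} [Field k] {A B : Type*} [Ring A] [Algebra k A] [Ring B] [Algebra k B]

theorem mul_tmul_eq_ts (t : A ⊗[k] B) (x : A) (y : B) :
    t * x ⊗ₜ[k] y = ts t fun a b => (a * x) ⊗ₜ[k] (b * y) := by
  conv_lhs => rw [← ts_tmul_self t]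
  rw [Lin.map_ts (g := fun t => t * x ⊗ₜ[k] y) (by fun_prop)]
  simp only [Algebra.TensorProduct.tmul_mul_tmul]

theorem tmul_mul_eq_ts (t : A ⊗[k] B) (x : A) (y : B) :
    x ⊗ₜ[k] y * t = ts t fun a b => (x * a) ⊗ₜ[k] (y * b) := by
  conv_lhs => rw [← ts_tmul_self t]
  rw [Lin.map_ts (g := fun t => x ⊗ₜ[k] y * t) (by fun_prop)]
  simp only [Algebra.TensorProduct.tmul_mul_tmul]

theorem mul_eq_ts (t s : A ⊗[k] B) :
    t * s = ts t fun a b => ts s fun c d => (a * c) ⊗ₜ[k] (b * d) := by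
  rw [← ts_mul _ _ (by fun_prop) (by fun_prop), ts_tmul_self]

end Sweedler

section Drinfeld

variable (k H : Type u) [Field k] [Ring H] [Algebra k H] [WeakHopfAlgebra k H]
  [QuasitriangularStructure k H]

/-- The Drinfeld element `u = S(R⁽²⁾)R⁽¹⁾`. -/
noncomputable def drinfeldElement : H :=
  ts (QuasitriangularStructure.R : H ⊗[k] H) fun a b => WeakHopfAlgebra.antipode (k := k) b * a

/-- The double braiding element `R₂₁R`. -/
noncomputable def monodromy : H ⊗[k] H :=
  Algebra.TensorProduct.comm k H H (QuasitriangularStructure.R (k := k) (H := H)) *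
    QuasitriangularStructure.R

variable {k H} {P : Type*} [AddCommGroup P] [Module k P]

local notation "δ" => (Coalgebra.comul : H →ₗ[k] H ⊗[k] H)
local notation "ϵ" => (Coalgebra.counit : H →ₗ[k] k)
local notation "εt" => targetCounit k H
local notation "εs" => sourceCounit k H
local notation "σ" => (WeakHopfAlgebra.antipode : H →ₗ[k] H)
local notation "ℛ" => (QuasitriangularStructure.R : H ⊗[k] H)
local notation "ℛ'" => (QuasitriangularStructure.Rbar : H ⊗[k] H)
local notation "τ" => Algebra.TensorProduct.comm k H H
local notation "u" => drinfeldElement k H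
local notation "ℳ" => monodromy k H

theorem sw_comul_op_mul_R (h : H) {f : H → H → P} (h1 : ∀ b, Lin k fun a => f a b)
    (h2 : ∀ a, Lin k fun b => f a b) :
    ts (δ h) (fun p q => ts ℛ fun a b => f (q * a) (p * b)) =
      ts ℛ fun a b => ts (δ h) fun p q => f (a * p) (b * q) := by
  have e := congrArg (fun t => ts t f) (QuasitriangularStructure.comul_op_mul_R (k := k) h)
  rwa [ts_mul _ _ h1 h2, ts_mul _ _ h1 h2, ts_flip _ (by fun_prop) (by fun_prop)] at e

theorem sw_R_mul_one {f : H → H → P} (h1 : ∀ b, Lin k fun a => f a b)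
    (h2 : ∀ a, Lin k fun b => f a b) :
    ts ℛ (fun a b => ts (δ 1) fun p q => f (a * p) (b * q)) = ts ℛ f := by
  rw [← ts_mul _ _ h1 h2, R_mul_comul_one]

theorem sw_one_mul_R {f : H → H → P} (h1 : ∀ b, Lin k fun a => f a b)
    (h2 : ∀ a, Lin k fun b => f a b) :
    ts (δ 1) (fun p q => ts ℛ fun a b => f (q * a) (p * b)) = ts ℛ f := by
  rw [sw_comul_op_mul_R 1 h1 h2, sw_R_mul_one h1 h2]

/-- `(y ⊗ 1)R = R(1 ⊗ y)` for `y` in the source subalgebra. -/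
theorem sw_source_mul_R {y : H} (hy : εs y = y) {f : H → H → P} (h1 : ∀ b, Lin k fun a => f a b)
    (h2 : ∀ a, Lin k fun b => f a b) :
    ts ℛ (fun a b => f (y * a) b) = ts ℛ fun a b => f a (b * y) := by
  have e := sw_comul_op_mul_R y h1 h2
  rw [sw_source hy (by fun_prop) (by fun_prop)] at e
  conv_rhs at e =>
    enter [2, a, b]
    rw [sw_source' hy (by fun_prop) (by fun_prop)]
  rw [← sw_one_mul_R (f := fun a b => f (y * a) b) (by fun_prop) (by fun_prop),
    ← sw_R_mul_one (f := fun a b => f a (b * y)) (by fun_prop) (by fun_prop)]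
  simpa only [mul_assoc] using e

/-- `(z ⊗ 1)R = (1 ⊗ S(z))R` for `z` in the target subalgebra. -/
theorem sw_target_mul_R {z : H} (hz : εt z = z) {f : H → H → P} (h1 : ∀ b, Lin k fun a => f a b)
    (h2 : ∀ a, Lin k fun b => f a b) :
    ts ℛ (fun a b => f (z * a) b) = ts ℛ fun a b => f a (σ z * b) := by
  have e := sw_one_target_mul hz (f := fun p q => ts ℛ fun a b => f (q * a) (p * b)) (by fun_prop)
    (by fun_prop)
  rw [← sw_one_mul_R (f := fun a b => f (z * a) b) (by fun_prop) (by fun_prop),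
    ← sw_one_mul_R (f := fun a b => f a (σ z * b)) (by fun_prop) (by fun_prop)]
  simpa only [mul_assoc] using e

/-- `(id ⊗ ε)R = 1`. -/
theorem sw_R_counit {f : H → P} (hf : Lin k f) : ts ℛ (fun a b => ϵ b • f a) = f 1 := by
  have key : ts ℛ (fun a b => ϵ b • a) = 1 := by
    -- Applying `ε` to the third leg of `(id ⊗ Δ)R = R₁₃R₁₂` yields `R = (w ⊗ 1)R` with `w = (id ⊗
    -- ε)R`. Multiplying by `R̄` and applying `id ⊗ ε` again gives `w = 1`.
    have e := sw_R_comul_right (k := k) (H := H) (f := fun a c d => ϵ d • a ⊗ₜ[k] c)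
      (by fun_prop) (by fun_prop) (by fun_prop)
    conv_lhs at e =>
      enter [2, a, b]
      rw [sw_counit_right b (f := fun c => a ⊗ₜ[k] c) (by fun_prop)]
    rw [ts_tmul_self, ts_comm] at e
    have e1 : ∀ c d : H, ts ℛ (fun a b => ϵ b • ((a * c) ⊗ₜ[k] d)) =
        (ts ℛ (fun a b => ϵ b • a) * c) ⊗ₜ[k] (1 * d) := fun c d => by
      rw [Lin.map_ts (g := fun x => (x * c) ⊗ₜ[k] (1 * d)) (by fun_prop)]
      simp only [smul_mul_assoc, smul_tmul', one_mul]
    simp only [e1] at e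
    rw [← tmul_mul_eq_ts] at e
    have e2 := congrArg (fun t => ts (t * ℛ') fun a b => ϵ b • a) e
    simp only [mul_assoc, QuasitriangularStructure.R_mul_Rbar] at e2
    rw [tmul_mul_eq_ts, ts_map _ (by fun_prop) (by fun_prop),
      ts_flip _ (by fun_prop) (by fun_prop), ts_flip _ (by fun_prop) (by fun_prop)] at e2
    simp (disch := fun_prop) only [ts_tmul] at e2
    simp only [one_mul] at e2
    rwa [sw_counit_left 1 (f := fun b => b) (by fun_prop),
      sw_counit_left 1 (f := fun b => ts ℛ (fun a b => ϵ b • a) * b) (by fun_prop), mul_one,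
      eq_comm] at e2
  rw [← key, hf.map_ts]
  simp only [hf.map_smul]

/-- `(id ⊗ ε_t)R = 1₂ ⊗ S(1₁)`. -/
theorem sw_R_targetCounit {f : H → H → P} (h1 : ∀ b, Lin k fun a => f a b)
    (h2 : ∀ a, Lin k fun b => f a b) :
    ts ℛ (fun a b => f a (εt b)) = ts (δ 1) fun a b => f b (σ a) := by
  -- Rewriting `Δ(1)` as `S(1₂) ⊗ S(1₁)` puts the antipode of a target element in front of `R⁽²⁾`.
  -- It can then cross to the first leg of `R`, after which the counit property applies.
  have e : ∀ a b, f a (εt b) = ts (δ 1) fun c d => ϵ (σ (εt d) * b) • f a (σ c) := fun a b => by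
    rw [sw_one_target (f := fun c d => ϵ (σ d * b) • f a (σ c)) (by fun_prop) (by fun_prop),
      sw_one_antipode (f := fun c d => ϵ (c * b) • f a d) (by fun_prop) (by fun_prop),
      targetCounit_eq, (h2 a).map_ts]
    simp only [(h2 a).map_smul]
  simp only [e]
  rw [ts_comm, ← sw_one_target (f := fun a b => f b (σ a)) (by fun_prop) (by fun_prop)]
  refine ts_congr _ fun c d => ?_
  rw [← sw_target_mul_R (targetCounit_idem d) (f := fun a b => ϵ b • f a (σ c)) (by fun_prop)
    (by fun_prop), sw_R_counit (f := fun a => f (εt d * a) (σ c)) (by fun_prop), mul_one]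

/-- `S(R⁽²⁾)yR⁽¹⁾ = S(y)u` for `y` in the source subalgebra. -/
theorem sw_R_antipode_source_mul {y : H} (hy : εs y = y) :
    ts ℛ (fun a b => σ b * (y * a)) = σ y * u := by
  rw [sw_source_mul_R hy (f := fun a b => σ b * a) (by fun_prop) (by fun_prop), drinfeldElement,
    Lin.map_ts (g := fun x => σ y * x) (by fun_prop)]
  simp only [antipode_mul_rev, mul_assoc]

/-- `S²(h)u = uh`. -/
theorem antipode_antipode_mul_drinfeldElement (h : H) : σ (σ h) * u = u * h := by
  -- Feed `Δᵒᵖ(h₁)R = RΔ(h₁)` into `a ⊗ b ↦ S²(h₂)S(b)a`. On the left `S(h₁)h₂` becomes `ε_s`, on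
  -- the right `h₂S(h₃)` becomes `ε_t`, and the two sides reduce to `S²(h)u` and `uh`.
  have e := ts_congr (δ h) fun x z => sw_comul_op_mul_R (k := k) x
    (f := fun a b => σ (σ z) * σ b * a) (by fun_prop) (by fun_prop)
  have eL : ∀ x z : H, ts (δ x) (fun p q => ts ℛ fun a b => σ (σ z) * σ (p * b) * (q * a)) =
      σ (εs x * σ z) * u := fun x z => by
    rw [ts_comm, antipode_mul_rev, mul_assoc, ← sw_R_antipode_source_mul (sourceCounit_idem x),
      Lin.map_ts (g := fun w => σ (σ z) * w) (by fun_prop)]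
    refine ts_congr _ fun a b => ?_
    rw [← sw_antipode_mul, Lin.map_ts (g := fun w => σ (σ z) * (σ b * (w * a))) (by fun_prop)]
    simp only [antipode_mul_rev, mul_assoc]
  simp only [eL] at e
  rw [← Lin.map_ts (g := fun w => σ w * u) (by fun_prop), sw_sourceCounit_antipode] at e
  rw [e]
  have eR : ∀ x z : H, (ts ℛ fun a b => ts (δ x) fun p q => σ (σ z) * σ (b * q) * (a * p)) =
      ts (δ x) fun p q => ts ℛ fun a b => σ (σ z) * σ (b * q) * (a * p) :=
    fun x z => ts_comm _ _ _
  simp only [eR]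
  rw [sw_coassoc h (f := fun p q z => ts ℛ fun a b => σ (σ z) * σ (b * q) * (a * p)) (by fun_prop)
    (by fun_prop) (by fun_prop)]
  have eR : ∀ p w : H, (ts (δ w) fun q z => ts ℛ fun a b => σ (σ z) * σ (b * q) * (a * p)) =
      ts ℛ fun a b => σ (b * εt w) * (a * p) := fun p w => by
    rw [ts_comm]
    refine ts_congr _ fun a b => ?_
    rw [← sw_mul_antipode, Lin.map_ts (g := fun w => σ (b * w) * (a * p)) (by fun_prop)]
    simp only [antipode_mul_rev, mul_assoc]
  simp only [eR]
  rw [sw_targetCounit_right h (f := fun p w => ts ℛ fun a b => σ (b * w) * (a * p)) (by fun_prop)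
    (by fun_prop), ts_comm]
  simp only [← mul_assoc _ _ h]
  rw [sw_R_mul_one (f := fun a b => σ b * a * h) (by fun_prop) (by fun_prop), drinfeldElement,
    Lin.map_ts (g := fun x => x * h) (by fun_prop)]

/-- Multiply `Δᵒᵖ(h)R = RΔ(h)` by `R̄` on both sides; the resulting `RR̄` and `R̄R` are absorbed by
the coproducts of `h`. -/
theorem sw_Rbar_mul_comul_op (h : H) {f : H → H → P} (h1 : ∀ b, Lin k fun a => f a b)
    (h2 : ∀ a, Lin k fun b => f a b) :
    ts ℛ' (fun a b => ts (δ h) fun p q => f (a * q) (b * p)) =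
      ts (δ h) fun p q => ts ℛ' fun a b => f (p * a) (q * b) := by
  have e : ℛ' * τ (δ h) = δ h * ℛ' := by
    calc ℛ' * τ (δ h) = ℛ' * (τ (δ h) * ℛ) * ℛ' := by
          rw [mul_assoc, mul_assoc, QuasitriangularStructure.R_mul_Rbar, ← map_mul,
            ← WeakHopfAlgebra.comul_mul, mul_one]
      _ = δ h * ℛ' := by
          rw [QuasitriangularStructure.comul_op_mul_R, ← mul_assoc ℛ',
            QuasitriangularStructure.Rbar_mul_R, ← WeakHopfAlgebra.comul_mul, one_mul]
  have e := congrArg (fun t => ts t f) e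
  rw [ts_mul _ _ h1 h2, ts_mul _ _ h1 h2] at e
  conv_lhs at e =>
    enter [2, a, b]
    rw [ts_flip _ (by fun_prop) (by fun_prop)]
  exact e

/-- `(id ⊗ S)(R)(1 ⊗ u) = (1 ⊗ u)R̄`. -/
theorem sw_R_antipode_mul_drinfeldElement (hu : IsUnit u) {f : H → H → P}
    (h1 : ∀ b, Lin k fun a => f a b) (h2 : ∀ a, Lin k fun b => f a b) :
    ts ℛ (fun a b => f a (σ b * u)) = ts ℛ' fun a b => f a (u * b) := by
  obtain ⟨v, hv⟩ := hu
  have hS : ∀ b : H, ↑v⁻¹ * σ (σ b) = b * ↑v⁻¹ := fun b => by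
    rw [Units.inv_mul_eq_iff_eq_mul, ← mul_assoc, Units.eq_mul_inv_iff_mul_eq, hv,
      antipode_antipode_mul_drinfeldElement]
  -- Put `T = R⁽¹⁾ ⊗ u⁻¹S(R⁽²⁾)u`. Quasi-inverses are unique: `RT = Δᵒᵖ(1)` and `Δ(1)T = T` force `T
  -- = R̄RT = R̄`.
  have e1 : ℛ * ts ℛ (fun a b => a ⊗ₜ[k] (↑v⁻¹ * σ b * v)) = τ (δ 1) := by
    rw [Lin.map_ts (g := fun t => ℛ * t) (by fun_prop)]
    simp only [mul_tmul_eq_ts]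
    -- Moving `d` past `u⁻¹` turns it into `S²(d)`, which merges with `S(b)` into `S(bS(d))`. The
    -- two copies of `R` then form `(id ⊗ Δ)R` and the second leg collapses to `ε_t`.
    have e : ∀ a b c d : H, (c * a) ⊗ₜ[k] (d * (↑v⁻¹ * σ b * v)) =
        (c * a) ⊗ₜ[k] (↑v⁻¹ * σ (b * σ d) * v) := fun a b c d => by
      rw [antipode_mul_rev, ← mul_assoc (v⁻¹ : Hˣ).val, hS]
      simp only [mul_assoc]
    simp only [e]
    rw [ts_comm, ← sw_R_comul_right (f := fun a c d => a ⊗ₜ[k] (↑v⁻¹ * σ (c * σ d) * v))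
      (by fun_prop) (by fun_prop) (by fun_prop)]
    have e' : ∀ a b : H, (ts (δ b) fun c d => a ⊗ₜ[k] (↑v⁻¹ * σ (c * σ d) * v)) =
        a ⊗ₜ[k] (↑v⁻¹ * σ (εt b) * v) := fun a b => by
      rw [← sw_mul_antipode, Lin.map_ts (g := fun x => a ⊗ₜ[k] (↑v⁻¹ * σ x * v)) (by fun_prop)]
    simp only [e']
    rw [sw_R_targetCounit (f := fun a b => a ⊗ₜ[k] (↑v⁻¹ * σ b * v)) (by fun_prop) (by fun_prop)]
    simp only [hS, mul_assoc, Units.inv_mul, mul_one]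
    rw [← ts_flip _ (by fun_prop) (by fun_prop), ts_tmul_self]
  have e2 : δ 1 * ts ℛ (fun a b => a ⊗ₜ[k] (↑v⁻¹ * σ b * v)) =
      ts ℛ (fun a b => a ⊗ₜ[k] (↑v⁻¹ * σ b * v)) := by
    rw [Lin.map_ts (g := fun t => δ 1 * t) (by fun_prop)]
    simp only [mul_tmul_eq_ts]
    rw [ts_comm, ← sw_one_target (f := fun c d => ts ℛ fun a b =>
      (c * a) ⊗ₜ[k] (d * (↑v⁻¹ * σ b * v))) (by fun_prop) (by fun_prop)]
    -- The factor `1₂` passes `u⁻¹`, becomes `S(1₂)` on the right of `R⁽²⁾`, and crosses to the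
    -- first leg as an element of `H_s`. There it meets `1₁`, and `1₁S(1₂) = 1`.
    have e : ∀ c d : H, (ts ℛ fun a b => (c * a) ⊗ₜ[k] (εt d * (↑v⁻¹ * σ b * v))) =
        ts ℛ fun a b => (c * σ (εt d) * a) ⊗ₜ[k] (↑v⁻¹ * σ b * v) := fun c d => by
      simp only [mul_assoc c]
      rw [sw_source_mul_R (sourceCounit_antipode_target (targetCounit_idem d))
        (f := fun a b => (c * a) ⊗ₜ[k] (↑v⁻¹ * σ b * v)) (by fun_prop) (by fun_prop)]
      refine ts_congr _ fun a b => ?_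
      rw [antipode_mul_rev, ← mul_assoc (v⁻¹ : Hˣ).val, hS]
      simp only [mul_assoc]
    simp only [e]
    rw [sw_one_target (f := fun c d => ts ℛ fun a b => (c * σ d * a) ⊗ₜ[k] (↑v⁻¹ * σ b * v))
      (by fun_prop) (by fun_prop), ← Lin.map_ts (g := fun x => ts ℛ fun a b =>
        (x * a) ⊗ₜ[k] (↑v⁻¹ * σ b * v)) (by fun_prop), sw_mul_antipode, targetCounit_one]
    simp only [one_mul]
  have e3 : ts ℛ (fun a b => a ⊗ₜ[k] (↑v⁻¹ * σ b * v)) = ℛ' := by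
    rw [← e2, ← QuasitriangularStructure.Rbar_mul_R, mul_assoc, e1, Rbar_mul_comul_op_one]
  rw [← e3, ts_map _ (by fun_prop) (by fun_prop)]
  simp (disch := fun_prop) only [ts_tmul]
  simp only [← hv, ← mul_assoc, Units.mul_inv, one_mul]

/-- `Δ(u) = (u ⊗ u)R̄R̄₂₁`. -/
theorem comul_drinfeldElement (hu : IsUnit u) : δ u = u ⊗ₜ[k] u * (ℛ' * τ ℛ') := by
  -- Each use of `(Δ ⊗ id)R = R₁₃R₂₃` in the computation below releases one copy of `R` in exactly
  -- this shape, hence one factor `u`.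
  have hm : ∀ n y : H, ts ℛ (fun p m => σ (m * n) * (p * y)) = σ n * u * y := fun n y => by
    rw [drinfeldElement, Lin.map_ts (g := fun x => σ n * x * y) (by fun_prop)]
    simp only [antipode_mul_rev, mul_assoc]
  calc δ u = ts ℛ fun a b => ts (δ (σ b * a)) fun p q => p ⊗ₜ[k] q := by
        simp only [ts_tmul_self]
        rw [drinfeldElement, Lin.map_ts (Lin.coe δ)]
    _ = ts ℛ fun a b => ts (δ b) fun p q => ts (δ a) fun r s => (σ q * r) ⊗ₜ[k] (σ p * s) := by
        refine ts_congr _ fun a b => ?_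
        rw [sw_mul _ _ (by fun_prop) (by fun_prop), sw_antipode _ (by fun_prop) (by fun_prop)]
    _ = ts ℛ fun a b => ts ℛ fun c d => ts (δ a) fun r s => ts (δ c) fun r' s' =>
          (σ b * (r * r')) ⊗ₜ[k] (σ d * (s * s')) := by
        rw [sw_R_comul_right (f := fun a p q => ts (δ a) fun r s => (σ q * r) ⊗ₜ[k] (σ p * s))
          (by fun_prop) (by fun_prop) (by fun_prop)]
        refine ts_congr _ fun a b => ts_congr _ fun c d => ?_
        rw [sw_mul _ _ (by fun_prop) (by fun_prop)]
    _ = ts ℛ fun a b => ts (δ a) fun r s => ts ℛ fun c d => ts (δ c) fun r' s' =>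
          (σ b * (r * r')) ⊗ₜ[k] (σ d * (s * s')) := by
        refine ts_congr _ fun a b => ?_
        rw [ts_comm]
    _ = ts ℛ fun p m => ts ℛ fun q n => ts ℛ fun c d => ts (δ c) fun r' s' =>
          (σ (m * n) * (p * r')) ⊗ₜ[k] (σ d * (q * s')) :=
        sw_R_comul_left (f := fun r s b => ts ℛ fun c d => ts (δ c) fun r' s' =>
          (σ b * (r * r')) ⊗ₜ[k] (σ d * (s * s'))) (by fun_prop) (by fun_prop) (by fun_prop)
    _ = ts ℛ fun q n => ts ℛ fun c d => ts (δ c) fun r' s' =>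
          (σ n * u * r') ⊗ₜ[k] (σ d * (q * s')) := by
        rw [ts_comm]
        refine ts_congr _ fun q n => ?_
        rw [ts_comm]
        refine ts_congr _ fun c d => ?_
        rw [ts_comm]
        refine ts_congr _ fun r s => ?_
        rw [← hm, Lin.map_ts (g := fun x => x ⊗ₜ[k] (σ d * (q * s))) (by fun_prop)]
    -- The factor `S(n)u` exchanges `R` for `R̄`. The latter can be commuted past the remaining
    -- coproduct, so that the same extraction works in the other tensor leg.
    _ = ts ℛ' fun x y => ts ℛ fun c d => ts (δ c) fun r' s' =>
          (u * y * r') ⊗ₜ[k] (σ d * (x * s')) :=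
        sw_R_antipode_mul_drinfeldElement hu (f := fun q n => ts ℛ fun c d => ts (δ c) fun r' s' =>
          (n * r') ⊗ₜ[k] (σ d * (q * s'))) (by fun_prop) (by fun_prop)
    _ = ts ℛ fun c d => ts (δ c) fun p q => ts ℛ' fun x y =>
          (u * (q * y)) ⊗ₜ[k] (σ d * (p * x)) := by
        rw [ts_comm]
        refine ts_congr _ fun c d => ?_
        rw [← sw_Rbar_mul_comul_op c (f := fun x y => (u * y) ⊗ₜ[k] (σ d * x)) (by fun_prop)
          (by fun_prop)]
        simp only [mul_assoc]
    _ = ts ℛ fun p m => ts ℛ fun q n => ts ℛ' fun x y =>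
          (u * (q * y)) ⊗ₜ[k] (σ (m * n) * (p * x)) :=
        sw_R_comul_left (f := fun p q d => ts ℛ' fun x y =>
          (u * (q * y)) ⊗ₜ[k] (σ d * (p * x))) (by fun_prop) (by fun_prop) (by fun_prop)
    _ = ts ℛ fun q n => ts ℛ' fun x y => (u * (q * y)) ⊗ₜ[k] (σ n * u * x) := by
        rw [ts_comm]
        refine ts_congr _ fun q n => ?_
        rw [ts_comm]
        refine ts_congr _ fun x y => ?_
        rw [← hm, Lin.map_ts (g := fun w => (u * (q * y)) ⊗ₜ[k] w) (by fun_prop)]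
    _ = ts ℛ' fun x' y' => ts ℛ' fun x y => (u * (x' * y)) ⊗ₜ[k] (u * y' * x) :=
        sw_R_antipode_mul_drinfeldElement hu (f := fun q n => ts ℛ' fun x y =>
          (u * (q * y)) ⊗ₜ[k] (n * x)) (by fun_prop) (by fun_prop)
    _ = u ⊗ₜ[k] u * (ℛ' * τ ℛ') := by
        rw [mul_eq_ts ℛ' (τ ℛ'), Lin.map_ts (g := fun t => u ⊗ₜ[k] u * t) (by fun_prop)]
        refine ts_congr _ fun x' y' => ?_
        rw [ts_flip _ (by fun_prop) (by fun_prop),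
          Lin.map_ts (g := fun t => u ⊗ₜ[k] u * t) (by fun_prop)]
        simp only [Algebra.TensorProduct.tmul_mul_tmul, mul_assoc]

/-- `R̄R̄₂₁` is the quasi-inverse of `R₂₁R`: the inner pair collapses to `Δᵒᵖ(1)`, which `R`
absorbs, and the outer pair to `Δ(1)`. -/
theorem comul_drinfeldElement_mul_monodromy (hu : IsUnit u) :
    δ u * ℳ = u ⊗ₜ[k] u * δ 1 := by
  have e : τ ℛ' * τ ℛ = τ (δ 1) := by rw [← map_mul, QuasitriangularStructure.Rbar_mul_R]
  rw [comul_drinfeldElement hu, monodromy, mul_assoc, mul_assoc, ← mul_assoc (τ ℛ'), e,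
    comul_op_one_mul_R, QuasitriangularStructure.Rbar_mul_R]

theorem comul_one_mul_monodromy : δ 1 * ℳ = ℳ := by
  rw [monodromy, ← mul_assoc, comul_one_mul_flip_R]

/-- Quasitriangularity twice: the flipped relation carries `Δ(h)` past `R₂₁` as `Δᵒᵖ(h)`, and the
original one carries it back past `R`. -/
theorem comul_mul_monodromy (h : H) : δ h * ℳ = ℳ * δ h := by
  have e := congrArg τ (QuasitriangularStructure.comul_op_mul_R (k := k) h)
  rw [map_mul, map_mul, flip_flip] at e
  rw [monodromy, ← mul_assoc, e, mul_assoc, QuasitriangularStructure.comul_op_mul_R, mul_assoc]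

theorem monodromy_mul_comul_one : ℳ * δ 1 = ℳ := by
  rw [← comul_mul_monodromy, comul_one_mul_monodromy]

/-- For a functional `φ` with `φ(xy) = φ(yS²(x))` the element `(id ⊗ φ)(R₂₁R)` is central. -/
theorem partialTrace_central (φ : H →ₗ[k] k) (hφ : ∀ x y, φ (x * y) = φ (y * σ (σ x))) (h : H) :
    h * ts ℳ (fun a b => φ b • a) = ts ℳ (fun a b => φ b • a) * h := by
  -- Contract `Δ(h₁)M = MΔ(h₁)` in the second leg with `φ(· S(h₂))`; both sides then lose all but
  -- one leg of the coproduct of `h`.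
  have e := ts_congr (δ h) fun x z =>
    congrArg (fun t => ts t fun a b => φ (b * σ z) • a) (comul_mul_monodromy (k := k) x)
  simp (disch := fun_prop) only [ts_mul] at e
  have eR : ∀ x z : H, (ts ℳ fun a b => ts (δ x) fun p q => φ (b * q * σ z) • (a * p)) =
      ts (δ x) fun p q => ts ℳ fun a b => φ (b * q * σ z) • (a * p) := fun x z => ts_comm _ _ _
  simp only [eR] at e
  rw [sw_coassoc h (f := fun p q z => ts ℳ fun a b => φ (b * q * σ z) • (a * p)) (by fun_prop)
    (by fun_prop) (by fun_prop), sw_coassoc h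
    (f := fun p q z => ts ℳ fun a b => φ (q * b * σ z) • (p * a)) (by fun_prop)
    (by fun_prop) (by fun_prop)] at e
  have e1 : ∀ p w : H, (ts (δ w) fun q z => ts ℳ fun a b => φ (b * q * σ z) • (a * p)) =
      ts ℳ fun a b => φ (b * εt w) • (a * p) := fun p w => by
    rw [ts_comm]
    refine ts_congr _ fun a b => ?_
    rw [← sw_mul_antipode, Lin.map_ts (g := fun w => φ (b * w) • (a * p)) (by fun_prop)]
    simp only [mul_assoc]
  -- The twisted trace property moves `h₂` to the far right as `S²(h₂)`, where `S(h₃)S²(h₂) =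
  -- S(S(h₂)h₃)` produces `ε_s`.
  have e2 : ∀ p w : H, (ts (δ w) fun q z => ts ℳ fun a b => φ (q * b * σ z) • (p * a)) =
      ts ℳ fun a b => φ (b * σ (εs w)) • (p * a) := fun p w => by
    rw [ts_comm]
    refine ts_congr _ fun a b => ?_
    rw [← sw_antipode_mul, Lin.map_ts (g := fun w => φ (b * σ w) • (p * a)) (by fun_prop)]
    refine ts_congr _ fun q z => ?_
    rw [mul_assoc, hφ, mul_assoc, ← antipode_mul_rev]
  simp only [e1, e2] at e
  rw [sw_targetCounit_right h (f := fun p w => ts ℳ fun a b => φ (b * w) • (a * p)) (by fun_prop)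
    (by fun_prop), sw_sourceCounit_right h (f := fun p w => ts ℳ fun a b => φ (b * σ w) • (p * a))
    (by fun_prop) (by fun_prop)] at e
  -- The antipode of `ε_s` leaves `S²(1₂)` on the right of `b`; the twisted trace property brings it
  -- back as `1₂` on the left, where `Δ(1)M = M` removes it.
  simp only [← hφ, ← mul_assoc _ _ h] at e
  rw [ts_comm (δ 1) ℳ fun c d a b => φ (b * d) • (a * c * h),
    ← ts_mul ℳ (δ 1) (f := fun a b => φ b • (a * h)) (by fun_prop) (by fun_prop),
    monodromy_mul_comul_one] at e
  simp only [mul_assoc h] at e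
  rw [← ts_mul (δ 1) ℳ (f := fun a b => φ b • (h * a)) (by fun_prop) (by fun_prop),
    comul_one_mul_monodromy] at e
  rw [Lin.map_ts (g := fun x => h * x) (by fun_prop), Lin.map_ts (g := fun x => x * h)
    (by fun_prop)]
  simpa only [mul_smul_comm, smul_mul_assoc] using e

section Ribbon

variable [RibbonStructure k H]

local notation "ν" => ((RibbonStructure.ν k : Hˣ) : H)

/-- The element `uν` is group-like up to the double braiding: `Δ(uν)R₂₁R = (uν ⊗ uν)R₂₁R`. -/
theorem comul_balancing_mul_monodromy (hu : IsUnit u) :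
    δ (u * ν) * ℳ = (u * ν) ⊗ₜ[k] (u * ν) * ℳ := by
  have e : δ 1 * ν ⊗ₜ[k] ν = ν ⊗ₜ[k] ν * δ 1 := by
    rw [mul_tmul_eq_ts, tmul_mul_eq_ts]
    simp only [RibbonStructure.ν_central]
  have e1 : δ ν = ℳ * ν ⊗ₜ[k] ν := RibbonStructure.comul_ν
  rw [WeakHopfAlgebra.comul_mul, e1, ← mul_assoc, comul_drinfeldElement_mul_monodromy hu,
    mul_assoc (u ⊗ₜ[k] u), e, ← mul_assoc, Algebra.TensorProduct.tmul_mul_tmul, mul_assoc,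
    comul_one_mul_monodromy]

end Ribbon

end Drinfeld

end WeakHopf

namespace WeakHopf

/-! ### Maschke's theorem for a normalized integral. -/

section Maschke

variable {k H : Type u} [Field k] [Ring H] [Algebra k H] [WeakHopfAlgebra k H]
  {P : Type*} [AddCommGroup P] [Module k P]

local notation "δ" => (Coalgebra.comul : H →ₗ[k] H ⊗[k] H)
local notation "ϵ" => (Coalgebra.counit : H →ₗ[k] k)
local notation "εt" => targetCounit k H
local notation "εs" => sourceCounit k H
local notation "σ" => (WeakHopfAlgebra.antipode : H →ₗ[k] H)

theorem sw_target_mul {z : H} (hz : εt z = z) (x : H) {f : H → H → P}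
    (h1 : ∀ b, Lin k fun a => f a b) (h2 : ∀ a, Lin k fun b => f a b) :
    ts (δ (z * x)) f = ts (δ x) fun a b => f (z * a) b := by
  conv_rhs => rw [← one_mul x]
  rw [sw_mul _ _ h1 h2, sw_mul _ _ (by fun_prop) (by fun_prop),
    sw_target' hz (by fun_prop) (by fun_prop)]
  simp only [mul_assoc]

theorem sw_source_mul {y : H} (hy : εs y = y) (x : H) {f : H → H → P}
    (h1 : ∀ b, Lin k fun a => f a b) (h2 : ∀ a, Lin k fun b => f a b) :
    ts (δ (y * x)) f = ts (δ x) fun a b => f a (y * b) := by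
  conv_rhs => rw [← one_mul x]
  rw [sw_mul _ _ h1 h2, sw_mul _ _ (by fun_prop) (by fun_prop),
    sw_source hy (by fun_prop) (by fun_prop)]
  simp only [mul_assoc]

/-- `hl₁ ⊗ S(l₂) = l₁ ⊗ S(l₂)h` for a left integral `l`. -/
theorem sw_integral {l : H} (hl : ∀ h : H, h * l = εt h * l) (h : H) {f : H → H → P}
    (h1 : ∀ b, Lin k fun a => f a b) (h2 : ∀ a, Lin k fun b => f a b) :
    ts (δ l) (fun a b => f (h * a) (σ b)) = ts (δ l) fun a b => f a (σ b * h) := by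
  -- The case of a target element `z = S(y)` with `y ∈ H_s`: the integral property gives `zl = yl`,
  -- and the coproduct of `yl` carries `y` in the second leg, where the antipode turns it into `z`
  -- on the right.
  have ht : ∀ x : H, ∀ {g : H → H → P}, (∀ b, Lin k fun a => g a b) → (∀ a, Lin k fun b => g a b) →
      ts (δ l) (fun a b => g (εt x * a) (σ b)) = ts (δ l) fun a b => g a (σ b * εt x) := by
    intro x g g1 g2
    obtain ⟨y, hy, hyx⟩ := exists_source_antipode_eq (targetCounit_idem (k := k) x)
    rw [← sw_target_mul (targetCounit_idem x) l (f := fun a b => g a (σ b)) (by fun_prop)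
      (by fun_prop), ← hyx, antipode_source hy, ← hl,
      sw_source_mul hy l (by fun_prop) (by fun_prop), ← antipode_source hy]
    simp only [antipode_mul_rev]
  have e : ∀ x z : H, ts (δ (x * l)) (fun a b => f a (σ b * z)) =
      ts (δ l) fun a b => f a (σ b * (εt x * z)) := fun x z => by
    rw [hl, sw_target_mul (targetCounit_idem x) l (by fun_prop) (by fun_prop),
      ht x (g := fun a b => f a (b * z)) (by fun_prop) (by fun_prop)]
    simp only [mul_assoc]
  -- For general `h` write `h = ε_t(h₁)h₂` on the right of `S(l₂)`, so that `ε_t(h₁)l` becomes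
  -- `h₁l`. Then `S(h₂)h₃` reduces to `ε_s(h₂)`.
  have e := ts_congr (δ h) e
  rw [← Lin.map_ts (g := fun w => ts (δ l) fun a b => f a (σ b * w)) (by fun_prop),
    sw_targetCounit_mul] at e
  rw [← e]
  have e' : ∀ x z : H, ts (δ (x * l)) (fun a b => f a (σ b * z)) =
      ts (δ x) fun p q => ts (δ l) fun a b => f (p * a) (σ b * σ q * z) := fun x z => by
    rw [sw_mul x l (by fun_prop) (by fun_prop)]
    simp only [antipode_mul_rev]
  simp only [e']
  rw [sw_coassoc h (f := fun p q z => ts (δ l) fun a b => f (p * a) (σ b * σ q * z))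
    (by fun_prop) (by fun_prop) (by fun_prop)]
  have e2 : ∀ p w : H, (ts (δ w) fun q z => ts (δ l) fun a b => f (p * a) (σ b * σ q * z)) =
      ts (δ l) fun a b => f (p * a) (σ b * εs w) := fun p w => by
    rw [ts_comm]
    refine ts_congr _ fun a b => ?_
    rw [← sw_antipode_mul, Lin.map_ts (g := fun w => f (p * a) (σ b * w)) (by fun_prop)]
    simp only [mul_assoc]
  simp only [e2]
  rw [sw_sourceCounit_right h (f := fun p w => ts (δ l) fun a b => f (p * a) (σ b * w))
    (by fun_prop) (by fun_prop)]
  simp only [← antipode_mul_rev, mul_assoc]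
  rw [← sw_mul 1 l (f := fun a b => f (h * a) (σ b)) (by fun_prop) (by fun_prop), one_mul]

/-- Maschke's theorem: modules over a weak Hopf algebra with a normalized left integral are
semisimple. -/
theorem isSemisimpleModule_of_integral {l : H} (hl : ∀ h : H, h * l = εt h * l) (hl1 : εt l = 1)
    (V : Type u) [AddCommGroup V] [Module k V] [Module H V] [IsScalarTower k H V] :
    IsSemisimpleModule H V := by
  refine (isSemisimpleModule_iff H V).mpr ⟨fun U => ?_⟩
  obtain ⟨p, hp⟩ := LinearMap.exists_leftInverse_of_injective
    (U.restrictScalars k).subtype (Submodule.ker_subtype _)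
  let p' : V →ₗ[k] U := p
  have hp' : ∀ v : U, p' v = v := fun v => LinearMap.congr_fun hp v
  -- The averaged projection `v ↦ l₁p(S(l₂)v)`. It is `H`-linear by `sw_integral`, and fixes `U`
  -- pointwise because `l₁S(l₂) = ε_t(l) = 1`.
  have hq : Lin k fun v => ts (δ l) fun a b => a • p' (σ b • v) := by fun_prop
  let q : V →ₗ[H] U := mkHom hq.mk' fun h v => by
    change (ts (δ l) fun a b => a • p' (σ b • h • v)) = h • ts (δ l) fun a b => a • p' (σ b • v)
    rw [Lin.map_ts (g := fun x => h • x) (by fun_prop)]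
    simp only [smul_smul]
    exact (sw_integral hl h (f := fun a b => a • p' (b • v)) (by fun_prop) (by fun_prop)).symm
  refine ⟨LinearMap.ker q, LinearMap.isCompl_of_proj (f := q) fun v => ?_⟩
  change (ts (δ l) fun a b => a • p' (σ b • (v : V))) = v
  have e : ∀ a b : H, a • p' (σ b • (v : V)) = (a * σ b) • v := fun a b => by
    rw [← Submodule.coe_smul, hp', smul_smul]
  simp only [e]
  rw [← Lin.map_ts (g := fun x : H => x • v) (by fun_prop), sw_mul_antipode, hl1, one_smul]

end Maschke

/-! ### Characters, invertibility of the Drinfeld element, and the quantum trace formula. -/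

section Traces

variable {k H : Type u} [Field k] [Ring H] [Algebra k H]

open WHRep

variable (k) in
/-- The character of a representation. -/
noncomputable def character (V : Type u) [AddCommGroup V] [Module k V] [Module H V]
    [IsScalarTower k H V] : H →ₗ[k] k :=
  LinearMap.trace k V ∘ₗ (Algebra.lsmul k k V).toLinearMap

theorem character_mul_comm (V : Type u) [AddCommGroup V] [Module k V] [Module H V]
    [IsScalarTower k H V] (x y : H) : character k V (x * y) = character k V (y * x) := by
  simp only [character, LinearMap.comp_apply, AlgHom.toLinearMap_apply, map_mul]
  exact LinearMap.trace_mul_comm _ _ _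

variable [WeakHopfAlgebra k H]

local notation "δ" => (Coalgebra.comul : H →ₗ[k] H ⊗[k] H)
local notation "ϵ" => (Coalgebra.counit : H →ₗ[k] k)
local notation "εt" => targetCounit k H
local notation "εs" => sourceCounit k H
local notation "σ" => (WeakHopfAlgebra.antipode : H →ₗ[k] H)

@[fun_prop] theorem Lin.unitMk [FiniteDimensional k H] {L : Type*} [AddCommGroup L] [Module k L]
    {g : L → H} (hg : Lin k g) : Lin k (fun x => (WeakHopf.unitMk (g x) : (𝟙_ (WHRep k H) : WHRep k H))) :=
  Lin.comp' (Lin.coe (TargetSub.mk k H)) hg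

@[fun_prop] theorem Lin.trace_lsmul {L : Type*} [AddCommGroup L] [Module k L] {g : L → H}
    (hg : Lin k g) (V : Type u) [AddCommGroup V] [Module k V] [Module H V] [IsScalarTower k H V]
    (T : V →ₗ[k] V) : Lin k fun x => LinearMap.trace k V (Algebra.lsmul k k V (g x) ∘ₗ T) :=
  ⟨fun x y => by rw [hg.map_add, _root_.map_add, LinearMap.add_comp, _root_.map_add],
    fun c x => by rw [hg.map_smul, _root_.map_smul, LinearMap.smul_comp, _root_.map_smul]⟩

theorem trace_eq_ts_canon {V : Type u} [AddCommGroup V] [Module k V] [Module H V]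
    [IsScalarTower k H V] [FiniteDimensional k V] (T : V →ₗ[k] V) :
    LinearMap.trace k V T = ts (canon k H V) fun g γ => DualMod.ev k H V γ (T g) := by
  classical
  rw [ts_canon (by fun_prop) (by fun_prop),
    LinearMap.trace_eq_matrix_trace k (Module.Basis.ofVectorSpace k V), Matrix.trace]
  exact Finset.sum_congr rfl fun i _ => LinearMap.toMatrix_apply ..

theorem trace_tensorAct (V W : Type u) [AddCommGroup V] [Module k V] [Module H V]
    [IsScalarTower k H V] [AddCommGroup W] [Module k W] [Module H W] [IsScalarTower k H W]
    [FiniteDimensional k V] [FiniteDimensional k W] (t : H ⊗[k] H) :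
    LinearMap.trace k (V ⊗[k] W) (tensorAct k H V W t) =
      ts t fun a b => character k V a * character k W b := by
  conv_lhs => rw [← ts_tmul_self t]
  rw [Lin.map_ts (g := fun t => LinearMap.trace k (V ⊗[k] W) (tensorAct k H V W t))
    (Lin.comp' (Lin.coe _) (Lin.coe (tensorAct k H V W).toLinearMap))]
  refine ts_congr _ fun a b => ?_
  rw [character, character, LinearMap.comp_apply, LinearMap.comp_apply,
    ← LinearMap.trace_tensorProduct']
  congr 1

/-- The trace of the action of `t ∈ (H ⊗ H)Δ(1)` on a tensor product of modules. -/
theorem trace_proj_tensorAct_incl (V W : Type u) [AddCommGroup V] [Module k V] [Module H V]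
    [IsScalarTower k H V] [AddCommGroup W] [Module k W] [Module H W] [IsScalarTower k H W]
    [FiniteDimensional k V] [FiniteDimensional k W] (t : H ⊗[k] H) (ht : t * δ 1 = t) :
    LinearMap.trace k (WTensor k H V W)
        (WTensor.proj k H V W ∘ₗ tensorAct k H V W t ∘ₗ WTensor.incl k H V W) =
      ts t fun a b => character k V a * character k W b := by
  -- Projection followed by inclusion is the action of `Δ(1)`, which `t` absorbs; by cyclicity the
  -- trace can thus be taken on all of `V ⊗_k W`.
  have e : (tensorAct k H V W t ∘ₗ WTensor.incl k H V W) ∘ₗ WTensor.proj k H V W =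
      tensorAct k H V W t := by
    conv_rhs => rw [← ht, map_mul]
    rfl
  rw [LinearMap.trace_comp_comm', e, trace_tensorAct]

section Quasitriangular

variable [FiniteDimensional k H] [QuasitriangularStructure k H]

local notation "ℛ" => (QuasitriangularStructure.R : H ⊗[k] H)
local notation "u" => drinfeldElement k H
local notation "ℳ" => monodromy k H

theorem lin_evaluation (V : WHRep k H) (φ : DualMod k H V) (v : V) :
    lin (ε_ V Vᘁ) (tp (V := dualRep V) φ v) =
      ts (δ 1) fun a b => DualMod.ev k H V φ (a • v) • unitMk b := evalLin_wtm φ v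

theorem lin_coevaluation (V : WHRep k H) (z : (𝟙_ (WHRep k H) : WHRep k H)) :
    lin (η_ V Vᘁ) z = ts (canon k H V) fun g γ => tp (W := dualRep V) (unitVal z • g) γ :=
  lin_coevHom V z

/-- The source of `u` in quantum traces: braiding and then evaluating yields `φ(S(R⁽²⁾)1₁R⁽¹⁾v)1₂`,
and `1₁`, being in `H_s`, comes out of the sandwich as `S(1₁)`. -/
theorem lin_braiding_evaluation (V : WHRep k H) (v : V) (φ : DualMod k H V) :
    lin ((β_ V Vᘁ).hom ≫ ε_ V Vᘁ) (tp (W := dualRep V) v φ) =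
      ts (δ 1) fun a b => DualMod.ev k H V φ ((σ a * u) • v) • unitMk b := by
  refine (congrArg (lin (ε_ V Vᘁ)) (lin_braiding V (dualRep V) v φ)).trans ?_
  refine (lin_ts (ε_ V Vᘁ) _ _).trans ?_
  refine (ts_congr _ fun a b => lin_evaluation V (b • φ) (a • v)).trans ?_
  rw [ts_comm, ← sw_one_source (f := fun p q => ts ℛ fun a b =>
    DualMod.ev k H V (b • φ) (p • a • v) • unitMk q) (by fun_prop)
    (by fun_prop), ← sw_one_source (f := fun p q =>
      DualMod.ev k H V φ ((σ p * u) • v) • unitMk q) (by fun_prop) (by fun_prop)]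
  refine ts_congr _ fun p q => ?_
  rw [← sw_R_antipode_source_mul (sourceCounit_idem p),
    Lin.map_ts (g := fun x : H => DualMod.ev k H V φ (x • v) • unitMk q) (by fun_prop)]
  simp only [mul_smul]
  rfl

/-- Rigidity replaces an explicit inverse. The right annihilator `{x | ux = 0}` is a left ideal
because `uh = S²(h)u`, hence a representation on which `u` acts by zero. Its evaluation composed
with the invertible braiding is then zero, so its evaluation is zero, and the zigzag identity makes
the representation itself zero. In finite dimension, injectivity of left multiplication by `u`
suffices. -/
theorem isUnit_drinfeldElement : IsUnit u := by
  let K : Submodule H H :=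
    { carrier := {x | u * x = 0}
      add_mem' := fun {x y} hx hy => by
        change u * (x + y) = 0
        rw [mul_add, hx, hy, add_zero]
      zero_mem' := mul_zero _
      smul_mem' := fun h x hx => by
        change u * (h * x) = 0
        rw [← mul_assoc, ← antipode_antipode_mul_drinfeldElement, mul_assoc, hx, mul_zero] }
  let V : WHRep k H := ⟨K⟩
  have h0 : (β_ V Vᘁ).hom ≫ ε_ V Vᘁ = 0 := rep_ext₂ (V := V) (W := dualRep V) fun v φ => by
    refine (lin_braiding_evaluation V v φ).trans ?_
    have hv : u • v = 0 := Subtype.ext v.2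
    simp only [mul_smul, hv, smul_zero, map_zero, zero_smul]
    exact Finset.sum_const_zero
  have h1 : ε_ V Vᘁ = 0 := by
    rw [← cancel_epi (β_ V Vᘁ).hom, h0, Limits.comp_zero]
  have h2 : 𝟙 V = 0 := by
    have e := ExactPairing.evaluation_coevaluation V Vᘁ
    rw [h1, MonoidalPreadditive.whiskerLeft_zero, Limits.comp_zero, Limits.comp_zero] at e
    rw [← cancel_epi (λ_ V).hom, ← cancel_mono (ρ_ V).inv, Category.comp_id, ← e]
    simp
  have hK : ∀ x : H, u * x = 0 → x = 0 := fun x hx =>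
    congrArg Subtype.val (LinearMap.congr_fun h2 (⟨x, hx⟩ : K))
  have hinj : Function.Injective (LinearMap.mulLeft k u) :=
    (injective_iff_map_eq_zero _).mpr hK
  obtain ⟨w, hw⟩ := LinearMap.surjective_of_injective hinj 1
  have hw : u * w = 1 := hw
  have hw' : w * u = 1 := by
    refine sub_eq_zero.mp (hK _ ?_)
    rw [mul_sub, ← mul_assoc, hw, one_mul, mul_one, sub_self]
  exact ⟨⟨u, w, hw, hw'⟩, rfl⟩

variable [RibbonStructure k H]

local notation "ν" => ((RibbonStructure.ν k : Hˣ) : H)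

/-- The quantum trace of `f` is `z ↦ Tr(S(1₁)uνf) 1₂` at `z = 1`. -/
theorem unitVal_qtrace (V : WHRep k H) (f : V ⟶ V) :
    unitVal (lin (qtrace f) (unitMk 1)) = ts (δ 1) fun a b =>
      LinearMap.trace k V (Algebra.lsmul k k V (σ a * (u * ν)) ∘ₗ toLin k (lin f)) • b := by
  have e0 : unitVal (unitMk (k := k) (1 : H)) = 1 := targetCounit_one
  have e1 : lin (η_ V Vᘁ ≫ ((f ≫ (RibbonCategory.twist V).hom) ▷ Vᘁ)) (unitMk 1) =
      ts (canon k H V) fun g γ => tp (W := dualRep V) (ν • lin f g) γ := by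
    rw [lin_comp, lin_coevaluation, e0]
    refine (lin_ts _ _ _).trans (ts_congr _ fun g γ => (lin_whiskerRight _ _ _ _).trans ?_)
    rw [one_smul]
    rfl
  have e2 : lin (qtrace f) (unitMk 1) = ts (canon k H V) fun g γ => ts (δ 1) fun a b =>
      DualMod.ev k H V γ ((σ a * u) • ν • lin f g) • unitMk b := by
    refine (congrArg (lin ((β_ V Vᘁ).hom ≫ ε_ V Vᘁ)) e1).trans ?_
    exact (lin_ts _ _ _).trans (ts_congr _ fun g γ => lin_braiding_evaluation V _ γ)
  rw [e2, ts_comm, ← sw_one_target (f := fun a b => LinearMap.trace k V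
    (Algebra.lsmul k k V (σ a * (u * ν)) ∘ₗ toLin k (lin f)) • b) (by fun_prop) (by fun_prop)]
  change TargetSub.val k H _ = _
  rw [Lin.map_ts (Lin.coe _)]
  refine ts_congr _ fun a b => ?_
  rw [trace_eq_ts_canon (H := H), Lin.map_ts (Lin.coe _),
    Lin.map_ts (g := fun x : k => x • εt b) (by fun_prop)]
  refine ts_congr _ fun g γ => ?_
  have e : (σ a * (u * ν)) • lin f g = (σ a * u) • ν • lin f g := by rw [← mul_assoc, mul_smul]
  refine (map_smul (TargetSub.val k H) _ _).trans ?_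
  exact congrArg (fun x => DualMod.ev k H V γ x • εt b) e.symm

end Quasitriangular

end Traces

end WeakHopf

namespace WeakHopf

/-! ### The quantum trace of the double braiding as a partial trace. -/

section QuantumTraces

variable {k H : Type u} [Field k] [Ring H] [Algebra k H] [WeakHopfAlgebra k H]
  [FiniteDimensional k H] [QuasitriangularStructure k H]

open WHRep

local notation "δ" => (Coalgebra.comul : H →ₗ[k] H ⊗[k] H)
local notation "εt" => targetCounit k H
local notation "εs" => sourceCounit k H
local notation "σ" => (WeakHopfAlgebra.antipode : H →ₗ[k] H)
local notation "ℛ" => (QuasitriangularStructure.R : H ⊗[k] H)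
local notation "ℳ" => monodromy k H

theorem lin_braiding_braiding (V W : WHRep k H) (v : V) (w : W) :
    lin ((β_ V W).hom ≫ (β_ W V).hom) (tp v w) = ts ℳ fun a b => tp (a • v) (b • w) := by
  rw [lin_comp, lin_braiding, lin_ts, monodromy, ts_mul _ _ (by fun_prop) (by fun_prop),
    ts_flip _ (by fun_prop) (by fun_prop), ts_comm]
  refine ts_congr _ fun a b => ?_
  rw [lin_braiding]
  simp only [smul_smul]

/-- The endomorphism is the restriction of the action of `Δ(h)M`. As this element absorbs `Δ(1)` on
the right, its trace on the truncated tensor product equals the trace on `V ⊗_k W`, which splits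
into characters. -/
theorem trace_lsmul_braiding_braiding (V W : WHRep k H) (h : H) :
    LinearMap.trace k (V ⊗ W : WHRep k H) (Algebra.lsmul k k (V ⊗ W : WHRep k H) h ∘ₗ
        toLin k (lin ((β_ V W).hom ≫ (β_ W V).hom))) =
      ts (δ h * ℳ) fun a b => character k V a * character k W b := by
  have ht : δ h * ℳ * δ 1 = δ h * ℳ := by rw [mul_assoc, monodromy_mul_comul_one]
  rw [← trace_proj_tensorAct_incl V W _ ht]
  congr 1
  refine LinearMap.ext (WTensor.ind (V := V) (W := W) (Lin.coe _) (Lin.coe _) fun v w => ?_)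
  refine Eq.trans (b := ts (δ h * ℳ) fun a b => tp (a • v) (b • w)) ?_ ?_
  · refine (congrArg (h • ·) (lin_braiding_braiding V W v w)).trans ?_
    rw [Lin.map_ts (g := fun x => h • x) (by fun_prop), ts_mul _ _ (by fun_prop) (by fun_prop),
      ts_comm]
    simp only [smul_tp, smul_smul]
  · symm
    conv_rhs => rw [← ht]
    refine Eq.trans ?_ (proj_act (δ h * ℳ * δ 1) v w)
    rw [map_mul _ (δ h * ℳ) (δ 1)]
    rfl

variable [RibbonStructure k H]

variable (k H) in
/-- The balancing element `uν`. -/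
noncomputable def balancing : H := drinfeldElement k H * ((RibbonStructure.ν k : Hˣ) : H)

local notation "γ" => balancing k H

theorem antipode_antipode_mul_balancing (h : H) : σ (σ h) * γ = γ * h := by
  rw [balancing, ← mul_assoc, antipode_antipode_mul_drinfeldElement, mul_assoc,
    ← RibbonStructure.ν_central, mul_assoc]

/-- The twisted trace property required by `partialTrace_central`: cyclicity brings `S²(x)` in front
of `γ`, and `S²(x)γ = γx`. -/
theorem character_balancing_mul (V : WHRep k H) (x y : H) :
    character k V (γ * (x * y)) = character k V (γ * (y * σ (σ x))) := by
  rw [← mul_assoc γ y, character_mul_comm _ (γ * y), ← mul_assoc (σ (σ x)),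
    antipode_antipode_mul_balancing,
    mul_assoc]

variable (k) in
/-- The functional `h ↦ Tr(uνh)`. -/
noncomputable def qcharacter (V : WHRep k H) : H →ₗ[k] k :=
  character k V ∘ₗ LinearMap.mulLeft k γ

theorem qcharacter_apply (V : WHRep k H) (h : H) :
    qcharacter k V h = character k V (γ * h) := rfl

/-- The element `(id ⊗ φ)(R₂₁R)`. -/
noncomputable def partialTrace (φ : H →ₗ[k] k) : H := ts ℳ fun a b => φ b • a

theorem unitVal_qtrace_id (V : WHRep k H) :
    unitVal (lin (qtrace (𝟙 V)) (unitMk 1)) =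
      ts (δ 1) fun a b => character k V (σ a * γ) • b :=
  unitVal_qtrace V (𝟙 V)

/-- The trace over `W` can be carried out first. Since `S(1₁)` lies in `H_t`, its coproduct only
affects the first leg, and the group-like property of `γ` relative to `M` places one `γ` in each
leg; the one in the second leg belongs to the `qcharacter` of `W`. -/
theorem unitVal_qtrace_braiding_braiding (V W : WHRep k H) :
    unitVal (lin (qtrace ((β_ V W).hom ≫ (β_ W V).hom)) (unitMk 1)) =
      ts (δ 1) fun a b => character k V (σ a * γ * partialTrace (qcharacter k W)) • b := by
  rw [unitVal_qtrace]
  simp only [trace_lsmul_braiding_braiding]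
  rw [← sw_one_source (f := fun a b => ts (δ (σ a * (drinfeldElement k H *
    ((RibbonStructure.ν k : Hˣ) : H))) * ℳ) (fun a b => character k V a * character k W b) • b)
    (by fun_prop) (by fun_prop), ← sw_one_source (f := fun a b =>
      character k V (σ a * γ * partialTrace (qcharacter k W)) • b) (by fun_prop) (by fun_prop)]
  refine ts_congr _ fun p q => ?_
  congr 1
  have hz := targetCounit_antipode_source (sourceCounit_idem (k := k) p)
  -- `γ` need not be group-like on its own; the factor `M` is what makes this identity available.
  have e : δ (σ (εs p) * γ) * ℳ = (σ (εs p) * γ) ⊗ₜ[k] γ * ℳ := by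
    have e1 : δ (σ (εs p) * γ) = σ (εs p) ⊗ₜ[k] 1 * δ γ := by
      rw [← ts_tmul_self (δ (_ * γ)), sw_target_mul hz _ (by fun_prop) (by fun_prop),
        tmul_mul_eq_ts]
      simp only [one_mul]
    rw [e1, mul_assoc, balancing, comul_balancing_mul_monodromy isUnit_drinfeldElement,
      ← mul_assoc, Algebra.TensorProduct.tmul_mul_tmul, one_mul]
  change ts (δ (σ (εs p) * γ) * ℳ) _ = _
  rw [e, partialTrace, ts_mul _ _ (by fun_prop) (by fun_prop), ts_tmul _ _ (by fun_prop)
    (by fun_prop), Lin.map_ts (g := fun x => character k V (σ (εs p) * γ * x)) (by fun_prop)]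
  refine ts_congr _ fun a b => ?_
  rw [qcharacter_apply, mul_smul_comm, map_smul, smul_eq_mul, mul_comm]

theorem partialTrace_qcharacter_central (W : WHRep k H) (h : H) :
    h * partialTrace (qcharacter k W) = partialTrace (qcharacter k W) * h :=
  partialTrace_central _ (fun x y => character_balancing_mul W x y) h

end QuantumTraces

end WeakHopf

namespace WeakHopf

/-! ### Simple modules, the unit object, duals, and nonvanishing quantum dimensions. -/

section Simple

variable {k H : Type u} [Field k] [Ring H] [Algebra k H]

open WHRep

theorem bijective_smul_id_of_isSimpleModule [IsAlgClosed k] (V : WHRep k H) [IsSimpleModule H V] :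
    Function.Bijective fun c : k => c • 𝟙 V := by
  have e := IsSimpleModule.algebraMap_end_bijective_of_isAlgClosed (A := H) (V := V) k
  exact e

/-- Converse of Schur's lemma for semisimple modules: the projection onto a submodule along a
complement is a scalar, and if the submodule contains a nonzero vector this scalar is `1`, so the
submodule is everything. -/
theorem isSimpleModule_of_bijective_smul_id (V : WHRep k H) [IsSemisimpleModule H V]
    (hV : Function.Bijective fun c : k => c • 𝟙 V) : IsSimpleModule H V := by
  have hnt : Nontrivial V := by
    by_contra h
    rw [not_nontrivial_iff_subsingleton] at h
    exact zero_ne_one (hV.1 (rep_ext fun v => Subsingleton.elim _ _ :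
      (0 : k) • 𝟙 V = (1 : k) • 𝟙 V))
  refine (isSimpleModule_iff H V).mpr ⟨fun U => ?_⟩
  obtain ⟨W, hW⟩ := exists_isCompl U
  obtain ⟨c, hc⟩ := hV.2 (ofHom (U.subtype ∘ₗ U.projectionOnto W hW))
  have hc : ∀ v : V, c • v = U.projectionOnto W hW v := fun v => LinearMap.congr_fun hc v
  by_cases hU : U = ⊥
  · exact Or.inl hU
  · refine Or.inr (eq_top_iff.mpr fun v _ => ?_)
    obtain ⟨x, hx, hx0⟩ := U.exists_mem_ne_zero_of_ne_bot hU
    have h1 := hc x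
    rw [Submodule.projectionOnto_apply_left hW ⟨x, hx⟩] at h1
    have h2 : c = 1 := by
      have h3 : (c - 1) • x = 0 := by rw [sub_smul, h1, one_smul, sub_self]
      exact sub_eq_zero.mp ((smul_eq_zero.mp h3).resolve_right hx0)
    have h4 := hc v
    rw [h2, one_smul] at h4
    rw [h4]
    exact Subtype.prop _

variable [WeakHopfAlgebra k H]

local notation "δ" => (Coalgebra.comul : H →ₗ[k] H ⊗[k] H)
local notation "εt" => targetCounit k H
local notation "εs" => sourceCounit k H
local notation "σ" => (WeakHopfAlgebra.antipode : H →ₗ[k] H)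

/-- The common kernel in `V` of a submodule of the dual is stable under `S(H)`, hence under `H` once
`S` is onto. It is therefore zero or `V`, and finite-dimensional duality determines the submodule
from it. -/
theorem isSimpleModule_dual (hσ : Function.Surjective σ) (V : Type u) [AddCommGroup V] [Module k V]
    [Module H V] [IsScalarTower k H V] [FiniteDimensional k V] [IsSimpleModule H V] :
    IsSimpleModule H (DualMod k H V) := by
  have hnt : Nontrivial V := IsSimpleModule.nontrivial H V
  have : Nontrivial (DualMod k H V) := inferInstanceAs (Nontrivial (Module.Dual k V))
  refine (isSimpleModule_iff H _).mpr ⟨fun U => ?_⟩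
  let W : Submodule H V :=
    { carrier := {v | ∀ φ ∈ U, DualMod.ev k H V φ v = 0}
      add_mem' := fun {v w} hv hw φ hφ => by rw [map_add, hv φ hφ, hw φ hφ, add_zero]
      zero_mem' := fun φ _ => map_zero _
      smul_mem' := fun h v hv φ hφ => by
        obtain ⟨g, rfl⟩ := hσ h
        exact hv _ (U.smul_mem g hφ) }
  rcases eq_bot_or_eq_top W with hW | hW
  · right
    let U' : Submodule k (Module.Dual k V) :=
      { carrier := (U : Set (DualMod k H V))
        add_mem' := U.add_mem
        zero_mem' := U.zero_mem
        smul_mem' := fun c φ hφ =>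
          (U.restrictScalars k).smul_mem (x := show DualMod k H V from φ) c hφ }
    have hU' : U'.dualCoannihilator = ⊥ := by
      refine (Submodule.eq_bot_iff _).mpr fun v hv => ?_
      have hv' : v ∈ W := fun φ hφ => (Submodule.mem_dualCoannihilator v).mp hv φ hφ
      rwa [hW] at hv'
    have hU : U' = ⊤ := by
      rw [← Subspace.dualCoannihilator_dualAnnihilator_eq (W := U'), hU',
        Submodule.dualAnnihilator_bot]
    have hmem : ∀ φ : Module.Dual k V, φ ∈ U' := fun φ => hU ▸ Submodule.mem_top
    exact eq_top_iff.mpr fun φ _ => hmem φ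
  · left
    refine (Submodule.eq_bot_iff _).mpr fun φ hφ => DualMod.ext fun v => ?_
    have hv : v ∈ W := hW ▸ Submodule.mem_top
    rw [hv φ hφ, map_zero, LinearMap.zero_apply]

variable [FiniteDimensional k H]

/-- An endomorphism is determined by the image `w ∈ H_t` of `1`. The point is that `w` is central in
`H`, so that connectedness makes it a scalar; uniqueness of the scalar uses `1 ≠ 0` in `H`. -/
theorem bijective_smul_id_unit [Nontrivial H] (hconn : IsConnected k H) :
    Function.Bijective fun c : k => c • 𝟙 (𝟙_ (WHRep k H)) := by
  have h1 : unitVal (unitMk (k := k) (1 : H)) = 1 := targetCounit_one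
  refine ⟨fun c d h => ?_, fun f => ?_⟩
  · have e : unitVal (c • unitMk (k := k) (1 : H)) = unitVal (d • unitMk (k := k) (1 : H)) :=
      congrArg unitVal (LinearMap.congr_fun h (unitMk 1))
    have e' : ∀ c : k, unitVal (c • unitMk (k := k) (1 : H)) = c • 1 := fun c =>
      (map_smul (TargetSub.val k H) c _).trans (congrArg (c • ·) h1)
    rw [e', e'] at e
    exact smul_left_injective k one_ne_zero e
  · set w : H := unitVal (lin f (unitMk 1)) with hw
    have hwt : εt w = w := TargetSub.targetCounit_val _
    have hf : ∀ h : H, unitVal (lin f (unitMk h)) = εt (h * w) := fun h => by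
      have : unitMk h = h • unitMk (k := k) (1 : H) := by
        refine Eq.trans ?_ (TargetSub.smul_mk h 1).symm
        rw [mul_one]
        rfl
      rw [this, lin_map_smul]
      rfl
    have hz : ∀ z : H, εt z = z → εt (z * w) = z * w := fun z hz => targetCounit_mul hz hwt
    -- Well-definedness of the endomorphism gives `ε_t(aw) = ε_t(a)w`, so `hw = ε_t(h₁)wh₂ =
    -- ε_t(1₁)w1₂h`. The case `h = 1` identifies the left factor with `w`, which yields centrality.
    have hcomm : ∀ h : H, h * w = ts (δ 1) (fun a b => εt a * w * b) * h := fun h => by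
      have e : ∀ a : H, εt (a * w) = εt a * w := fun a => by
        have e : unitMk (k := k) (εt a) = unitMk a := TargetSub.mk_targetCounit a
        rw [← hf, ← hz _ (targetCounit_idem a), ← hf, e]
      rw [← sw_targetCounit_mul_target h hwt]
      simp only [e]
      rw [sw_targetCounit_left h (f := fun a b => a * w * b) (by fun_prop) (by fun_prop),
        Lin.map_ts (g := fun x => x * h) (by fun_prop)]
      simp only [mul_assoc]
    have hc : ∀ h : H, h * w = w * h := fun h => by
      have e1 := hcomm 1
      rw [one_mul, mul_one] at e1
      rw [hcomm h, ← e1]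
    obtain ⟨c, hcw⟩ := hconn w ⟨w, hwt⟩ (Subalgebra.mem_center_iff.mpr hc)
    refine ⟨c, rep_ext fun z => TargetSub.val_injective ?_⟩
    have e := hf (unitVal z)
    have ez : unitMk (unitVal z) = z := TargetSub.mk_val z
    have ezt : εt (unitVal z) = unitVal z := TargetSub.targetCounit_val z
    rw [ez, hz _ ezt, ← hcw, ← Algebra.commutes, ← Algebra.smul_def] at e
    exact (map_smul (TargetSub.val k H) c z).trans e.symm

variable [QuasitriangularStructure k H]

/-- The square of the antipode is conjugation by the unit `u`, hence surjective. -/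
theorem antipode_surjective : Function.Surjective σ := fun h => by
  obtain ⟨v, hv⟩ := isUnit_drinfeldElement (k := k) (H := H)
  refine ⟨σ (↑v⁻¹ * h * v), ?_⟩
  have e := antipode_antipode_mul_drinfeldElement (k := k) (↑v⁻¹ * h * v : H)
  rw [← hv, ← mul_assoc, ← mul_assoc, Units.mul_inv, one_mul] at e
  exact v.isUnit.mul_right_cancel e

variable [RibbonStructure k H]

/-- The coevaluation is nonzero by the zigzag identity, injective because the unit is simple, and
split by semisimplicity. By adjunction every map `V* ⊗ V → 1` is a multiple of evaluation, so the
splitting is a multiple of braiding followed by evaluation. The composite defining the quantum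
dimension, times that multiple, is then the nonzero twist scalar. -/
theorem qtrace_id_ne_zero [IsAlgClosed k] (hss : ∀ X : WHRep k H, IsSemisimpleModule H X)
    (h1 : Function.Bijective fun c : k => c • 𝟙 (𝟙_ (WHRep k H))) (V : WHRep k H)
    [IsSimpleModule H V] : qtrace (𝟙 V) ≠ 0 := by
  have hunit : IsSimpleModule H (𝟙_ (WHRep k H) : WHRep k H) :=
    have := hss (𝟙_ (WHRep k H))
    isSimpleModule_of_bijective_smul_id _ h1
  have hV := bijective_smul_id_of_isSimpleModule V
  have hη : η_ V Vᘁ ≠ 0 := fun h => by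
    have e := ExactPairing.evaluation_coevaluation V Vᘁ
    rw [h, MonoidalPreadditive.zero_whiskerRight, Limits.zero_comp] at e
    have h2 : 𝟙 V = 0 := by
      rw [← cancel_epi (λ_ V).hom, ← cancel_mono (ρ_ V).inv, Category.comp_id, ← e]
      simp
    exact one_ne_zero (hV.1 (show (1 : k) • 𝟙 V = (0 : k) • 𝟙 V by rw [h2, smul_zero, smul_zero]))
  have := hss (V ⊗ Vᘁ)
  obtain ⟨r, hr⟩ := IsSemisimpleModule.extension_property (lin (η_ V Vᘁ))
    (LinearMap.injective_of_ne_zero hη) LinearMap.id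
  have hr : η_ V Vᘁ ≫ ofHom r = 𝟙 _ := hr
  -- Duality identifies these maps with `End V = k`, evaluation corresponding to the identity up to
  -- unit constraints.
  have hom_eq : ∀ f : Vᘁ ⊗ V ⟶ 𝟙_ (WHRep k H), ∃ c : k, f = c • ε_ V Vᘁ := fun f => by
    obtain ⟨c, hc⟩ := hV.2 (tensorLeftHomEquiv V V Vᘁ (𝟙_ _) f ≫ (ρ_ V).hom)
    have hc : c • 𝟙 V = tensorLeftHomEquiv V V Vᘁ (𝟙_ _) f ≫ (ρ_ V).hom := hc
    refine ⟨c, ?_⟩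
    rw [← (tensorLeftHomEquiv V V Vᘁ (𝟙_ _)).symm_apply_apply f,
      show tensorLeftHomEquiv V V Vᘁ (𝟙_ _) f = c • (ρ_ V).inv by
        rw [← cancel_mono (ρ_ V).hom, ← hc, Linear.smul_comp, Iso.inv_hom_id]]
    simp [tensorLeftHomEquiv, unitors_equal]
  obtain ⟨c, hc⟩ := hom_eq ((β_ V Vᘁ).inv ≫ ofHom r)
  obtain ⟨t, ht⟩ := hV.2 (RibbonCategory.twist V).hom
  have ht : t • 𝟙 V = (RibbonCategory.twist V).hom := ht
  have ht0 : t ≠ 0 := by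
    rintro rfl
    rw [zero_smul] at ht
    refine one_ne_zero (hV.1 (show (1 : k) • 𝟙 V = (0 : k) • 𝟙 V from ?_))
    rw [one_smul, zero_smul, ← (RibbonCategory.twist V).hom_inv_id, ← ht, Limits.zero_comp]
  intro h0
  have e : c • qtrace (𝟙 V) = t • 𝟙 _ := by
    rw [qtrace, ← Linear.comp_smul, ← Linear.comp_smul, ← Linear.comp_smul, ← hc,
      Iso.hom_inv_id_assoc, Category.id_comp, ← ht, MonoidalLinear.smul_whiskerRight,
      id_whiskerRight, Linear.smul_comp, Category.id_comp, Linear.comp_smul, hr]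
  rw [h0, smul_zero] at e
  exact ht0 (h1.1 (show t • 𝟙 _ = (0 : k) • 𝟙 _ by rw [← e, zero_smul]))

end Simple

end WeakHopf

namespace WeakHopf

/-! ### Complete families of simple modules and their central idempotents. -/

section Families

variable {k H : Type u} [Field k] [Ring H] [Algebra k H]

open WHRep

/-- A linear equivalence as an isomorphism of representations. -/
def WHRep.isoOfEquiv {V W : WHRep k H} (e : V ≃ₗ[H] W) : V ≅ W where
  hom := ofHom e.toLinearMap
  inv := ofHom e.symm.toLinearMap
  hom_inv_id := rep_ext e.symm_apply_apply
  inv_hom_id := rep_ext e.apply_symm_apply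

theorem isEmpty_iso_hom_eq_zero {V W : WHRep k H} [IsSimpleModule H V] [IsSimpleModule H W]
    (h : ¬ Nonempty (V ≅ W)) (f : V →ₗ[H] W) : f = 0 := by
  by_contra hf
  exact h ⟨isoOfEquiv (LinearEquiv.ofBijective f (LinearMap.bijective_of_ne_zero hf))⟩

theorem lin_sum {V W : WHRep k H} {ι : Type*} (s : Finset ι) (f : ι → (V ⟶ W)) (v : V) :
    lin (∑ i ∈ s, f i) v = ∑ i ∈ s, lin (f i) v :=
  map_sum (AddMonoidHom.mk' (fun f : V ⟶ W => lin f v) fun _ _ => rfl) f s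

/-- The simple representations form finitely many isomorphism classes; the representative of one
class may be prescribed. -/
theorem exists_simple_family [IsSemisimpleRing H] (X₀ : WHRep k H) [IsSimpleModule H X₀]
    [FiniteDimensional k H] :
    ∃ (n : ℕ) (V : Fin n → WHRep k H), (∀ i, IsSimpleModule H (V i)) ∧
      (∀ i j, Nonempty (V i ≅ V j) → i = j) ∧
      (∀ X : WHRep k H, IsSimpleModule H X → ∃ i, Nonempty (X ≅ V i)) ∧ ∃ i, V i = X₀ := by
  classical
  obtain ⟨m, S, e, hS⟩ := IsSemisimpleModule.exists_linearEquiv_fin_dfinsupp H H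
  -- The simple summands of the regular module, together with the prescribed object at `none`.
  let T : Option (Fin m) → WHRep k H := fun a => a.elim X₀ fun i => ⟨S i⟩
  have hT : ∀ a, IsSimpleModule H (T a) := fun a => match a with
    | none => inferInstanceAs (IsSimpleModule H X₀)
    | some i => hS i
  have hcomplete : ∀ X : WHRep k H, IsSimpleModule H X → ∃ i, Nonempty (X ≅ T (some i)) := by
    intro X hX
    have := IsSimpleModule.nontrivial H X
    obtain ⟨x, hx⟩ := exists_ne (0 : X)
    by_contra! hne
    refine hx ?_
    -- The map `h ↦ hx` restricts to zero on every simple summand of `H` if none is isomorphic to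
    -- `X`, contradicting `x ≠ 0` at `h = 1`.
    have hzero : LinearMap.toSpanSingleton H X x ∘ₗ e.symm.toLinearMap = 0 := by
      refine DFinsupp.lhom_ext' fun i => ?_
      have := hT (some i)
      refine isEmpty_iso_hom_eq_zero (V := T (some i)) (W := X) ?_ _
      rintro ⟨f⟩
      exact (hne i).false f.symm
    have h1 := LinearMap.congr_fun hzero (e 1)
    simpa using h1
  let s : Setoid (Option (Fin m)) :=
    { r := fun a b => Nonempty (T a ≅ T b)
      iseqv := ⟨fun a => ⟨Iso.refl _⟩, fun ⟨f⟩ => ⟨f.symm⟩, fun ⟨f⟩ ⟨g⟩ => ⟨f.trans g⟩⟩ }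
  -- The class of `X₀` is represented by `X₀` itself, because the conclusion asks for an equality of
  -- objects.
  let rep : Quotient s → Option (Fin m) := fun q => if q = ⟦none⟧ then none else q.out
  have hrep : ∀ q, ⟦rep q⟧ = q := fun q => by
    by_cases hq : q = ⟦none⟧
    · simp only [rep, if_pos hq]
      exact hq.symm
    · simp only [rep, if_neg hq, Quotient.out_eq]
  have hiso : ∀ a, Nonempty (T a ≅ T (rep ⟦a⟧)) := fun a => Quotient.exact (hrep ⟦a⟧).symm
  let E := Fintype.equivFin (Quotient s)
  refine ⟨_, fun i => T (rep (E.symm i)), fun i => hT _, fun i j hij => ?_, fun X hX => ?_,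
    E ⟦none⟧, ?_⟩
  · refine E.symm.injective ?_
    rw [← hrep (E.symm i), ← hrep (E.symm j)]
    exact Quotient.sound hij
  · obtain ⟨i, ⟨f⟩⟩ := hcomplete X hX
    obtain ⟨g⟩ := hiso (some i)
    refine ⟨E ⟦some i⟧, ⟨?_⟩⟩
    change X ≅ T (rep (E.symm (E ⟦some i⟧)))
    rw [E.symm_apply_apply]
    exact f.trans g
  · simp [rep, T]

/-- A semisimple representation is dominated by a complete family of simple representations. -/
theorem exists_domination {ι : Type*} {V : ι → WHRep k H}
    (hV : ∀ X : WHRep k H, IsSimpleModule H X → ∃ i, Nonempty (X ≅ V i)) (X : WHRep k H)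
    [IsSemisimpleModule H X] :
    ∃ (n : ℕ) (r : Fin n → ι) (f : ∀ a, V (r a) ⟶ X) (g : ∀ a, X ⟶ V (r a)),
      𝟙 X = ∑ a, g a ≫ f a := by
  have : Module.Finite H X := Module.Finite.of_restrictScalars_finite k H X
  obtain ⟨m, S, e, hS⟩ := IsSemisimpleModule.exists_linearEquiv_fin_dfinsupp H X
  have hfd : ∀ i, FiniteDimensional k (S i) := fun i =>
    inferInstanceAs (FiniteDimensional k ((S i).restrictScalars k))
  let Y : Fin m → WHRep k H := fun i => ⟨S i⟩
  choose r hr using fun i => hV (Y i) (hS i)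
  let F : ∀ i, Y i ≅ V (r i) := fun i => (hr i).some
  let inc : ∀ i, Y i ⟶ X := fun i => ofHom (W := X)
    (V := Y i) (e.symm.toLinearMap ∘ₗ DFinsupp.lsingle (R := H) (M := fun i => S i) i)
  let pr : ∀ i, X ⟶ Y i := fun i => ofHom (V := X)
    (W := Y i) (DFinsupp.lapply (R := H) (M := fun i => S i) i ∘ₗ e.toLinearMap)
  refine ⟨m, r, fun i => (F i).inv ≫ inc i, fun i => pr i ≫ (F i).hom, rep_ext fun x => ?_⟩
  simp only [Category.assoc, Iso.hom_inv_id_assoc]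
  rw [lin_sum, lin_id]
  refine e.injective ?_
  rw [map_sum]
  have h : ∀ i, e (lin (pr i ≫ inc i) x) = DFinsupp.single i (e x i) := fun i =>
    e.apply_symm_apply _
  simp only [h]
  refine DFinsupp.ext fun j => ?_
  rw [DFinsupp.finsetSum_apply, Finset.sum_eq_single j
    (fun i _ hi => DFinsupp.single_eq_of_ne hi.symm) (by simp), DFinsupp.single_eq_same]

/-- Joint faithfulness of the simple modules: the regular module is dominated by them, so `h` also
annihilates `1 ∈ H`. -/
theorem eq_zero_of_forall_smul_eq_zero [FiniteDimensional k H] [IsSemisimpleRing H] {ι : Type*}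
    {V : ι → WHRep k H} (hV : ∀ X : WHRep k H, IsSimpleModule H X → ∃ i, Nonempty (X ≅ V i)) {h : H}
    (hh : ∀ i (v : V i), h • v = 0) : h = 0 := by
  have : IsSemisimpleModule H (⟨H⟩ : WHRep k H) := inferInstanceAs (IsSemisimpleModule H H)
  obtain ⟨n, r, f, g, hfg⟩ := exists_domination hV ⟨H⟩
  have e : lin (𝟙 (⟨H⟩ : WHRep k H)) (h • (1 : H)) = 0 := by
    rw [hfg, lin_sum]
    refine Finset.sum_eq_zero fun a _ => ?_
    rw [lin_comp, map_smul (lin (g a)), hh, map_zero]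
  have e : h • (1 : H) = 0 := e
  rwa [smul_eq_mul, mul_one] at e

/-- The central idempotent of a member of a complete family of pairwise non-isomorphic simple
representations. -/
theorem exists_central_idempotent [FiniteDimensional k H] [IsSemisimpleRing H] {ι : Type*}
    [Fintype ι] [DecidableEq ι] {V : ι → WHRep k H} (hs : ∀ i, IsSimpleModule H (V i))
    (hinj : ∀ i j, Nonempty (V i ≅ V j) → i = j)
    (hV : ∀ X : WHRep k H, IsSimpleModule H X → ∃ i, Nonempty (X ≅ V i)) (j : ι) :
    ∃ e : H, (∀ h, e * h = h * e) ∧ ∀ i (v : V i), e • v = if i = j then v else 0 := by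
  let M := ∀ i, V i
  have : Module.Finite (Module.End H M) M := Module.Finite.of_restrictScalars_finite k _ M
  -- By Schur's lemma endomorphisms of the product of the pairwise non-isomorphic `V_i` are
  -- diagonal. Hence the coordinate projection `p` commutes with all of them, and the density
  -- theorem realizes it as the action of an element of `H`.
  have hz : ∀ (T : Module.End H M) (i l : ι) (v : V i), l ≠ i → T (Pi.single i v) l = 0 :=
    fun T i l v hl => LinearMap.congr_fun (isEmpty_iso_hom_eq_zero (fun h => hl (hinj i l h).symm)
      (LinearMap.proj l ∘ₗ T ∘ₗ LinearMap.single H (fun i => V i) i)) v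
  let p : Module.End (Module.End H M) M :=
    { toFun := fun x => Pi.single j (x j)
      map_add' := fun x y => Pi.single_add (f := fun i => V i) j (x j) (y j)
      map_smul' := fun T x => by
        change Pi.single j (T x j) = T (Pi.single j (x j))
        funext l
        by_cases hl : l = j
        · subst hl
          rw [Pi.single_eq_same]
          conv_lhs => rw [← Finset.univ_sum_single x, map_sum, Finset.sum_apply]
          exact Finset.sum_eq_single l (fun i _ hi => hz T i l _ hi.symm) (by simp)
        · rw [Pi.single_eq_of_ne hl, hz T j l _ hl] }
  obtain ⟨e, he⟩ := Module.Finite.toModuleEnd_moduleEnd_surjective p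
  have he' : ∀ i (v : V i), e • v = if i = j then v else 0 := fun i v => by
    have h := congrFun (LinearMap.congr_fun he (Pi.single i v)) i
    have h1 : e • v = (Pi.single j ((Pi.single i v : M) j) : M) i := by
      refine Eq.trans ?_ h
      change e • v = e • (Pi.single i v : M) i
      rw [Pi.single_eq_same]
    rw [h1]
    by_cases hij : i = j
    · subst hij; simp
    · rw [if_neg hij, Pi.single_eq_of_ne hij]
  -- Centrality follows from faithfulness, since `eh - he` acts by zero on each `V_i`.
  refine ⟨e, fun h => sub_eq_zero.mp (eq_zero_of_forall_smul_eq_zero hV fun i v => ?_), he'⟩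
  rw [sub_smul, mul_smul, mul_smul, he', he']
  split_ifs <;> simp

end Families

/-! ### Factorizability as duality between the map `F` and the partial trace. -/

section Modular

variable {k H : Type u} [Field k] [Ring H] [Algebra k H]

theorem character_eq_of_smul_eq {V : WHRep k H} {x y : H} (c : k)
    (h : ∀ v : V, x • v = c • y • v) : character k V x = c * character k V y := by
  have e : Algebra.lsmul k k V x = c • Algebra.lsmul k k V y := LinearMap.ext h
  simp only [character, LinearMap.comp_apply, AlgHom.toLinearMap_apply, e, map_smul, smul_eq_mul]

variable [WeakHopfAlgebra k H] [FiniteDimensional k H] [QuasitriangularStructure k H]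

open WHRep

theorem drinfeldMap_eq (φ : H →ₗ[k] k) :
    drinfeldMap k H φ = ts (monodromy k H) fun a b => φ a • b := by
  change TensorProduct.lid k H (LinearMap.rTensor H φ (monodromy k H)) = _
  conv_lhs => rw [← ts_tmul_self (monodromy k H)]
  rw [Lin.map_ts (Lin.coe _), Lin.map_ts (g := fun t => TensorProduct.lid k H t)
    (Lin.coe (TensorProduct.lid k H).toLinearMap)]
  simp

/-- The two maps contract opposite legs of the same tensor `M`, so they are transposes of each
other; both sides are `(φ ⊗ ψ)(M)`. -/
theorem apply_drinfeldMap (φ ψ : H →ₗ[k] k) :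
    ψ (drinfeldMap k H φ) = φ (partialTrace ψ) := by
  rw [drinfeldMap_eq, partialTrace, Lin.map_ts (Lin.coe _), Lin.map_ts (Lin.coe _)]
  simp only [map_smul, smul_eq_mul, mul_comm]

/-- If `H` is factorizable, a functional killed by `partialTrace` vanishes on the centralizer of
the source subalgebra. -/
theorem apply_eq_zero_of_partialTrace_eq_zero (hfact : IsFactorizable k H) {ψ : H →ₗ[k] k}
    (hψ : partialTrace ψ = 0) {x : H}
    (hx : x ∈ Subalgebra.centralizer k (LinearMap.range (sourceCounit k H) : Set H)) : ψ x = 0 := by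
  obtain ⟨φ, rfl⟩ := hfact x hx
  rw [apply_drinfeldMap, hψ, map_zero]

theorem partialTrace_sum {ι : Type*} (s : Finset ι) (x : ι → k) (φ : ι → H →ₗ[k] k) :
    partialTrace (∑ i ∈ s, x i • φ i) = ∑ i ∈ s, x i • partialTrace (φ i) := by
  simp only [partialTrace, LinearMap.sum_apply, LinearMap.smul_apply, ts, Finset.sum_smul,
    Finset.smul_sum, smul_assoc]
  exact Finset.sum_comm

end Modular

end WeakHopf

namespace WeakHopf

/-! ### Invertibility of the S-matrix and the final assembly. -/

section Modular

variable {k H : Type u} [Field k] [Ring H] [Nontrivial H] [Algebra k H] [FiniteDimensional k H]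
  [WeakHopfAlgebra k H] [QuasitriangularStructure k H] [RibbonStructure k H]

local notation "δ" => (Coalgebra.comul : H →ₗ[k] H ⊗[k] H)
local notation "εt" => targetCounit k H
local notation "εs" => sourceCounit k H
local notation "σ" => (WeakHopfAlgebra.antipode : H →ₗ[k] H)
local notation "γ" => balancing k H

open WHRep

theorem unitVal_smul_id (s : k) :
    unitVal (lin (s • 𝟙 (𝟙_ (WHRep k H))) (unitMk 1)) = s • (1 : H) :=
  (map_smul (TargetSub.val k H) s _).trans (congrArg (s • ·) targetCounit_one)

/-- Once the partial trace over `W` acts on `V` by the scalar `t`, it factors out of the trace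
formula for the double braiding, leaving the formula for the quantum dimension of `V`. -/
theorem qtrace_braiding_eq_mul {V W : WHRep k H} {s t d : k}
    (hs : qtrace ((β_ V W).hom ≫ (β_ W V).hom) = s • 𝟙 _) (hd : qtrace (𝟙 V) = d • 𝟙 _)
    (ht : ∀ v : V, partialTrace (qcharacter k W) • v = t • v) : s = t * d := by
  have e1 := unitVal_qtrace_braiding_braiding V W
  have e2 := unitVal_qtrace_id V
  rw [hs, unitVal_smul_id] at e1
  rw [hd, unitVal_smul_id] at e2
  have e3 : ∀ a : H, character k V (σ a * γ * partialTrace (qcharacter k W)) =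
      t * character k V (σ a * γ) := fun a => character_eq_of_smul_eq t fun v => by
    rw [mul_smul, ht, smul_comm]
  simp only [e3, mul_smul] at e1
  rw [← Lin.map_ts (g := fun x : H => t • x) (by fun_prop), ← e2, smul_smul] at e1
  exact smul_left_injective k one_ne_zero e1

/-- A functional vanishing on the centralizer of the source subalgebra has no component along a
simple representation. -/
theorem eq_zero_of_apply_centralizer {ι : Type*} [Fintype ι] [DecidableEq ι] {V : ι → WHRep k H}
    {x : ι → k} (hx : ∀ h ∈ Subalgebra.centralizer k (LinearMap.range εs : Set H),
      (∑ i, x i • qcharacter k (V i)) h = 0) {j : ι} {e : H} (he : ∀ h, e * h = h * e)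
    (hej : ∀ i (v : V i), e • v = if i = j then v else 0) {d : k} (hd0 : d ≠ 0)
    (hd : qtrace (𝟙 (V j)) = d • 𝟙 _) : x j = 0 := by
  have h1 : ∀ z : H, εt z = z → x j * character k (V j) (γ * z) = 0 := fun z hz => by
    -- The test elements are `ez` with `e` central and `z ∈ H_t`: target and source subalgebras
    -- commute, and `e` isolates the `j`-th character.
    have hmem : e * z ∈ Subalgebra.centralizer k (LinearMap.range εs : Set H) := by
      rw [Subalgebra.mem_centralizer_iff]
      rintro _ ⟨y, rfl⟩
      rw [← mul_assoc, ← he, mul_assoc, mul_assoc, target_mul_source hz (sourceCounit_idem y)]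
    have h := hx _ hmem
    rw [LinearMap.sum_apply, Finset.sum_eq_single j, LinearMap.smul_apply, smul_eq_mul,
      qcharacter_apply] at h
    · rwa [character_eq_of_smul_eq (y := γ * z) 1 fun v => by
        rw [one_smul, mul_smul, mul_smul, hej, if_pos rfl, mul_smul], one_mul] at h
    · intro i _ hi
      rw [LinearMap.smul_apply, qcharacter_apply, character_eq_of_smul_eq (y := 0) 0 fun v => by
        rw [mul_smul, mul_smul, hej, if_neg hi, smul_zero, zero_smul], zero_mul, smul_zero]
    · simp
  have h2 := unitVal_qtrace_id (V j)
  rw [hd, unitVal_smul_id] at h2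
  -- The quantum dimension only involves traces of `S(1₁)γ` with `S(1₁) ∈ H_t`, which are the values
  -- just annihilated.
  have h3 : x j • d • (1 : H) = 0 := by
    rw [h2, ← sw_one_source (f := fun a b => character k (V j) (σ a * γ) • b) (by fun_prop)
      (by fun_prop), Lin.map_ts (g := fun y : H => x j • y) (by fun_prop)]
    have h4 : ∀ a b : H, x j • character k (V j) (σ (εs a) * γ) • b = 0 := fun a b => by
      rw [smul_smul, character_mul_comm,
        h1 _ (targetCounit_antipode_source (sourceCounit_idem a)), zero_smul]
    rw [ts_congr _ h4]
    exact Finset.sum_const_zero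
  rw [smul_smul] at h3
  exact (mul_eq_zero.mp ((smul_eq_zero.mp h3).resolve_right one_ne_zero)).resolve_right hd0

/-- The left kernel of `S` is shown to be zero. Since `S i j = t i j * d j` with nonzero dimensions,
a vector in it kills the matrix `t` of scalars by which the central partial traces act; the
corresponding combination of partial traces is zero in `H`, and factorizability then forces the
coefficients to vanish. -/
theorem isUnit_smatrix [IsAlgClosed k] [IsSemisimpleRing H] (hfact : IsFactorizable k H)
    {ι : Type*} [Fintype ι] [DecidableEq ι] {V : ι → WHRep k H} (hs : ∀ i, IsSimpleModule H (V i))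
    (hinj : ∀ i j, Nonempty (V i ≅ V j) → i = j)
    (hV : ∀ X : WHRep k H, IsSimpleModule H X → ∃ i, Nonempty (X ≅ V i)) {d : ι → k}
    (hd0 : ∀ j, d j ≠ 0) (hd : ∀ j, qtrace (𝟙 (V j)) = d j • 𝟙 _) {S : Matrix ι ι k}
    (hS : ∀ i j, qtrace ((β_ (V j) (V i)).hom ≫ (β_ (V i) (V j)).hom) = S i j • 𝟙 _) :
    IsUnit S := by
  have hc : ∀ i j, ∃ t : k, ∀ v : V j, partialTrace (qcharacter k (V i)) • v = t • v :=
    fun i j => by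
      let f : V j →ₗ[H] V j :=
        { toFun := fun v => partialTrace (qcharacter k (V i)) • v
          map_add' := smul_add _
          map_smul' := fun h v => by
            rw [RingHom.id_apply, smul_smul, smul_smul, partialTrace_qcharacter_central] }
      obtain ⟨t, ht⟩ := (bijective_smul_id_of_isSimpleModule (V j)).2 (ofHom f)
      exact ⟨t, fun v => (LinearMap.congr_fun ht v).symm⟩
  choose t ht using hc
  have hSt : ∀ i j, S i j = t i j * d j := fun i j =>
    qtrace_braiding_eq_mul (hS i j) (hd j) (ht i j)
  rw [← Matrix.vecMul_injective_iff_isUnit, ← Matrix.coe_vecMulLinear, ← LinearMap.ker_eq_bot,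
    LinearMap.ker_eq_bot']
  intro x hx
  have hxt : ∀ j, ∑ i, x i * t i j = 0 := fun j => by
    have h := congrFun hx j
    simp only [Matrix.vecMulLinear_apply, Matrix.vecMul, dotProduct, hSt, ← mul_assoc,
      ← Finset.sum_mul] at h
    exact (mul_eq_zero.mp h).resolve_right (hd0 j)
  -- It acts on `V j` by `∑ x i * t i j = 0`, for every `j`, and the simple modules are jointly
  -- faithful.
  have hp : partialTrace (∑ i, x i • qcharacter k (V i)) = 0 :=
    eq_zero_of_forall_smul_eq_zero hV fun j v => by
      rw [partialTrace_sum, Finset.sum_smul]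
      simp only [smul_assoc, ht, smul_smul]
      rw [← Finset.sum_smul, hxt, zero_smul]
  funext j
  obtain ⟨e, he, hej⟩ := exists_central_idempotent hs hinj hV j
  exact eq_zero_of_apply_centralizer
    (fun h hh => apply_eq_zero_of_partialTrace_eq_zero hfact hp hh) he hej (hd0 j) (hd j)

end Modular

end WeakHopf

theorem mainTheorem8 {k H : Type u} [Field k] [IsAlgClosed k] [Ring H] [Nontrivial H]
    [Algebra k H] [FiniteDimensional k H] [WeakHopf.WeakHopfAlgebra k H]
    [WeakHopf.QuasitriangularStructure k H] [WeakHopf.RibbonStructure k H]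
    (hconn : WeakHopf.IsConnected k H) (hfact : WeakHopf.IsFactorizable k H)
    (hint : ∃ l : H, WeakHopf.IsNormalizedIntegral k l) :
    ∃ (n : ℕ) (V : Fin n → WeakHopf.WHRep k H),
      (∀ i, IsSimpleModule H (V i)) ∧
      (∀ i j, Nonempty (V i ≅ V j) → i = j) ∧
      (∀ X : WeakHopf.WHRep k H, IsSimpleModule H X → ∃ i, Nonempty (X ≅ V i)) ∧
      WeakHopf.IsModularCategory k (WeakHopf.WHRep k H) V := by
  obtain ⟨l, hl⟩ := hint
  have hss : ∀ X : WeakHopf.WHRep k H, IsSemisimpleModule H X := fun X =>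
    WeakHopf.isSemisimpleModule_of_integral hl.left hl.targetCounit_eq_one X
  have : IsSemisimpleRing H :=
    WeakHopf.isSemisimpleModule_of_integral hl.left hl.targetCounit_eq_one H
  have h1 := WeakHopf.bijective_smul_id_unit hconn
  have := hss (𝟙_ (WeakHopf.WHRep k H))
  have := WeakHopf.isSimpleModule_of_bijective_smul_id _ h1
  -- Prescribing the unit as a representative makes it a member of the family on the nose.
  obtain ⟨n, V, hs, hinj, hV, hunit⟩ := WeakHopf.exists_simple_family (𝟙_ (WeakHopf.WHRep k H))
  choose S hS using fun i j =>
    h1.2 (WeakHopf.qtrace ((β_ (V j) (V i)).hom ≫ (β_ (V i) (V j)).hom))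
  choose d hd using fun j => h1.2 (WeakHopf.qtrace (𝟙 (V j)))
  have hd0 : ∀ j, d j ≠ 0 := fun j h => WeakHopf.qtrace_id_ne_zero hss h1 (V j)
    ((hd j).symm.trans (by simp only [h, zero_smul]))
  refine ⟨n, V, hs, hinj, hV, fun i => WeakHopf.bijective_smul_id_of_isSimpleModule (V i), hunit,
    fun i => ?_, fun X => ?_, S, fun i j => (hS i j).symm,
    WeakHopf.isUnit_smatrix hfact hs hinj hV hd0 (fun j => (hd j).symm) fun i j => (hS i j).symm⟩
  · obtain ⟨j, ⟨f⟩⟩ := hV (V i)ᘁ (WeakHopf.isSimpleModule_dual WeakHopf.antipode_surjective (V i))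
    exact ⟨j, ⟨f.symm⟩⟩
  · have := hss X
    exact WeakHopf.exists_domination hV X
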